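/- Consider a multi-source M/G/1/1 system with a finite set $\mathcal C$ of sources. Source $c\in\mathcal C$ generates packets according to a Poisson process of rate $\lambda_c>0$ on $[0,\infty)$, and a packet arrives at the server at the instant it is generated. The service times of all packets are i.i.d. copies of a random variable $S\ge 0$ with an arbitrary distribution. The Poisson processes of the different sources and the service times are independent. Put $\lambda=\sum_{c\in\mathcal C}\lambda_c$, $M_S(u)=\mathbb E[e^{uS}]$ and $L_\lambda=\mathbb E[e^{-\lambda S}]$. The server works under the source-agnostic preemptive policy: there is no waiting room, and an arriving packet enters service immediately, preempting (discarding) the packet in service, if any, whatever its source. The system starts empty at time $0$. A packet whose service is completed without preemption is delivered to the sink. Fix $c\in\mathcal C$. Let $t_{c,i}$ and $t'_{c,i}$ ($i=1,2,\dots$) be the generation and the delivery time of the $i$-th delivered packet of source $c$. The age of information (AoI) of source $c$ at time $t$ is $\delta_c(t)=t-U_c(t)$, where $U_c(t)$ is the generation time of the packet of source $c$ most recently delivered by time $t$ (before the first delivery, $U_c(t)$ is an arbitrary real random variable $U_0$). For $i\ge 2$ the $i$-th peak AoI is $A_{c,i}=(t'_{c,i}-t'_{c,i-1})+(t'_{c,i-1}-t_{c,i-1})$,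 the value of the AoI immediately before the $i$-th delivery. Then the AoI has a stationary law $\nu_c$: as $t\to\infty$ the law of $\delta_c(t)$ converges weakly to $\nu_c$, and for every bounded continuous $f:\mathbb R\to\mathbb R$, almost surely $\frac1\tau\int_0^\tau f(\delta_c(t))\,\mathrm dt\to\int f\,\mathrm d\nu_c$ as $\tau\to\infty$. Let $\delta_c$ denote a random variable with law $\nu_c$. For real $s$ and every $i\ge2$, each of $\mathbb E[e^{s\delta_c}]$ and $\mathbb E[e^{sA_{c,i}}]$ is finite if and only if $s<\lambda$ and $s<\lambda_cM_S(s-\lambda)$ (which holds for all $s\le0$ and in a neighbourhood of $0$), and for these $s$ $$\mathbb E[e^{s\delta_c}]=\frac{\lambda_cM_S(s-\lambda)}{\lambda_cM_S(s-\lambda)-s},\qquad \mathbb E[e^{sA_{c,i}}]=\frac{\lambda_c\,M_S(s-\lambda)^2}{L_\lambda\,\bigl(\lambda_cM_S(s-\lambda)-s\bigr)}.$$ -/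

import Mathlib

open MeasureTheory ProbabilityTheory Filter
open scoped Topology BoundedContinuousFunction

namespace AoI

noncomputable section

/-- Probabilistic input of the multi-source M/G/1/1 system with sources `ι`, on `(Ω, P)`.
`X c k` is the `k`-th interarrival time of source `c` (the time from `0` to the first arrival if
`k = 0`) and `S c k` is the service time of the `k`-th packet of source `c`. Source `c` generates a
Poisson process of rate `rate c` (i.i.d. exponential interarrival times), the service times are
i.i.d. with law `σ`, and the sources and the service times are mutually independent. -/
structure IsMG11Input {ι Ω : Type*} [MeasurableSpace Ω] (P : Measure Ω) (rate : ι → ℝ)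
    (σ : Measure ℝ) (X S : ι → ℕ → Ω → ℝ) : Prop where
  interarrival_law : ∀ c k, HasLaw (X c k) (expMeasure (rate c)) P
  service_law : ∀ c k, HasLaw (S c k) σ P
  indep : iIndepFun
    (Sum.elim (fun p : ι × ℕ => X p.1 p.2) (fun p : ι × ℕ => S p.1 p.2)) P

variable {ι Ω : Type*} (X S : ι → ℕ → Ω → ℝ)

/-- Generation (and arrival) time of the `n`-th packet of source `c`, `n = 0, 1, …`. -/
def genTime (c : ι) (n : ℕ) (ω : Ω) : ℝ := ∑ k ∈ Finset.range (n + 1), X c k ω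

/-- Source-agnostic preemption: every arriving packet enters service at once, replacing whatever
packet is in service. So the `n`-th packet of source `c` is preempted if and only if some packet,
of whatever source, arrives after it and before its service is complete. -/
def Preempted (c : ι) (n : ℕ) (ω : Ω) : Prop :=
  ∃ (d : ι) (m : ℕ), genTime X c n ω < genTime X d m ω ∧
    genTime X d m ω < genTime X c n ω + S c n ω

/-- Index, among all the packets of source `c`, of the `i`-th delivered (that is, not preempted)
packet of source `c`, `i = 0, 1, …`. -/
def deliveredIndex (c : ι) (i : ℕ) (ω : Ω) : ℕ := Nat.nth (fun n => ¬ Preempted X S c n ω) i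

/-- Generation time of the `i`-th delivered packet of source `c`. -/
def deliveredGen (c : ι) (i : ℕ) (ω : Ω) : ℝ := genTime X c (deliveredIndex X S c i ω) ω

/-- The time at which the `i`-th delivered packet of source `c` arrives at the sink. -/
def deliveryTime (c : ι) (i : ℕ) (ω : Ω) : ℝ :=
  deliveredGen X S c i ω + S c (deliveredIndex X S c i ω) ω

/-- System time of the `i`-th delivered packet of source `c`. -/
def systemTime (c : ι) (i : ℕ) (ω : Ω) : ℝ := deliveryTime X S c i ω - deliveredGen X S c i ω

/-- Time between the deliveries of the `i`-th and the `(i+1)`-st delivered packet of source `c`. -/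
def interdeparture (c : ι) (i : ℕ) (ω : Ω) : ℝ :=
  deliveryTime X S c (i + 1) ω - deliveryTime X S c i ω

/-- Peak AoI of source `c` at the delivery of its `(i+1)`-st delivered packet (counted from `0`):
the value of the AoI immediately before that delivery. -/
def peakAoI (c : ι) (i : ℕ) (ω : Ω) : ℝ := interdeparture X S c i ω + systemTime X S c i ω

open Classical in
/-- Time stamp of the packet of source `c` most recently received at the sink by time `τ`; the
random variable `U₀` is the time stamp that the sink holds before the first delivery. -/
def timeStamp (U₀ : Ω → ℝ) (c : ι) (τ : ℝ) (ω : Ω) : ℝ :=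
  if ∃ i, deliveryTime X S c i ω ≤ τ
  then deliveredGen X S c (sSup {i : ℕ | deliveryTime X S c i ω ≤ τ}) ω
  else U₀ ω

/-- The AoI of source `c` at the sink at time `τ`. -/
def age (U₀ : Ω → ℝ) (c : ι) (τ : ℝ) (ω : Ω) : ℝ := τ - timeStamp X S U₀ c τ ω

/-- `ν` is the stationary law of the real-valued ergodic process `Z`: the law of `Z t` converges
weakly to `ν` as `t → ∞`, and the time averages of bounded continuous observables along almost
every path converge to their expectation under `ν`. -/
structure IsStationaryLaw [MeasurableSpace Ω] (P : Measure Ω) [IsProbabilityMeasure P]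
    (Z : ℝ → Ω → ℝ) (ν : Measure ℝ) [IsProbabilityMeasure ν] : Prop where
  tendsto_law : TendstoInDistribution Z atTop (id : ℝ → ℝ) (fun _ => P) ν
  tendsto_timeAverage : ∀ f : ℝ →ᵇ ℝ, ∀ᵐ ω ∂P,
    Tendsto (fun τ : ℝ => τ⁻¹ * ∫ t in (0 : ℝ)..τ, f (Z t ω)) atTop (𝓝 (∫ x, f x ∂ν))

end

end AoI

/-! Under preemption the fate of a packet depends only on arrivals after its own, so the packets
generated after a time `u` behave as if the system started empty at `u`. Once source `c` has
delivered, its age at `t` is below `x` exactly when some packet of `c` generated after `t - x` is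
delivered by `t`, which is the event `receivedWithin c (t - x) t` (`IsRecurrent.sysAge_lt_iff`). By
the Markov property of the Poisson paths (`map_past_future_pathLaw`) this event is as likely as a
first delivery by time `x` in a system started empty. Hence the stationary law is the law of the
first delivery time (`ageLaw`), which has no atoms. Events for windows that do not overlap are
independent (`sysLaw_receivedWithin_inter`), and a law of large numbers over blocks of windows gives
the time averages.

For the moments, pair each interarrival time `X` of source `c` with the service time `S` of the
packet before it, and mark the pair by the fate of that packet. Given the path of `c`, the packet is
delivered iff `S ≤ X` and the other sources, of total rate `μ`, are silent for a time `S`, which has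
probability `exp (-μ S)`. Silent windows with `S ≤ X` do not overlap, so the marked pairs are
independent (`iIndepFun_markedGap`). Write `r` for the rate of `c`, `λ` for the total rate, and `m =
M (s - λ)`. For `s < r` one finds `E[exp (s X); delivered] = r m / (r - s)`, `E[exp (s S);
delivered] = m`, and `E[exp (s X); lost] = ℓ = r (1 - m) / (r - s)`.

The first delivery time is one interarrival time, a run of interarrival times after lost packets,
and the service time of a delivered packet. Its moment is `r / (r - s) * (∑ ℓ ^ j) * m = r m / (r m
- s)` (`lintegral_exp_firstDelivery`). The peak age starts instead with the interarrival time after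
a delivered packet, and conditioning on that delivery divides by `L` (`lintegral_exp_sysPeak`). All
moments are computed in `[0, ∞]`, so the finiteness criterion is read off the same formulas: for `s
< r` the geometric series converges iff `ℓ < 1`, that is, iff `s < r m`; for `s ≥ r` the first
factor is infinite. -/

namespace AoI

open scoped ENNReal

/-! ### The exponential law -/

/-- The density is finite, so `g` need not be measurable. This spares measurability proofs for the
iterated integrals to which memorylessness is applied. -/
lemma lintegral_expMeasure (r : ℝ) (g : ℝ → ℝ≥0∞) :
    ∫⁻ x, g x ∂(expMeasure r) =
      ∫⁻ x in Set.Ioi 0, ENNReal.ofReal (r * Real.exp (-(r * x))) * g x := by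
  have h1 : expMeasure r = volume.withDensity (exponentialPDF r) := rfl
  have h2 : Measurable (exponentialPDF r) := (measurable_exponentialPDFReal r).ennreal_ofReal
  rw [h1, lintegral_withDensity_eq_lintegral_mul_non_measurable₀ _ h2.aemeasurable
    (Eventually.of_forall fun _ => ENNReal.ofReal_lt_top),
    ← setLIntegral_congr Ioi_ae_eq_Ici.symm, ← lintegral_indicator measurableSet_Ici]
  refine lintegral_congr fun x => ?_
  by_cases hx : 0 ≤ x
  · simp [Set.indicator_of_mem (Set.mem_Ici.2 hx), exponentialPDF_of_nonneg hx]
  · rw [Set.indicator_of_notMem (by simpa using hx)]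
    simp [exponentialPDF_of_neg (not_le.1 hx)]

/-- Memorylessness of the exponential law. -/
lemma setLIntegral_Ioi_expMeasure_sub (r : ℝ) {u : ℝ} (hu : 0 ≤ u) (g : ℝ → ℝ≥0∞) :
    ∫⁻ x in Set.Ioi u, g (x - u) ∂(expMeasure r) =
      ENNReal.ofReal (Real.exp (-(r * u))) * ∫⁻ x, g x ∂(expMeasure r) := by
  rw [← lintegral_indicator measurableSet_Ioi, lintegral_expMeasure, lintegral_expMeasure,
    ← lintegral_const_mul' _ _ ENNReal.ofReal_ne_top, ← lintegral_indicator measurableSet_Ioi,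
    ← lintegral_indicator measurableSet_Ioi, ← lintegral_add_right_eq_self _ u]
  refine lintegral_congr fun x => ?_
  by_cases hx : 0 < x
  · have hx0 : (0 : ℝ) < x + u := by linarith
    have hx1 : u < x + u := by linarith
    rw [Set.indicator_of_mem (Set.mem_Ioi.2 hx0), Set.indicator_of_mem (Set.mem_Ioi.2 hx1),
      Set.indicator_of_mem (Set.mem_Ioi.2 hx), ← mul_assoc,
      ← ENNReal.ofReal_mul (Real.exp_pos _).le, mul_left_comm, ← Real.exp_add, add_sub_cancel_right]
    ring_nf
  · have hx1 : ¬ u < x + u := by simpa using hx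
    rw [Set.indicator_of_notMem (s := Set.Ioi (0 : ℝ)) (a := x) (by simpa using hx)]
    simp [Set.indicator_apply, hx]

lemma expMeasure_Ioi {r : ℝ} (hr : 0 < r) {u : ℝ} (hu : 0 ≤ u) :
    expMeasure r (Set.Ioi u) = ENNReal.ofReal (Real.exp (-(r * u))) := by
  have := isProbabilityMeasure_expMeasure hr
  simpa using setLIntegral_Ioi_expMeasure_sub r hu (fun _ => 1)

lemma expMeasure_Ici {r : ℝ} (hr : 0 < r) {u : ℝ} (hu : 0 ≤ u) :
    expMeasure r (Set.Ici u) = ENNReal.ofReal (Real.exp (-(r * u))) := by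
  rw [← expMeasure_Ioi hr hu]
  have hac : expMeasure r ≪ volume := withDensity_absolutelyContinuous _ _
  exact measure_congr (hac.ae_eq Ioi_ae_eq_Ici.symm)

lemma ae_pos_expMeasure {r : ℝ} (hr : 0 < r) : ∀ᵐ x ∂(expMeasure r), 0 < x := by
  have := isProbabilityMeasure_expMeasure hr
  exact (prob_compl_eq_zero_iff measurableSet_Ioi).2 (by simp [expMeasure_Ioi hr le_rfl])

/-! ### Paths of a single source -/

/-- A path of one source: the sequence of interarrival times and service times. -/
abbrev Path := ℕ → ℝ × ℝ

/-- The `n`-th arrival time of a path. -/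
noncomputable def arrival (w : Path) (n : ℕ) : ℝ := ∑ k ∈ Finset.range (n + 1), (w k).1

/-- Prepend a packet to a path. -/
def consPath (z : ℝ × ℝ) (w : Path) : Path
  | 0 => z
  | k + 1 => w k

/-- The law of a path with exponential interarrival times and i.i.d. service times. -/
noncomputable def pathLaw (r : ℝ) (σ : Measure ℝ) : Measure Path :=
  Measure.infinitePi fun _ => (expMeasure r).prod σ

lemma arrival_zero (w : Path) : arrival w 0 = (w 0).1 := by simp [arrival]

lemma arrival_succ (w : Path) (n : ℕ) : arrival w (n + 1) = arrival w n + (w (n + 1)).1 := by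
  simp [arrival, Finset.sum_range_succ _ (n + 1)]

lemma arrival_cons_zero (z : ℝ × ℝ) (w : Path) : arrival (consPath z w) 0 = z.1 := by
  simp [arrival, consPath]

lemma arrival_cons_succ (z : ℝ × ℝ) (w : Path) (n : ℕ) :
    arrival (consPath z w) (n + 1) = z.1 + arrival w n := by
  simp only [arrival]
  rw [Finset.sum_range_succ']
  simp [consPath, add_comm]

@[fun_prop]
lemma measurable_arrival (n : ℕ) : Measurable fun w : Path => arrival w n := by
  unfold arrival; fun_prop

lemma measurable_consPath : Measurable fun q : (ℝ × ℝ) × Path => consPath q.1 q.2 := by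
  refine measurable_pi_lambda _ fun k => ?_
  cases k with
  | zero => exact measurable_fst
  | succ k => exact (measurable_pi_apply k).comp measurable_snd

lemma measurable_consPath_right (z : ℝ × ℝ) : Measurable (consPath z) :=
  measurable_consPath.comp measurable_prodMk_left

section Law

variable {r : ℝ} {σ : Measure ℝ}

lemma isProbabilityMeasure_pathLaw (hr : 0 < r) [IsProbabilityMeasure σ] :
    IsProbabilityMeasure (pathLaw r σ) := by
  have := isProbabilityMeasure_expMeasure hr
  unfold pathLaw; infer_instance

/-- An i.i.d. sequence keeps its law when an independent copy of one entry is prepended. This is the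
source of every first-packet decomposition below. -/
lemma map_consPath_pathLaw (hr : 0 < r) [IsProbabilityMeasure σ] :
    (((expMeasure r).prod σ).prod (pathLaw r σ)).map (fun q => consPath q.1 q.2) =
      pathLaw r σ := by
  have := isProbabilityMeasure_expMeasure hr
  have := isProbabilityMeasure_pathLaw (σ := σ) hr
  refine Measure.eq_infinitePi _ fun s t ht => ?_
  set κ := (expMeasure r).prod σ
  -- Padding the cylinder with trivial factors to an initial segment of indices makes its preimage a
  -- product of coordinate `0` and a cylinder in the tail.
  let t' : ℕ → Set (ℝ × ℝ) := fun i => if i ∈ s then t i else Set.univ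
  have ht' : ∀ i, MeasurableSet (t' i) := fun i => by
    by_cases hi : i ∈ s <;> simp [t', hi, ht]
  let N := s.sup id + 1
  have hsN : s ⊆ Finset.range (N + 1) := fun i hi => by
    have : i ≤ s.sup id := Finset.le_sup (f := id) hi
    simp [N]; omega
  have hpi : Set.pi (s : Set ℕ) t = Set.pi (Finset.range (N + 1) : Set ℕ) t' := by
    ext w
    simp only [Set.mem_pi, Finset.mem_coe]
    refine ⟨fun h i _ => ?_, fun h i hi => ?_⟩
    · by_cases his : i ∈ s <;> simp [t', his, h]
    · simpa [t', hi] using h i (hsN hi)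
  have hprod : ∏ i ∈ s, κ (t i) = ∏ i ∈ Finset.range (N + 1), κ (t' i) := by
    rw [← Finset.prod_subset hsN (fun i _ hi => by simp [t', hi])]
    exact Finset.prod_congr rfl fun i hi => by simp [t', hi]
  have hpre : (fun q : (ℝ × ℝ) × Path => consPath q.1 q.2) ⁻¹'
      Set.pi (Finset.range (N + 1) : Set ℕ) t' =
      t' 0 ×ˢ Set.pi (Finset.range N : Set ℕ) (fun i => t' (i + 1)) := by
    ext ⟨z, w⟩
    simp only [Set.mem_preimage, Set.mem_pi, Finset.coe_range, Set.mem_Iio, Set.mem_prod]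
    refine ⟨fun h => ⟨h 0 (by omega), fun i hi => h (i + 1) (by omega)⟩, fun h i hi => ?_⟩
    cases i with
    | zero => exact h.1
    | succ i => exact h.2 i (by omega)
  rw [hpi, hprod, Measure.map_apply measurable_consPath
    (MeasurableSet.pi (Finset.countable_toSet _) fun i _ => ht' i), hpre, Measure.prod_prod,
    pathLaw, Measure.infinitePi_pi _ (fun i _ => ht' (i + 1)), Finset.prod_range_succ' _ N, mul_comm]

lemma pathLaw_apply_eq_lintegral (hr : 0 < r) [IsProbabilityMeasure σ] {C : Set Path}
    (hC : MeasurableSet C) :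
    pathLaw r σ C =
      ∫⁻ x, ∫⁻ y, pathLaw r σ (consPath (x, y) ⁻¹' C) ∂σ ∂(expMeasure r) := by
  have := isProbabilityMeasure_expMeasure hr
  have := isProbabilityMeasure_pathLaw (σ := σ) hr
  conv_lhs => rw [← map_consPath_pathLaw hr, Measure.map_apply measurable_consPath hC,
    Measure.prod_apply (measurable_consPath hC)]
  rw [lintegral_prod _ (measurable_measure_prodMk_left (measurable_consPath hC)).aemeasurable]
  rfl

end Law

/-! ### Splitting a path at a deterministic time -/

/-- The event that the `n`-th packet is the first one arriving after time `u`. -/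
def firstAfter (u : ℝ) (n : ℕ) : Set Path := {w | u < arrival w n ∧ ∀ k < n, arrival w k ≤ u}

open Classical in
/-- The part of a path up to time `u`; the packets after `u` are replaced by `(b, 0)`. -/
noncomputable def past (b u : ℝ) (w : Path) : Path := fun k =>
  if ∀ j ≤ k, arrival w j ≤ u then w k else (b, 0)

/-- The path from the `n`-th packet on, seen from time `u`. -/
noncomputable def shiftAt (u : ℝ) (n : ℕ) (w : Path) : Path := fun k =>
  if k = 0 then (arrival w n - u, (w n).2) else w (n + k)

/-- The index of the first packet after time `u`. -/
noncomputable def indexAfter (u : ℝ) (w : Path) : ℕ := sInf {n | u < arrival w n}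

/-- The path after time `u`, seen from time `u`. -/
noncomputable def future (u : ℝ) (w : Path) : Path := shiftAt u (indexAfter u w) w

lemma measurableSet_firstAfter (u : ℝ) (n : ℕ) : MeasurableSet (firstAfter u n) := by
  have : firstAfter u n = {w | u < arrival w n} ∩ ⋂ k, ⋂ (_ : k < n), {w | arrival w k ≤ u} := by
    ext w; simp [firstAfter]
  rw [this]
  exact (measurableSet_lt measurable_const (by fun_prop)).inter
    (.iInter fun k => .iInter fun _ => measurableSet_le (by fun_prop) measurable_const)

lemma measurable_past (b u : ℝ) : Measurable (past b u) := by
  refine measurable_pi_lambda _ fun k => ?_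
  refine Measurable.ite ?_ (by fun_prop) measurable_const
  have : {w : Path | ∀ j ≤ k, arrival w j ≤ u} = ⋂ j, ⋂ (_ : j ≤ k), {w | arrival w j ≤ u} := by
    ext w; simp
  rw [this]
  exact .iInter fun k => .iInter fun _ => measurableSet_le (by fun_prop) measurable_const

lemma measurable_shiftAt (u : ℝ) (n : ℕ) : Measurable (shiftAt u n) := by
  refine measurable_pi_lambda _ fun k => ?_
  by_cases hk : k = 0
  · simp only [shiftAt, hk, if_true]; fun_prop
  · simp only [shiftAt, hk, if_false]; fun_prop

lemma indexAfter_eq {u : ℝ} {n : ℕ} {w : Path} (h : w ∈ firstAfter u n) : indexAfter u w = n :=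
  le_antisymm (Nat.sInf_le h.1) (not_lt.1 fun hlt =>
    absurd (Nat.sInf_mem (s := {n | u < arrival w n}) ⟨n, h.1⟩) (not_lt.2 (h.2 _ hlt)))

lemma mem_firstAfter_indexAfter {u : ℝ} {w : Path} (h : ∃ n, u < arrival w n) :
    w ∈ firstAfter u (indexAfter u w) :=
  ⟨Nat.sInf_mem (s := {n | u < arrival w n}) h,
    fun _ hk => not_lt.1 fun hlt => Nat.notMem_of_lt_sInf hk hlt⟩

lemma measurable_indexAfter (u : ℝ) : Measurable (indexAfter u) := by
  refine measurable_to_countable' fun n => ?_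
  -- A path that never passes `u` gets the default `sInf ∅ = 0`, which accounts for the second set
  -- when `n = 0`.
  have : indexAfter u ⁻¹' {n} =
      firstAfter u n ∪ ({w | n = 0} ∩ ⋂ k, {w | arrival w k ≤ u}) := by
    ext w
    simp only [Set.mem_preimage, Set.mem_singleton_iff, Set.mem_union, Set.mem_inter_iff,
      Set.mem_ofPred_eq, Set.mem_iInter]
    constructor
    · intro h
      by_cases hex : ∃ n, u < arrival w n
      · exact Or.inl (h ▸ mem_firstAfter_indexAfter hex)
      · push Not at hex
        refine Or.inr ⟨?_, hex⟩
        rw [← h, indexAfter, show {n | u < arrival w n} = ∅ by ext; simp [hex], Nat.sInf_empty]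
    · rintro (h | ⟨rfl, h⟩)
      · exact indexAfter_eq h
      · rw [indexAfter, show {n | u < arrival w n} = ∅ by ext; simp [h], Nat.sInf_empty]
  rw [this]
  exact (measurableSet_firstAfter u n).union ((MeasurableSet.const _).inter
    (.iInter fun k => measurableSet_le (by fun_prop) measurable_const))

lemma measurable_future (u : ℝ) : Measurable (future u) := by
  refine measurable_from_prod_countable_right (f := fun q : ℕ × Path => shiftAt u q.1 q.2)
    (fun n => measurable_shiftAt u n) |>.comp ((measurable_indexAfter u).prodMk measurable_id)

lemma cons_mem_firstAfter_zero {u : ℝ} {z : ℝ × ℝ} {w : Path} :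
    consPath z w ∈ firstAfter u 0 ↔ u < z.1 := by
  simp [firstAfter, arrival_cons_zero]

/-- Removing a first packet that arrives at `z.1 ≤ u` leaves the same situation with remaining time
`u - z.1`. Together with the analogous lemmas for `past` and `shiftAt`, this drives the induction in
`pathLaw_firstAfter_inter`. -/
lemma cons_mem_firstAfter_succ {u : ℝ} {n : ℕ} {z : ℝ × ℝ} {w : Path} :
    consPath z w ∈ firstAfter u (n + 1) ↔ z.1 ≤ u ∧ w ∈ firstAfter (u - z.1) n := by
  simp only [firstAfter, Set.mem_ofPred_eq, arrival_cons_succ]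
  constructor
  · rintro ⟨h1, h2⟩
    refine ⟨by simpa [arrival_cons_zero] using h2 0 (by omega), by linarith, fun k hk => ?_⟩
    have := h2 (k + 1) (by omega)
    rw [arrival_cons_succ] at this
    linarith
  · rintro ⟨h0, h1, h2⟩
    refine ⟨by linarith, fun k hk => ?_⟩
    cases k with
    | zero => simpa [arrival_cons_zero] using h0
    | succ k =>
      rw [arrival_cons_succ]
      linarith [h2 k (by omega)]

lemma past_cons_of_lt {b u : ℝ} {z : ℝ × ℝ} {w : Path} (h : u < z.1) :
    past b u (consPath z w) = fun _ => (b, 0) := by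
  funext k
  rw [past, if_neg]
  intro hk
  have := hk 0 (Nat.zero_le _)
  rw [arrival_cons_zero] at this
  linarith

lemma past_cons_of_le {b u : ℝ} {z : ℝ × ℝ} {w : Path} (h : z.1 ≤ u) :
    past b u (consPath z w) = consPath z (past b (u - z.1) w) := by
  funext k
  cases k with
  | zero => simp [past, arrival_cons_zero, h, consPath]
  | succ k =>
    have : (∀ j ≤ k + 1, arrival (consPath z w) j ≤ u) ↔ ∀ j ≤ k, arrival w j ≤ u - z.1 := by
      constructor
      · intro H j hj
        have := H (j + 1) (by omega)
        rw [arrival_cons_succ] at this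
        linarith
      · intro H j hj
        cases j with
        | zero => simpa [arrival_cons_zero] using h
        | succ j =>
          rw [arrival_cons_succ]
          linarith [H j (by omega)]
    simp only [past, this, consPath]

lemma shiftAt_zero_cons (u : ℝ) (z : ℝ × ℝ) (w : Path) :
    shiftAt u 0 (consPath z w) = consPath (z.1 - u, z.2) w := by
  funext k
  cases k with
  | zero => simp [shiftAt, arrival_cons_zero, consPath]
  | succ k => simp [shiftAt, consPath]

lemma shiftAt_succ_cons (u : ℝ) (n : ℕ) (z : ℝ × ℝ) (w : Path) :
    shiftAt u (n + 1) (consPath z w) = shiftAt (u - z.1) n w := by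
  funext k
  cases k with
  | zero =>
    simp only [shiftAt, arrival_cons_succ, consPath, if_true, Prod.mk.injEq, and_true]
    ring
  | succ k =>
    simp only [shiftAt, consPath, Nat.succ_ne_zero, if_false]
    rw [show n + (k + 1) = n + 1 + k by ring]
    rfl

section Markov

variable {r : ℝ} {σ : Measure ℝ}

/-- Induction on the number of packets up to `u`, peeling off the first one; hence the generality in
`u` and `A`. If there is none, the past is a constant path, and by memorylessness the residual time
to the first arrival is again exponential. -/
lemma pathLaw_firstAfter_inter (hr : 0 < r) [IsProbabilityMeasure σ] (b : ℝ) (n : ℕ) :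
    ∀ {u : ℝ}, 0 ≤ u → ∀ {A B : Set Path}, MeasurableSet A → MeasurableSet B →
      pathLaw r σ (firstAfter u n ∩ past b u ⁻¹' A ∩ shiftAt u n ⁻¹' B) =
        pathLaw r σ (firstAfter u n ∩ past b u ⁻¹' A) * pathLaw r σ B := by
  have := isProbabilityMeasure_expMeasure hr
  have := isProbabilityMeasure_pathLaw (σ := σ) hr
  induction n with
  | zero =>
    intro u hu A B hA hB
    have hmA := (measurableSet_firstAfter u 0).inter (measurable_past b u hA)
    rw [pathLaw_apply_eq_lintegral hr (hmA.inter (measurable_shiftAt u 0 hB)),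
      pathLaw_apply_eq_lintegral hr hmA, pathLaw_apply_eq_lintegral hr hB]
    -- When the first arrival comes after `u`, the past is this one constant path, so the condition
    -- on `A` holds always or never.
    by_cases hc : (fun _ => (b, 0) : Path) ∈ A
    · have h1 : ∀ x y, consPath (x, y) ⁻¹' (firstAfter u 0 ∩ past b u ⁻¹' A) =
          {_w | u < x} := by
        intro x y
        ext w
        simp only [Set.mem_preimage, Set.mem_inter_iff, cons_mem_firstAfter_zero,
          Set.mem_ofPred_eq, and_iff_left_iff_imp]
        intro hx
        rwa [past_cons_of_lt hx]
      have h2 : ∀ x y, pathLaw r σ (consPath (x, y) ⁻¹'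
          (firstAfter u 0 ∩ past b u ⁻¹' A ∩ shiftAt u 0 ⁻¹' B)) =
          (Set.Ioi u).indicator
            (fun x => pathLaw r σ (consPath (x - u, y) ⁻¹' B)) x := by
        intro x y
        rw [Set.preimage_inter, h1]
        by_cases hx : u < x
        · rw [Set.indicator_of_mem (Set.mem_Ioi.2 hx)]
          congr 1
          ext w
          simp [hx, shiftAt_zero_cons]
        · rw [Set.indicator_of_notMem (by simpa using hx)]
          simp [hx]
      have h3 : ∀ x, ∫⁻ y, (Set.Ioi u).indicator
            (fun x => pathLaw r σ (consPath (x - u, y) ⁻¹' B)) x ∂σ =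
          (Set.Ioi u).indicator
            (fun x => ∫⁻ y, pathLaw r σ (consPath (x - u, y) ⁻¹' B) ∂σ) x := by
        intro x
        by_cases hx : u < x
        · simp [hx]
        · simp [hx]
      have h4 : ∀ x : ℝ, ∫⁻ _y, pathLaw r σ {_w : Path | u < x} ∂σ =
          (Set.Ioi u).indicator (fun _ => 1) x := by
        intro x
        by_cases hx : u < x <;> simp [hx]
      simp_rw [h2, h3, h1, h4]
      rw [lintegral_indicator measurableSet_Ioi, lintegral_indicator measurableSet_Ioi,
        setLIntegral_Ioi_expMeasure_sub r hu
          (fun x => ∫⁻ y, pathLaw r σ (consPath (x, y) ⁻¹' B) ∂σ)]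
      simp [expMeasure_Ioi hr hu]
    · have h1 : ∀ x y, consPath (x, y) ⁻¹' (firstAfter u 0 ∩ past b u ⁻¹' A) = ∅ := by
        intro x y
        ext w
        simp only [Set.mem_preimage, Set.mem_inter_iff, cons_mem_firstAfter_zero,
          Set.mem_empty_iff_false, iff_false, not_and]
        intro hx
        rwa [past_cons_of_lt hx]
      simp [Set.preimage_inter (t := shiftAt u 0 ⁻¹' B), h1]
  | succ n ih =>
    intro u hu A B hA hB
    have hmA := (measurableSet_firstAfter u (n + 1)).inter (measurable_past b u hA)
    rw [pathLaw_apply_eq_lintegral hr (hmA.inter (measurable_shiftAt u (n + 1) hB)),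
      pathLaw_apply_eq_lintegral hr hmA, ← lintegral_mul_const' _ _ (measure_ne_top _ _)]
    refine lintegral_congr fun x => ?_
    rw [← lintegral_mul_const' _ _ (measure_ne_top _ _)]
    refine lintegral_congr fun y => ?_
    by_cases hx : x ≤ u
    · have h1 : consPath (x, y) ⁻¹' (firstAfter u (n + 1) ∩ past b u ⁻¹' A) =
          firstAfter (u - x) n ∩ past b (u - x) ⁻¹' (consPath (x, y) ⁻¹' A) := by
        ext w
        simp only [Set.mem_preimage, Set.mem_inter_iff, cons_mem_firstAfter_succ, hx, true_and]
        rw [past_cons_of_le (by exact hx)]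
      have h2 : consPath (x, y) ⁻¹' (shiftAt u (n + 1) ⁻¹' B) = shiftAt (u - x) n ⁻¹' B := by
        ext w
        simp only [Set.mem_preimage, shiftAt_succ_cons]
      rw [Set.preimage_inter, h1, h2]
      -- The removed packet is absorbed into the event about the past, which becomes its preimage
      -- under prepending that packet.
      exact ih (sub_nonneg.2 hx) (measurable_consPath_right _ hA) hB
    · have h1 : consPath (x, y) ⁻¹' (firstAfter u (n + 1) ∩ past b u ⁻¹' A) = ∅ := by
        ext w
        simp [cons_mem_firstAfter_succ, hx]
      simp [Set.preimage_inter (t := shiftAt u (n + 1) ⁻¹' B), h1]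

end Markov

/-! ### Regular paths and the Markov property at a deterministic time. -/

/-- Paths with positive interarrival times, nonnegative service times and finitely many arrivals in
bounded time intervals. -/
structure IsRegular (w : Path) : Prop where
  pos : ∀ k, 0 < (w k).1
  nonneg : ∀ k, 0 ≤ (w k).2
  unbounded : ∀ u, ∃ n, u < arrival w n

namespace IsRegular

variable {w : Path}

lemma strictMono (h : IsRegular w) : StrictMono (arrival w) :=
  strictMono_nat_of_lt_succ fun n => by rw [arrival_succ]; linarith [h.pos (n + 1)]

lemma arrival_pos (h : IsRegular w) (n : ℕ) : 0 < arrival w n :=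
  Finset.sum_pos (fun k _ => h.pos k) (by simp)

lemma mem_firstAfter (h : IsRegular w) (u : ℝ) : w ∈ firstAfter u (indexAfter u w) :=
  mem_firstAfter_indexAfter (h.unbounded u)

lemma indexAfter_le_iff (h : IsRegular w) {u : ℝ} {n : ℕ} :
    indexAfter u w ≤ n ↔ u < arrival w n :=
  ⟨fun hn => (h.mem_firstAfter u).1.trans_le (h.strictMono.monotone hn), fun hn => Nat.sInf_le hn⟩

end IsRegular

lemma arrival_future (u : ℝ) (w : Path) (k : ℕ) :
    arrival (future u w) k = arrival w (indexAfter u w + k) - u := by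
  induction k with
  | zero => simp [arrival_zero, future, shiftAt]
  | succ k ih =>
    rw [arrival_succ, ih, ← add_assoc, arrival_succ]
    simp [future, shiftAt, add_assoc]
    ring

lemma future_snd (u : ℝ) (w : Path) (k : ℕ) : (future u w k).2 = (w (indexAfter u w + k)).2 := by
  by_cases hk : k = 0 <;> simp [future, shiftAt, hk]

section Past

variable {w : Path} {b v : ℝ}

lemma past_of_arrival_le (h : IsRegular w) {m j : ℕ} (hm : arrival w m ≤ v) (hj : j ≤ m) :
    past b v w j = w j :=
  if_pos fun _ hi => (h.strictMono.monotone (hi.trans hj)).trans hm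

lemma arrival_past_of_le (h : IsRegular w) {m : ℕ} (hm : arrival w m ≤ v) :
    arrival (past b v w) m = arrival w m :=
  Finset.sum_congr rfl fun j hj => by
    rw [past_of_arrival_le h hm (Nat.lt_succ_iff.1 (Finset.mem_range.1 hj))]

lemma past_fst_nonneg (h : IsRegular w) (hb : 0 ≤ b) (k : ℕ) : 0 ≤ (past b v w k).1 := by
  unfold past
  split_ifs
  exacts [(h.pos k).le, hb]

lemma past_snd_nonneg (h : IsRegular w) (k : ℕ) : 0 ≤ (past b v w k).2 := by
  unfold past
  split_ifs
  exacts [h.nonneg k, le_rfl]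

/-- The filler `b` alone exceeds `v`, so the cut path still records that an arrival came after `v`.
This is why `past` is used with a filler larger than the cutting time. -/
lemma lt_arrival_past (h : IsRegular w) (hv : 0 ≤ v) (hb : v < b) {m : ℕ} (hm : v < arrival w m) :
    v < arrival (past b v w) m := by
  have h1 : (past b v w m).1 = b := by
    rw [past, if_neg fun H => absurd (H m le_rfl) (not_le.2 hm)]
  have h2 : (past b v w m).1 ≤ arrival (past b v w) m :=
    Finset.single_le_sum (f := fun k => (past b v w k).1)
      (fun k _ => past_fst_nonneg h (hv.trans hb.le) k) (by simp)
  linarith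

lemma arrival_past_le_iff (h : IsRegular w) (hv : 0 ≤ v) (hb : v < b) {m : ℕ} :
    arrival (past b v w) m ≤ v ↔ arrival w m ≤ v := by
  constructor
  · contrapose!
    exact lt_arrival_past h hv hb
  · intro hm
    rwa [arrival_past_of_le h hm]

end Past

section Law

variable {r : ℝ} {σ : Measure ℝ}

lemma map_eval_pathLaw (hr : 0 < r) [IsProbabilityMeasure σ] (k : ℕ) :
    (pathLaw r σ).map (fun w => w k) = (expMeasure r).prod σ := by
  have := isProbabilityMeasure_expMeasure hr
  exact Measure.infinitePi_map_eval _ k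

/-- If all arrivals stay below `u`, then so do the first `n` interarrival times, for every `n`; the
probability of that is a power `q ^ n` with `q < 1`. -/
lemma ae_exists_lt_arrival (hr : 0 < r) [IsProbabilityMeasure σ]
    (hpos : ∀ᵐ w ∂(pathLaw r σ), ∀ k, 0 < (w k).1) (u : ℝ) :
    ∀ᵐ w ∂(pathLaw r σ), ∃ n, u < arrival w n := by
  have := isProbabilityMeasure_expMeasure hr
  have := isProbabilityMeasure_pathLaw (σ := σ) hr
  set a := max u 0
  set q := ((expMeasure r).prod σ) (Set.Iic a ×ˢ Set.univ)
  have hq : q < 1 := by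
    have h1 : q = expMeasure r (Set.Iic a) := by simp [q, Measure.prod_prod]
    rw [h1, ← Set.compl_Ioi, prob_compl_eq_one_sub measurableSet_Ioi,
      expMeasure_Ioi hr (le_max_right u 0)]
    exact ENNReal.sub_lt_self (by simp) (by simp) (by simp [Real.exp_pos])
  have hle : ∀ n : ℕ, pathLaw r σ {w | ¬ ∃ n, u < arrival w n} ≤ q ^ n := by
    intro n
    have hbox := Measure.infinitePi_pi (fun _ : ℕ => (expMeasure r).prod σ)
      (s := Finset.range n) (t := fun _ => Set.Iic a ×ˢ Set.univ)
      (fun _ _ => measurableSet_Iic.prod .univ)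
    rw [Finset.prod_const, Finset.card_range] at hbox
    rw [← hbox]
    refine measure_mono_ae ?_
    filter_upwards [hpos] with w hw hw2 k _
    have h1 : ¬ ∃ n, u < arrival w n := hw2
    push Not at h1
    have h2 : (w k).1 ≤ arrival w k :=
      Finset.single_le_sum (f := fun k => (w k).1) (fun k _ => (hw k).le) (by simp)
    exact ⟨(h2.trans (h1 k)).trans (le_max_left _ _), trivial⟩
  exact le_antisymm (ge_of_tendsto' (ENNReal.tendsto_pow_atTop_nhds_zero_of_lt_one hq) hle) bot_le

lemma ae_isRegular (hr : 0 < r) [IsProbabilityMeasure σ] (hσ : ∀ᵐ x ∂σ, 0 ≤ x) :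
    ∀ᵐ w ∂(pathLaw r σ), IsRegular w := by
  have := isProbabilityMeasure_expMeasure hr
  have h1 : ∀ᵐ w ∂(pathLaw r σ), ∀ k, 0 < (w k).1 := by
    refine ae_all_iff.2 fun k => ?_
    have : ∀ᵐ z ∂((pathLaw r σ).map (fun w => w k)), 0 < z.1 := by
      rw [map_eval_pathLaw hr]
      exact Measure.quasiMeasurePreserving_fst.ae (ae_pos_expMeasure hr)
    exact ae_of_ae_map (measurable_pi_apply k).aemeasurable this
  have h2 : ∀ᵐ w ∂(pathLaw r σ), ∀ k, 0 ≤ (w k).2 := by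
    refine ae_all_iff.2 fun k => ?_
    have : ∀ᵐ z ∂((pathLaw r σ).map (fun w => w k)), 0 ≤ z.2 := by
      rw [map_eval_pathLaw hr]
      exact Measure.quasiMeasurePreserving_snd.ae hσ
    exact ae_of_ae_map (measurable_pi_apply k).aemeasurable this
  have h3 : ∀ᵐ w ∂(pathLaw r σ), ∀ N : ℕ, ∃ n, (N : ℝ) < arrival w n :=
    ae_all_iff.2 fun N => ae_exists_lt_arrival hr h1 N
  filter_upwards [h1, h2, h3] with w hw1 hw2 hw3
  exact ⟨hw1, hw2, fun u => (hw3 ⌈u⌉₊).imp fun n hn => (Nat.le_ceil u).trans_lt hn⟩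

lemma pathLaw_eq_tsum_firstAfter (hr : 0 < r) [IsProbabilityMeasure σ] (hσ : ∀ᵐ x ∂σ, 0 ≤ x)
    (u : ℝ) {C : Set Path} (hC : MeasurableSet C) :
    pathLaw r σ C = ∑' n, pathLaw r σ (firstAfter u n ∩ C) := by
  rw [← measure_iUnion]
  · refine measure_congr ?_
    filter_upwards [ae_isRegular hr hσ] with w hw
    refine propext ⟨fun h => Set.mem_iUnion.2 ⟨indexAfter u w, hw.mem_firstAfter u, h⟩, fun h => ?_⟩
    obtain ⟨n, hn⟩ := Set.mem_iUnion.1 h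
    exact hn.2
  · intro m n hmn
    refine Set.disjoint_left.2 fun w hm hn => hmn ?_
    rw [← indexAfter_eq hm.1, indexAfter_eq hn.1]
  · exact fun n => (measurableSet_firstAfter u n).inter hC

lemma firstAfter_inter_future (u : ℝ) (n : ℕ) (B : Set Path) :
    firstAfter u n ∩ future u ⁻¹' B = firstAfter u n ∩ shiftAt u n ⁻¹' B := by
  ext w
  simp only [Set.mem_inter_iff, Set.mem_preimage, and_congr_right_iff]
  intro h
  rw [future, indexAfter_eq h]

/-- Sum of `pathLaw_firstAfter_inter` over the index of the first packet after `u`. The factor for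
the future does not depend on this index. -/
lemma pathLaw_past_inter_future (hr : 0 < r) [IsProbabilityMeasure σ] (hσ : ∀ᵐ x ∂σ, 0 ≤ x)
    (b : ℝ) {u : ℝ} (hu : 0 ≤ u) {A B : Set Path} (hA : MeasurableSet A) (hB : MeasurableSet B) :
    pathLaw r σ (past b u ⁻¹' A ∩ future u ⁻¹' B) =
      pathLaw r σ (past b u ⁻¹' A) * pathLaw r σ B := by
  rw [pathLaw_eq_tsum_firstAfter hr hσ u ((measurable_past b u hA).inter (measurable_future u hB)),
    pathLaw_eq_tsum_firstAfter hr hσ u (measurable_past b u hA), ← ENNReal.tsum_mul_right]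
  refine tsum_congr fun n => ?_
  rw [← pathLaw_firstAfter_inter hr b n hu hA hB, Set.inter_left_comm, firstAfter_inter_future,
    Set.inter_left_comm, Set.inter_assoc]

/-- The Markov property of a path at a deterministic time. -/
lemma map_past_future_pathLaw (hr : 0 < r) [IsProbabilityMeasure σ] (hσ : ∀ᵐ x ∂σ, 0 ≤ x)
    (b : ℝ) {u : ℝ} (hu : 0 ≤ u) :
    (pathLaw r σ).map (fun w => (past b u w, future u w)) =
      ((pathLaw r σ).map (past b u)).prod (pathLaw r σ) := by
  have := isProbabilityMeasure_pathLaw (σ := σ) hr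
  have := Measure.isProbabilityMeasure_map (μ := pathLaw r σ) (measurable_past b u).aemeasurable
  refine (Measure.prod_eq fun A B hA hB => ?_).symm
  rw [Measure.map_apply ((measurable_past b u).prodMk (measurable_future u)) (hA.prod hB),
    Measure.map_apply (measurable_past b u) hA, ← pathLaw_past_inter_future hr hσ b hu hA hB]
  rfl

end Law

/-! ### Systems of independent sources -/

section System

variable {ι : Type*}

/-- A path of the system: a path for every source. -/
abbrev SysPath (ι : Type*) := ι → Path

/-- The law of the system: the sources are independent. -/
noncomputable def sysLaw [Fintype ι] (rate : ι → ℝ) (σ : Measure ℝ) : Measure (SysPath ι) :=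
  Measure.pi fun d => pathLaw (rate d) σ

/-- The `n`-th packet of source `c` is not preempted. -/
def IsDelivered (p : SysPath ι) (c : ι) (n : ℕ) : Prop :=
  ∀ d m, arrival (p c) n < arrival (p d) m → arrival (p c) n + (p c n).2 ≤ arrival (p d) m

/-- The event that some packet of source `c` generated after time `u` is delivered by time `t`. -/
def receivedWithin (c : ι) (u t : ℝ) : Set (SysPath ι) :=
  {p | ∃ n, u < arrival (p c) n ∧ arrival (p c) n + (p c n).2 ≤ t ∧ IsDelivered p c n}

/-- The parts of the paths of all sources up to time `u`. -/
noncomputable def sysPast (u : ℝ) (p : SysPath ι) : SysPath ι := fun d => past (u + 1) u (p d)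

/-- The paths of all sources after time `u`, seen from time `u`. -/
noncomputable def sysFuture (u : ℝ) (p : SysPath ι) : SysPath ι := fun d => future u (p d)

/-- Only later arrivals can preempt a packet, so packets up to time `u` have no say in what happens
to those generated after `u`. -/
lemma mem_receivedWithin_iff_sysFuture {p : SysPath ι} (hp : ∀ d, IsRegular (p d)) (c : ι)
    (u t : ℝ) : p ∈ receivedWithin c u t ↔ sysFuture u p ∈ receivedWithin c 0 (t - u) := by
  have hdel : ∀ k, IsDelivered (sysFuture u p) c k ↔ IsDelivered p c (indexAfter u (p c) + k) := by
    intro k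
    simp only [IsDelivered, sysFuture, arrival_future, future_snd]
    constructor
    · intro h d m hm
      have hum : u < arrival (p c) (indexAfter u (p c) + k) :=
        (hp c).indexAfter_le_iff.1 (Nat.le_add_right _ _)
      obtain ⟨j, rfl⟩ := Nat.exists_eq_add_of_le ((hp d).indexAfter_le_iff.2 (hum.trans hm))
      linarith [h d j (by linarith)]
    · intro h d m hm
      linarith [h d _ (by linarith : _ < arrival (p d) (indexAfter u (p d) + m))]
  constructor
  · rintro ⟨n, h1, h2, h3⟩
    obtain ⟨k, rfl⟩ := Nat.exists_eq_add_of_le ((hp c).indexAfter_le_iff.2 h1)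
    refine ⟨k, ?_, ?_, (hdel k).2 h3⟩ <;> simp only [sysFuture, arrival_future, future_snd] <;>
      linarith
  · rintro ⟨k, h1, h2, h3⟩
    simp only [sysFuture, arrival_future, future_snd] at h1 h2
    exact ⟨_, by linarith, by linarith, (hdel k).1 h3⟩

/-- A packet delivered by `t ≤ v` cannot be preempted by arrivals after `v`. The cut keeps these
arrivals beyond `v`, so it changes no delivery of this kind. -/
lemma mem_receivedWithin_iff_sysPast {p : SysPath ι} (hp : ∀ d, IsRegular (p d)) (c : ι)
    {u t v : ℝ} (htv : t ≤ v) (hv : 0 ≤ v) :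
    p ∈ receivedWithin c u t ↔ sysPast v p ∈ receivedWithin c u t := by
  have hb : v < v + 1 := by linarith
  constructor
  · rintro ⟨n, h1, h2, h3⟩
    have hn : arrival (p c) n ≤ v := by linarith [(hp c).nonneg n]
    have e1 : arrival (sysPast v p c) n = arrival (p c) n := arrival_past_of_le (hp c) hn
    have e2 : sysPast v p c n = p c n := past_of_arrival_le (hp c) hn le_rfl
    refine ⟨n, by rwa [e1], by rwa [e1, e2], fun d m hm => ?_⟩
    rw [e1] at hm ⊢
    rw [e2]
    by_cases hmv : arrival (p d) m ≤ v
    · have e3 : arrival (sysPast v p d) m = arrival (p d) m := arrival_past_of_le (hp d) hmv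
      rw [e3] at hm ⊢
      exact h3 d m hm
    · have := lt_arrival_past (hp d) hv hb (not_le.1 hmv)
      exact (h2.trans htv).trans this.le
  · rintro ⟨n, h1, h2, h3⟩
    have hn : arrival (p c) n ≤ v := by
      rw [← arrival_past_le_iff (hp c) hv hb]
      have := past_snd_nonneg (b := v + 1) (v := v) (hp c) n
      simp only [sysPast] at h2
      linarith
    have e1 : arrival (sysPast v p c) n = arrival (p c) n := arrival_past_of_le (hp c) hn
    have e2 : sysPast v p c n = p c n := past_of_arrival_le (hp c) hn le_rfl
    rw [e1] at h1 h2
    rw [e2] at h2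
    refine ⟨n, h1, h2, fun d m hm => ?_⟩
    by_cases hmv : arrival (p d) m ≤ v
    · have e3 : arrival (sysPast v p d) m = arrival (p d) m := arrival_past_of_le (hp d) hmv
      have := h3 d m
      rw [e1, e2, e3] at this
      exact this hm
    · exact (h2.trans htv).trans (not_le.1 hmv).le

@[fun_prop]
lemma measurable_arrival_apply (d : ι) (m : ℕ) :
    Measurable fun p : SysPath ι => arrival (p d) m :=
  (measurable_arrival m).comp (measurable_pi_apply d)

lemma measurableSet_isDelivered [Countable ι] (c : ι) (n : ℕ) :
    MeasurableSet {p : SysPath ι | IsDelivered p c n} := by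
  have : {p : SysPath ι | IsDelivered p c n} = ⋂ d, ⋂ m,
      {p | arrival (p d) m ≤ arrival (p c) n} ∪
        {p | arrival (p c) n + (p c n).2 ≤ arrival (p d) m} := by
    ext p
    simp [IsDelivered, imp_iff_not_or]
  rw [this]
  exact .iInter fun d => .iInter fun m =>
    (measurableSet_le (by fun_prop) (by fun_prop)).union
      (measurableSet_le (by fun_prop) (by fun_prop))

lemma measurableSet_receivedWithin [Countable ι] (c : ι) (u t : ℝ) :
    MeasurableSet (receivedWithin c u t) := by
  have : receivedWithin c u t = ⋃ n, {p | u < arrival (p c) n} ∩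
      ({p | arrival (p c) n + (p c n).2 ≤ t} ∩ {p | IsDelivered p c n}) := by
    ext p
    simp [receivedWithin]
  rw [this]
  exact .iUnion fun n => (measurableSet_lt (by fun_prop) (by fun_prop)).inter
    ((measurableSet_le (by fun_prop) (by fun_prop)).inter (measurableSet_isDelivered c n))

lemma measurable_sysPast (u : ℝ) : Measurable (sysPast u : SysPath ι → SysPath ι) :=
  measurable_pi_lambda _ fun d => (measurable_past _ u).comp (measurable_pi_apply d)

lemma measurable_sysFuture (u : ℝ) : Measurable (sysFuture u : SysPath ι → SysPath ι) :=
  measurable_pi_lambda _ fun d => (measurable_future u).comp (measurable_pi_apply d)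

variable [Fintype ι] {rate : ι → ℝ} {σ : Measure ℝ}

lemma isProbabilityMeasure_sysLaw (hr : ∀ d, 0 < rate d) [IsProbabilityMeasure σ] :
    IsProbabilityMeasure (sysLaw rate σ) := by
  have := fun d => isProbabilityMeasure_pathLaw (σ := σ) (hr d)
  unfold sysLaw; infer_instance

lemma map_eval_sysLaw (hr : ∀ d, 0 < rate d) [IsProbabilityMeasure σ] (d : ι) :
    (sysLaw rate σ).map (fun p => p d) = pathLaw (rate d) σ := by
  have := fun d => isProbabilityMeasure_pathLaw (σ := σ) (hr d)
  exact (measurePreserving_eval (fun d => pathLaw (rate d) σ) d).map_eq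

lemma ae_forall_isRegular (hr : ∀ d, 0 < rate d) [IsProbabilityMeasure σ]
    (hσ : ∀ᵐ x ∂σ, 0 ≤ x) : ∀ᵐ p ∂(sysLaw rate σ), ∀ d, IsRegular (p d) := by
  refine ae_all_iff.2 fun d => ?_
  have := ae_isRegular (hr d) hσ
  rw [← map_eval_sysLaw hr d] at this
  exact ae_of_ae_map (measurable_pi_apply d).aemeasurable this

/-- The Markov property holds for each source separately, and the sources are independent. -/
lemma sysLaw_sysPast_inter_sysFuture (hr : ∀ d, 0 < rate d) [IsProbabilityMeasure σ]
    (hσ : ∀ᵐ x ∂σ, 0 ≤ x) {u : ℝ} (hu : 0 ≤ u) {A B : Set (SysPath ι)} (hA : MeasurableSet A)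
    (hB : MeasurableSet B) :
    sysLaw rate σ (sysPast u ⁻¹' A ∩ sysFuture u ⁻¹' B) =
      sysLaw rate σ (sysPast u ⁻¹' A) * sysLaw rate σ B := by
  have := fun d => isProbabilityMeasure_pathLaw (σ := σ) (hr d)
  have hpast := fun d => Measure.isProbabilityMeasure_map (μ := pathLaw (rate d) σ)
    (measurable_past (u + 1) u).aemeasurable
  have hmPF : Measurable fun w : Path => (past (u + 1) u w, future u w) :=
    (measurable_past _ u).prodMk (measurable_future u)
  have h1 : (sysLaw rate σ).map (fun p d => (past (u + 1) u (p d), future u (p d))) =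
      Measure.pi fun d => ((pathLaw (rate d) σ).map (past (u + 1) u)).prod (pathLaw (rate d) σ) := by
    have := fun d => Measure.isProbabilityMeasure_map (μ := pathLaw (rate d) σ) hmPF.aemeasurable
    rw [sysLaw, Measure.pi_map_pi (f := fun _ w => (past (u + 1) u w, future u w))
      (fun _ => hmPF.aemeasurable)]
    simp_rw [map_past_future_pathLaw (hr _) hσ _ hu]
  have h2 : (sysLaw rate σ).map (sysPast u) =
      Measure.pi fun d => (pathLaw (rate d) σ).map (past (u + 1) u) :=
    Measure.pi_map_pi (f := fun _ w => past (u + 1) u w)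
      (fun _ => (measurable_past _ u).aemeasurable)
  -- A family of pairs (past, future) is regrouped as the pair of all pasts and all futures.
  have h3 : (sysLaw rate σ).map (fun p => (sysPast u p, sysFuture u p)) =
      ((sysLaw rate σ).map (sysPast u)).prod (sysLaw rate σ) := by
    have := (measurePreserving_arrowProdEquivProdArrow Path Path ι
      (fun d => (pathLaw (rate d) σ).map (past (u + 1) u)) (fun d => pathLaw (rate d) σ)).map_eq
    have hm : Measurable fun (p : SysPath ι) d => (past (u + 1) u (p d), future u (p d)) :=
      measurable_pi_lambda _ fun d => hmPF.comp (measurable_pi_apply d)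
    rw [h2, sysLaw, ← this, ← h1, Measure.map_map (MeasurableEquiv.measurable _) hm]
    rfl
  have := isProbabilityMeasure_sysLaw (σ := σ) hr
  rw [← Measure.map_apply (measurable_sysPast u) hA, ← Measure.prod_prod, ← h3,
    Measure.map_apply ((measurable_sysPast u).prodMk (measurable_sysFuture u)) (hA.prod hB)]
  rfl

/-- Time homogeneity: the event is read off the future of `u`, whose law is that of a fresh system.
-/
lemma sysLaw_receivedWithin (hr : ∀ d, 0 < rate d) [IsProbabilityMeasure σ]
    (hσ : ∀ᵐ x ∂σ, 0 ≤ x) (c : ι) {u : ℝ} (hu : 0 ≤ u) (t : ℝ) :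
    sysLaw rate σ (receivedWithin c u t) = sysLaw rate σ (receivedWithin c 0 (t - u)) := by
  have := isProbabilityMeasure_sysLaw (σ := σ) hr
  have h := sysLaw_sysPast_inter_sysFuture hr hσ hu .univ
    (measurableSet_receivedWithin c 0 (t - u))
  simp only [Set.preimage_univ, Set.univ_inter, measure_univ, one_mul] at h
  rw [← h]
  refine measure_congr ?_
  filter_upwards [ae_forall_isRegular hr hσ] with p hp
  exact propext (mem_receivedWithin_iff_sysFuture hp c u t)

/-- The first event is determined by the past of `u'` and the second by its future. -/
lemma sysLaw_receivedWithin_inter (hr : ∀ d, 0 < rate d) [IsProbabilityMeasure σ]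
    (hσ : ∀ᵐ x ∂σ, 0 ≤ x) (c : ι) {u t u' t' : ℝ} (ht : t ≤ u') (hu' : 0 ≤ u') :
    sysLaw rate σ (receivedWithin c u t ∩ receivedWithin c u' t') =
      sysLaw rate σ (receivedWithin c u t) * sysLaw rate σ (receivedWithin c u' t') := by
  have h := sysLaw_sysPast_inter_sysFuture hr hσ hu' (measurableSet_receivedWithin c u t)
    (measurableSet_receivedWithin c 0 (t' - u'))
  rw [sysLaw_receivedWithin hr hσ c hu' t']
  have e1 : sysPast u' ⁻¹' receivedWithin c u t =ᵐ[sysLaw rate σ] receivedWithin c u t := by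
    filter_upwards [ae_forall_isRegular hr hσ] with p hp
    exact propext (mem_receivedWithin_iff_sysPast hp c ht hu').symm
  have e2 : sysFuture u' ⁻¹' receivedWithin c 0 (t' - u') =ᵐ[sysLaw rate σ]
      receivedWithin c u' t' := by
    filter_upwards [ae_forall_isRegular hr hσ] with p hp
    exact propext (mem_receivedWithin_iff_sysFuture hp c u' t').symm
  rw [← measure_congr (e1.inter e2), h, measure_congr e1]

end System

/-! ### Void probabilities -/

/-- The event that there is no arrival strictly between `a` and `b`. -/
def emptyOn (a b : ℝ) : Set Path := {w | ∀ m, ¬ (a < arrival w m ∧ arrival w m < b)}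

lemma measurableSet_emptyOn (a b : ℝ) : MeasurableSet (emptyOn a b) := by
  have : emptyOn a b = ⋂ m, ({w | a < arrival w m} ∩ {w | arrival w m < b})ᶜ := by
    ext w
    simp [emptyOn]
  rw [this]
  exact .iInter fun m => ((measurableSet_lt (by fun_prop) (by fun_prop)).inter
    (measurableSet_lt (by fun_prop) (by fun_prop))).compl

lemma mem_emptyOn_iff_future {w : Path} (h : IsRegular w) (a s : ℝ) :
    w ∈ emptyOn a (a + s) ↔ s ≤ arrival (future a w) 0 := by
  rw [arrival_future, add_zero]
  constructor
  · intro hw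
    by_contra! hlt
    exact hw _ ⟨(h.mem_firstAfter a).1, by linarith⟩
  · rintro hs m ⟨h1, h2⟩
    have := h.strictMono.monotone (h.indexAfter_le_iff.2 h1)
    linarith

lemma mem_emptyOn_iff_past {w : Path} (h : IsRegular w) {a b v c : ℝ} (hbv : b ≤ v) (hv : 0 ≤ v)
    (hc : v < c) : w ∈ emptyOn a b ↔ past c v w ∈ emptyOn a b := by
  refine forall_congr' fun m => not_congr ?_
  by_cases hm : arrival w m ≤ v
  · rw [arrival_past_of_le h hm]
  · have h1 := lt_arrival_past h hv hc (not_le.1 hm)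
    constructor <;> rintro ⟨_, h2⟩ <;> linarith

section Void

variable {r : ℝ} {σ : Measure ℝ}

lemma pathLaw_le_arrival_zero (hr : 0 < r) [IsProbabilityMeasure σ] {s : ℝ} (hs : 0 ≤ s) :
    pathLaw r σ {w | s ≤ arrival w 0} = ENNReal.ofReal (Real.exp (-(r * s))) := by
  have h : {w : Path | s ≤ arrival w 0} = (fun w : Path => w 0) ⁻¹' (Set.Ici s ×ˢ Set.univ) := by
    ext w
    simp [arrival_zero]
  rw [h, ← Measure.map_apply (by fun_prop) (measurableSet_Ici.prod .univ),
    map_eval_pathLaw hr, Measure.prod_prod, expMeasure_Ici hr hs, measure_univ, mul_one]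

/-- A Poisson process has no arrivals in finitely many disjoint intervals with the product of the
probabilities for the single intervals. -/
lemma pathLaw_forall_mem_emptyOn (hr : 0 < r) [IsProbabilityMeasure σ] (hσ : ∀ᵐ x ∂σ, 0 ≤ x)
    {t s : ℕ → ℝ} (ht : ∀ n, 0 ≤ t n) (F : Finset ℕ) (hs : ∀ n ∈ F, 0 ≤ s n)
    (hts : ∀ i ∈ F, ∀ j, i < j → t i + s i ≤ t j) :
    pathLaw r σ {w | ∀ n ∈ F, w ∈ emptyOn (t n) (t n + s n)} =
      ∏ n ∈ F, ENNReal.ofReal (Real.exp (-(r * s n))) := by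
  have := isProbabilityMeasure_pathLaw (σ := σ) hr
  -- Peel off the last window. The earlier ones are determined by the past of its left end `t a`,
  -- and the last one is empty iff the first arrival after `t a` takes at least `s a`.
  induction F using Finset.induction_on_max with
  | empty => simp
  | insert a F hF ih =>
    have haF : a ∉ F := fun h => lt_irrefl _ (hF a h)
    have hA : MeasurableSet {w : Path | ∀ n ∈ F, w ∈ emptyOn (t n) (t n + s n)} := by
      have : {w : Path | ∀ n ∈ F, w ∈ emptyOn (t n) (t n + s n)} =
          ⋂ n, ⋂ (_ : n ∈ F), emptyOn (t n) (t n + s n) := by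
        ext w; simp
      rw [this]
      exact .iInter fun n => .iInter fun _ => measurableSet_emptyOn _ _
    have hB : MeasurableSet {w : Path | s a ≤ arrival w 0} :=
      measurableSet_le measurable_const (by fun_prop)
    have key := pathLaw_past_inter_future hr hσ (t a + 1) (ht a) hA hB
    have e1 : past (t a + 1) (t a) ⁻¹' {w : Path | ∀ n ∈ F, w ∈ emptyOn (t n) (t n + s n)}
        =ᵐ[pathLaw r σ] {w : Path | ∀ n ∈ F, w ∈ emptyOn (t n) (t n + s n)} := by
      filter_upwards [ae_isRegular hr hσ] with w hw
      refine propext (forall₂_congr fun n hn => ?_)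
      exact (mem_emptyOn_iff_past hw (hts n (Finset.mem_insert_of_mem hn) a (hF n hn)) (ht a)
        (lt_add_one _)).symm
    have e2 : future (t a) ⁻¹' {w : Path | s a ≤ arrival w 0} =ᵐ[pathLaw r σ]
        emptyOn (t a) (t a + s a) := by
      filter_upwards [ae_isRegular hr hσ] with w hw
      exact propext (mem_emptyOn_iff_future hw (t a) (s a)).symm
    rw [measure_congr (e1.inter e2), measure_congr e1,
      pathLaw_le_arrival_zero hr (hs a (Finset.mem_insert_self _ _)),
      ih (fun n hn => hs n (Finset.mem_insert_of_mem hn))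
        (fun i hi => hts i (Finset.mem_insert_of_mem hi))] at key
    rw [Finset.prod_insert haF, mul_comm, ← key]
    congr 1
    ext w
    simp [and_comm]

end Void

/-! ### The gaps between consecutive arrivals -/

/-- The arrival time of the packet preceding the `n`-th one (`0` for the first packet). -/
noncomputable def prevArrival (w : Path) (n : ℕ) : ℝ := ∑ k ∈ Finset.range n, (w k).1

/-- The service time of the packet preceding the `n`-th one (`y` for the first packet). -/
def prevService (y : ℝ) (w : Path) : ℕ → ℝ
  | 0 => y
  | n + 1 => (w n).2

/-- The `n`-th interarrival time with the service time of the packet preceding the `n`-th one. -/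
def gap (y : ℝ) (w : Path) (n : ℕ) : ℝ × ℝ := ((w n).1, prevService y w n)

/-- The law of the `n`-th gap. -/
noncomputable def gapLaw (r : ℝ) (σ : Measure ℝ) : ℕ → Measure (ℝ × ℝ)
  | 0 => (expMeasure r).prod (Measure.dirac 0)
  | _ + 1 => (expMeasure r).prod σ

lemma prevArrival_succ (w : Path) (n : ℕ) : prevArrival w (n + 1) = arrival w n := rfl

lemma arrival_eq_prevArrival_add (w : Path) (n : ℕ) : arrival w n = prevArrival w n + (w n).1 :=
  Finset.sum_range_succ _ _

@[fun_prop]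
lemma measurable_prevArrival (n : ℕ) : Measurable fun w : Path => prevArrival w n := by
  unfold prevArrival; fun_prop

@[fun_prop]
lemma measurable_prevService (y : ℝ) (n : ℕ) : Measurable fun w : Path => prevService y w n := by
  cases n with
  | zero => exact measurable_const
  | succ n => exact (measurable_pi_apply n).snd

@[fun_prop]
lemma measurable_gap (y : ℝ) (n : ℕ) : Measurable fun w : Path => gap y w n := by
  unfold gap; fun_prop

lemma gap_consPath_zero (y : ℝ) (z : ℝ × ℝ) (w : Path) : gap y (consPath z w) 0 = (z.1, y) := rfl

lemma gap_consPath_succ (y : ℝ) (z : ℝ × ℝ) (w : Path) (n : ℕ) :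
    gap y (consPath z w) (n + 1) = gap z.2 w n := by
  cases n <;> rfl

section GapLaw

variable {r : ℝ} {σ : Measure ℝ}

lemma isProbabilityMeasure_gapLaw (hr : 0 < r) [IsProbabilityMeasure σ] (n : ℕ) :
    IsProbabilityMeasure (gapLaw r σ n) := by
  have := isProbabilityMeasure_expMeasure hr
  cases n <;> (unfold gapLaw; infer_instance)

lemma lintegral_pathLaw (hr : 0 < r) [IsProbabilityMeasure σ] {f : Path → ℝ≥0∞}
    (hf : Measurable f) :
    ∫⁻ w, f w ∂(pathLaw r σ) =
      ∫⁻ x, ∫⁻ y, ∫⁻ w, f (consPath (x, y) w) ∂(pathLaw r σ) ∂σ ∂(expMeasure r) := by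
  have := isProbabilityMeasure_expMeasure hr
  have := isProbabilityMeasure_pathLaw (σ := σ) hr
  have hm : Measurable fun q : (ℝ × ℝ) × Path => f (consPath q.1 q.2) :=
    hf.comp measurable_consPath
  conv_lhs => rw [← map_consPath_pathLaw hr, lintegral_map hf measurable_consPath]
  rw [lintegral_prod _ hm.aemeasurable, lintegral_prod _ hm.lintegral_prod_right'.aemeasurable]

/-- Gap `n` holds interarrival time `n` and service time `n - 1`, so the entries of a single packet
are split between two consecutive gaps. The induction therefore runs over an arbitrary service time
`y` before the path. -/
lemma lintegral_prod_gap_aux (hr : 0 < r) [IsProbabilityMeasure σ] (N : ℕ) :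
    ∀ (y : ℝ) {h : ℕ → ℝ × ℝ → ℝ≥0∞}, (∀ n, Measurable (h n)) →
      ∫⁻ w, ∏ n ∈ Finset.range (N + 1), h n (gap y w n) ∂(pathLaw r σ) =
        (∫⁻ x, h 0 (x, y) ∂(expMeasure r)) *
          ∏ n ∈ Finset.range N, ∫⁻ z, h (n + 1) z ∂((expMeasure r).prod σ) := by
  have := isProbabilityMeasure_expMeasure hr
  have := isProbabilityMeasure_pathLaw (σ := σ) hr
  induction N with
  | zero =>
    intro y h hh
    have h1 : Measurable fun x => h 0 (x, y) := (hh 0).comp measurable_prodMk_right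
    rw [lintegral_pathLaw hr (by fun_prop)]
    simp [gap_consPath_zero]
  | succ N ih =>
    intro y h hh
    have h1 : Measurable fun x => h 0 (x, y) := (hh 0).comp measurable_prodMk_right
    have h2 : Measurable fun y' => ∫⁻ x', h 1 (x', y') ∂(expMeasure r) :=
      (hh 1).lintegral_prod_left'
    rw [lintegral_pathLaw hr (by fun_prop)]
    simp_rw [Finset.prod_range_succ' _ (N + 1), gap_consPath_succ, gap_consPath_zero]
    -- The service time `y'` of the removed packet enters the rest only through the next gap.
    -- Integrating over it afterwards completes the law of that gap.
    have h3 : ∀ x y', ∫⁻ w, (∏ n ∈ Finset.range (N + 1), h (n + 1) (gap y' w n)) * h 0 (x, y)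
        ∂(pathLaw r σ) =
        (∫⁻ x', h 1 (x', y') ∂(expMeasure r)) *
          ((∏ n ∈ Finset.range N, ∫⁻ z, h (n + 1 + 1) z ∂((expMeasure r).prod σ)) *
          h 0 (x, y)) := by
      intro x y'
      rw [lintegral_mul_const _ (by fun_prop), ih y' (h := fun n => h (n + 1)) (fun n => hh _),
        mul_assoc]
    simp_rw [h3, lintegral_mul_const _ h2]
    rw [lintegral_const_mul'' _ (by fun_prop), lintegral_const_mul'' _ h1.aemeasurable,
      ← lintegral_prod_symm _ (hh 1).aemeasurable]
    rw [Finset.prod_range_succ' _ N]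
    ring

/-- The gaps are independent. -/
lemma lintegral_prod_gap (hr : 0 < r) [IsProbabilityMeasure σ] (N : ℕ)
    {h : ℕ → ℝ × ℝ → ℝ≥0∞} (hh : ∀ n, Measurable (h n)) :
    ∫⁻ w, ∏ n ∈ Finset.range N, h n (gap 0 w n) ∂(pathLaw r σ) =
      ∏ n ∈ Finset.range N, ∫⁻ z, h n z ∂(gapLaw r σ n) := by
  have := isProbabilityMeasure_expMeasure hr
  have := isProbabilityMeasure_pathLaw (σ := σ) hr
  cases N with
  | zero => simp
  | succ N =>
    rw [lintegral_prod_gap_aux hr N 0 hh, Finset.prod_range_succ' _ N, mul_comm]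
    congr 1
    simp only [gapLaw]
    rw [lintegral_prod _ (hh 0).aemeasurable]
    refine lintegral_congr fun x => ?_
    rw [lintegral_dirac']
    exact (hh 0).comp measurable_prodMk_left

end GapLaw

/-! ### Deliveries -/

section System

variable {ι : Type*}

/-- The packet preceding the `n`-th packet of source `c` is not preempted. A virtual packet with
service time `0` arriving at time `0` precedes the first packet. -/
def prevDelivered (c : ι) (n : ℕ) (p : SysPath ι) : Prop :=
  prevService 0 (p c) n ≤ (p c n).1 ∧ ∀ d ≠ c,
    p d ∈ emptyOn (prevArrival (p c) n) (prevArrival (p c) n + prevService 0 (p c) n)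

/-- The conditional probability that the packet preceding a packet of source `c` is not preempted,
given the interarrival time and the service time; `μ` is the arrival rate of the other sources. -/
noncomputable def survival (μ : ℝ) (z : ℝ × ℝ) : ℝ≥0∞ :=
  {z : ℝ × ℝ | z.2 ≤ z.1}.indicator (fun z => ENNReal.ofReal (Real.exp (-(μ * z.2)))) z

@[fun_prop]
lemma measurable_survival (μ : ℝ) : Measurable (survival μ) :=
  Measurable.indicator (by fun_prop) (measurableSet_le measurable_snd measurable_fst)

/-- Among the later packets of the same source, the next one alone decides, since it arrives
earliest. -/
lemma prevDelivered_succ_iff {p : SysPath ι} (hp : ∀ d, IsRegular (p d)) (c : ι) (n : ℕ) :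
    prevDelivered c (n + 1) p ↔ IsDelivered p c n := by
  constructor
  · rintro ⟨h1, h2⟩ d m hm
    by_cases hd : d = c
    · subst hd
      have h3 := (hp d).strictMono.monotone ((hp d).strictMono.lt_iff_lt.1 hm : n + 1 ≤ m)
      rw [arrival_succ] at h3
      simp only [prevService] at h1
      linarith
    · by_contra! hlt
      exact h2 d hd m ⟨hm, hlt⟩
  · intro h
    refine ⟨?_, fun d _ m hm => not_le.2 hm.2 (h d m hm.1)⟩
    have := h c (n + 1) ((hp c).strictMono n.lt_succ_self)
    rw [arrival_succ] at this
    simp only [prevService]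
    linarith

lemma measurableSet_prevDelivered [Countable ι] (c : ι) (n : ℕ) :
    MeasurableSet {p : SysPath ι | prevDelivered c n p} := by
  have : {p : SysPath ι | prevDelivered c n p} =
      {p | prevService 0 (p c) n ≤ (p c n).1} ∩ ⋂ d, ⋂ (_ : d ≠ c), ⋂ m,
        ({p | prevArrival (p c) n < arrival (p d) m} ∩
          {p | arrival (p d) m < prevArrival (p c) n + prevService 0 (p c) n})ᶜ := by
    ext p
    simp [prevDelivered, emptyOn]
  have hA : Measurable fun p : SysPath ι => prevArrival (p c) n :=
    (measurable_prevArrival n).comp (measurable_pi_apply c)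
  have hS : Measurable fun p : SysPath ι => prevService 0 (p c) n :=
    (measurable_prevService 0 n).comp (measurable_pi_apply c)
  rw [this]
  exact (measurableSet_le hS (by fun_prop)).inter <| .iInter fun d => .iInter fun _ =>
    .iInter fun m => ((measurableSet_lt hA (by fun_prop)).inter
      (measurableSet_lt (by fun_prop) (hA.add hS))).compl

variable [Fintype ι] {rate : ι → ℝ} {σ : Measure ℝ}

-- Condition on the path of source `c`. The other sources are independent of it and must be silent
-- in one window after each selected packet; the void probabilities multiply over sources and over
-- windows.
open Classical in
lemma sysLaw_inter_prevDelivered (hr : ∀ d, 0 < rate d) [IsProbabilityMeasure σ]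
    (hσ : ∀ᵐ x ∂σ, 0 ≤ x) (c : ι) {C : Set Path} (hC : MeasurableSet C) (F : Finset ℕ) :
    sysLaw rate σ {p | p c ∈ C ∧ ∀ n ∈ F, prevDelivered c n p} =
      ∫⁻ w in C, ∏ n ∈ F, survival (∑ d ∈ {c}ᶜ, rate d) (gap 0 w n) ∂(pathLaw (rate c) σ) := by
  have hP := fun d => isProbabilityMeasure_pathLaw (σ := σ) (hr d)
  have := isProbabilityMeasure_sysLaw (σ := σ) hr
  have hind : iIndepFun (fun d (p : SysPath ι) => p d) (sysLaw rate σ) :=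
    iIndepFun_pi (X := fun _ w => w) (fun _ => aemeasurable_id)
  let O : Finset ι := {c}ᶜ
  let rest : SysPath ι → (O → Path) := fun p d => p d
  have hrest : Measurable rest := by fun_prop
  have hI : IndepFun (fun p : SysPath ι => p c) rest (sysLaw rate σ) := by
    have h := hind.indepFun_finset {c} O (Finset.disjoint_singleton_left.2 (by simp [O]))
      (fun d => measurable_pi_apply d)
    exact h.comp (φ := fun q : ({c} : Finset ι) → Path => q ⟨c, by simp⟩) (ψ := id)
      (measurable_pi_apply _) measurable_id
  have hlaw := (indepFun_iff_map_prod_eq_prod_map_map (measurable_pi_apply c).aemeasurable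
    hrest.aemeasurable).1 hI
  rw [map_eval_sysLaw hr] at hlaw
  have := Measure.isProbabilityMeasure_map (μ := sysLaw rate σ) hrest.aemeasurable
  let V : Path → Set Path := fun w =>
    {w' | ∀ n ∈ F, w' ∈ emptyOn (prevArrival w n) (prevArrival w n + prevService 0 w n)}
  let D : Set (Path × (O → Path)) := {q | (q.1 ∈ C ∧ ∀ n ∈ F, prevService 0 q.1 n ≤ (q.1 n).1) ∧
    ∀ d, q.2 d ∈ V q.1}
  have hD : MeasurableSet D := by
    have : D = (Prod.fst ⁻¹' C ∩ ⋂ n, ⋂ (_ : n ∈ F), {q | prevService 0 q.1 n ≤ (q.1 n).1}) ∩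
        ⋂ d : O, ⋂ n, ⋂ (_ : n ∈ F), ⋂ m,
          ({q : Path × (O → Path) | prevArrival q.1 n < arrival (q.2 d) m} ∩
          {q | arrival (q.2 d) m < prevArrival q.1 n + prevService 0 q.1 n})ᶜ := by
      ext q
      simp [D, V, emptyOn]
    have hA : ∀ n, Measurable fun q : Path × (O → Path) => prevArrival q.1 n := fun n =>
      (measurable_prevArrival n).comp measurable_fst
    have hS : ∀ n, Measurable fun q : Path × (O → Path) => prevService 0 q.1 n := fun n =>
      (measurable_prevService 0 n).comp measurable_fst
    have hT : ∀ d m, Measurable fun q : Path × (O → Path) => arrival (q.2 d) m := fun d m =>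
      (measurable_arrival m).comp ((measurable_pi_apply d).comp measurable_snd)
    rw [this]
    refine ((measurable_fst hC).inter (.iInter fun n => .iInter fun _ =>
      measurableSet_le (hS n) (by fun_prop))).inter (.iInter fun d => .iInter fun n =>
        .iInter fun _ => .iInter fun m => ?_)
    exact ((measurableSet_lt (hA n) (hT d m)).inter
      (measurableSet_lt (hT d m) ((hA n).add (hS n)))).compl
  have hev : {p : SysPath ι | p c ∈ C ∧ ∀ n ∈ F, prevDelivered c n p} =
      (fun p => (p c, rest p)) ⁻¹' D := by
    ext p
    simp only [prevDelivered, D, V, rest, O, Set.mem_ofPred_eq, Set.mem_preimage,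
      Subtype.forall, Finset.mem_compl, Finset.mem_singleton]
    grind
  rw [hev, ← Measure.map_apply ((measurable_pi_apply c).prodMk hrest) hD, hlaw,
    Measure.prod_apply hD, ← lintegral_indicator hC]
  refine lintegral_congr_ae ?_
  filter_upwards [ae_isRegular (hr c) hσ] with w hw
  by_cases hwC : w ∈ C
  swap
  · simp [D, hwC]
  rw [Set.indicator_of_mem hwC]
  -- If a selected service time exceeds its interarrival time, the packet is preempted by its own
  -- source, and both sides vanish.
  by_cases hK : ∀ n ∈ F, prevService 0 w n ≤ (w n).1
  swap
  · push Not at hK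
    obtain ⟨n, hnF, hn⟩ := hK
    have h0 : Prod.mk w ⁻¹' D = ∅ := by
      ext q
      simp only [D, Set.mem_preimage, Set.mem_ofPred_eq, Set.mem_empty_iff_false, iff_false]
      exact fun h => absurd (h.1.2 n hnF) (not_le.2 hn)
    rw [h0, measure_empty, eq_comm, Finset.prod_eq_zero hnF]
    simp [survival, gap, hn]
  have hpos : ∀ n, 0 ≤ prevArrival w n := fun n => Finset.sum_nonneg fun k _ => (hw.pos k).le
  have hmono : Monotone (prevArrival w) := monotone_nat_of_le_succ fun n => by
    rw [prevArrival_succ, arrival_eq_prevArrival_add]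
    linarith [hw.pos n]
  have hser : ∀ n, 0 ≤ prevService 0 w n := fun n => by
    cases n with
    | zero => exact le_rfl
    | succ n => exact hw.nonneg n
  -- Each selected window ends before the next packet of `c` arrives, by `hK`, so the windows are
  -- ordered as `pathLaw_forall_mem_emptyOn` demands.
  have hvoid : ∀ d, pathLaw (rate d) σ (V w) =
      ∏ n ∈ F, ENNReal.ofReal (Real.exp (-(rate d * prevService 0 w n))) := fun d =>
    pathLaw_forall_mem_emptyOn (hr d) hσ hpos F (fun n _ => hser n) fun i hi j hij => by
      refine le_trans ?_ (hmono (Nat.succ_le_of_lt hij))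
      rw [Nat.succ_eq_add_one, prevArrival_succ, arrival_eq_prevArrival_add]
      linarith [hK i hi]
  have hV : MeasurableSet (V w) := by
    have : V w = ⋂ n, ⋂ (_ : n ∈ F), emptyOn (prevArrival w n)
        (prevArrival w n + prevService 0 w n) := by
      ext w'; simp [V]
    rw [this]
    exact .iInter fun n => .iInter fun _ => measurableSet_emptyOn _ _
  have hsec : Prod.mk w ⁻¹' D = {q | ∀ d, q d ∈ V w} := by
    ext q
    simp only [D, Set.mem_preimage, Set.mem_ofPred_eq, hwC, true_and]
    exact and_iff_right hK
  have hVm : MeasurableSet {q : O → Path | ∀ d, q d ∈ V w} := by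
    have : {q : O → Path | ∀ d, q d ∈ V w} = ⋂ d, (fun q => q d) ⁻¹' V w := by ext q; simp
    rw [this]
    exact .iInter fun d => measurable_pi_apply d hV
  -- With a trivial condition on source `c` the event becomes a box over all sources, to which the
  -- product formula for `sysLaw` applies.
  have hbox : rest ⁻¹' {q | ∀ d, q d ∈ V w} =
      Set.pi Set.univ fun d => if d ∈ O then V w else Set.univ := by
    ext p
    simp only [rest, Set.mem_preimage, Set.mem_ofPred_eq, Subtype.forall, Set.mem_pi, Set.mem_univ,
      true_imp_iff]
    refine forall_congr' fun d => ?_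
    by_cases hd : d ∈ O <;> simp [hd]
  have hfac : ∀ d, pathLaw (rate d) σ (if d ∈ O then V w else Set.univ) =
      if d ∈ O then pathLaw (rate d) σ (V w) else 1 := fun d => by
    split_ifs <;> simp
  rw [hsec, Measure.map_apply hrest hVm, hbox, sysLaw, Measure.pi_pi]
  simp_rw [hfac]
  rw [Finset.prod_ite_mem, Finset.univ_inter]
  simp_rw [hvoid]
  rw [Finset.prod_comm]
  refine Finset.prod_congr rfl fun n hn => ?_
  rw [survival, Set.indicator_of_mem (by exact hK n hn),
    ← ENNReal.ofReal_prod_of_nonneg (fun _ _ => (Real.exp_pos _).le), ← Real.exp_sum]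
  simp [gap, Finset.sum_mul, O]

open Classical in
/-- Joint law of finitely many gaps and deliveries. -/
lemma sysLaw_gap_inter_prevDelivered (hr : ∀ d, 0 < rate d) [IsProbabilityMeasure σ]
    (hσ : ∀ᵐ x ∂σ, 0 ≤ x) (c : ι) (N : ℕ) {C : ℕ → Set (ℝ × ℝ)} (hC : ∀ n, MeasurableSet (C n))
    {F : Finset ℕ} (hF : F ⊆ Finset.range N) :
    sysLaw rate σ {p | (∀ n < N, gap 0 (p c) n ∈ C n) ∧ ∀ n ∈ F, prevDelivered c n p} =
      ∏ n ∈ Finset.range N, ∫⁻ z in C n,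
        (if n ∈ F then survival (∑ d ∈ {c}ᶜ, rate d) z else 1) ∂(gapLaw (rate c) σ n) := by
  have hm : MeasurableSet {w : Path | ∀ n < N, gap 0 w n ∈ C n} := by
    have : {w : Path | ∀ n < N, gap 0 w n ∈ C n} =
        ⋂ n, ⋂ (_ : n < N), (fun w => gap 0 w n) ⁻¹' C n := by ext; simp
    rw [this]
    exact .iInter fun n => .iInter fun _ => measurable_gap 0 n (hC n)
  rw [show {p : SysPath ι | (∀ n < N, gap 0 (p c) n ∈ C n) ∧ ∀ n ∈ F, prevDelivered c n p} =
    {p | p c ∈ {w : Path | ∀ n < N, gap 0 w n ∈ C n} ∧ ∀ n ∈ F, prevDelivered c n p} from rfl,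
    sysLaw_inter_prevDelivered hr hσ c hm F, ← lintegral_indicator hm]
  set μ := ∑ d ∈ {c}ᶜ, rate d
  have hmeas : ∀ n, Measurable fun z => if n ∈ F then survival μ z else 1 := fun n => by
    split_ifs <;> fun_prop
  simp_rw [← lintegral_indicator (hC _)]
  rw [← lintegral_prod_gap (hr c) N (fun n => (hmeas n).indicator (hC n))]
  refine lintegral_congr fun w => ?_
  by_cases hw : ∀ n < N, gap 0 w n ∈ C n
  · rw [Set.indicator_of_mem (by exact hw)]
    rw [← Finset.prod_subset hF (fun n hn hnF => ?_)]
    · refine Finset.prod_congr rfl fun n hn => ?_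
      rw [Set.indicator_of_mem (hw n (Finset.mem_range.1 (hF hn))), if_pos hn]
    · rw [Set.indicator_of_mem (hw n (Finset.mem_range.1 hn)), if_neg hnF]
  · rw [Set.indicator_of_notMem (by exact hw)]
    push Not at hw
    obtain ⟨n, hn, hnC⟩ := hw
    rw [Finset.prod_eq_zero (Finset.mem_range.2 hn)]
    rw [Set.indicator_of_notMem hnC]

end System

/-! ### Marked gaps: independence and joint law. -/

section System

variable {ι : Type*}

/-- The `n`-th gap of source `c`, marked by the fate of the packet preceding the `n`-th one. -/
def markedGap (c : ι) (n : ℕ) (p : SysPath ι) : (ℝ × ℝ) × Prop :=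
  (gap 0 (p c) n, prevDelivered c n p)

@[fun_prop]
lemma measurable_gap_apply (c : ι) (n : ℕ) :
    Measurable fun p : SysPath ι => gap 0 (p c) n :=
  (measurable_gap 0 n).comp (measurable_pi_apply c)

lemma measurable_markedGap [Countable ι] (c : ι) (n : ℕ) :
    Measurable (markedGap c n : SysPath ι → (ℝ × ℝ) × Prop) :=
  (measurable_gap_apply c n).prodMk
    (measurableSet_setOfPred.1 (measurableSet_prevDelivered c n))

variable [Fintype ι] {rate : ι → ℝ} {σ : Measure ℝ}

/-- The total arrival rate of the sources other than `c`. -/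
noncomputable def otherRate (rate : ι → ℝ) (c : ι) : ℝ := ∑ d, rate d - rate c

open Classical in
lemma sum_compl_eq_otherRate (rate : ι → ℝ) (c : ι) :
    ∑ d ∈ {c}ᶜ, rate d = otherRate rate c := by
  have := Finset.sum_add_sum_compl {c} rate
  rw [Finset.sum_singleton] at this
  rw [otherRate, ← this]
  ring

-- The propositions `e n` switch the condition on the mark on or off. Events of this kind generate
-- each marked gap and never require the probability of a preemption.
open Classical in
lemma sysLaw_forall_gap_mem (hr : ∀ d, 0 < rate d) [IsProbabilityMeasure σ]
    (hσ : ∀ᵐ x ∂σ, 0 ≤ x) (c : ι) (F : Finset ℕ) {C : ℕ → Set (ℝ × ℝ)}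
    (hC : ∀ n, MeasurableSet (C n)) (e : ℕ → Prop) :
    sysLaw rate σ {p | ∀ n ∈ F, gap 0 (p c) n ∈ C n ∧ (e n → prevDelivered c n p)} =
      ∏ n ∈ F, ∫⁻ z in C n,
        (if e n then survival (otherRate rate c) z else 1) ∂(gapLaw (rate c) σ n) := by
  have hprob := fun n => isProbabilityMeasure_gapLaw (σ := σ) (hr c) n
  let N := F.sup id + 1
  have hsN : F ⊆ Finset.range N := fun i hi => by
    have : i ≤ F.sup id := Finset.le_sup (f := id) hi
    simp [N]; omega
  have key := sysLaw_gap_inter_prevDelivered hr hσ c N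
    (C := fun n => if n ∈ F then C n else Set.univ)
    (fun n => by split_ifs; exacts [hC n, .univ])
    ((Finset.filter_subset e F).trans hsN)
  rw [sum_compl_eq_otherRate, ← Finset.prod_subset hsN] at key
  · convert key using 1
    · congr 1
      ext p
      simp only [Set.mem_ofPred_eq, Finset.mem_filter]
      constructor
      · intro h
        refine ⟨fun n _ => ?_, fun n hn => (h n hn.1).2 hn.2⟩
        by_cases hn : n ∈ F
        · simpa [hn] using (h n hn).1
        · simp [hn]
      · rintro ⟨h1, h2⟩ n hn
        refine ⟨?_, fun he => h2 n ⟨hn, he⟩⟩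
        simpa [hn] using h1 n (Finset.mem_range.1 (hsN hn))
    · refine Finset.prod_congr rfl fun n hn => ?_
      simp [hn]
  · intro n _ hn
    simp [hn]

open Classical in
lemma sysLaw_gap_mem (hr : ∀ d, 0 < rate d) [IsProbabilityMeasure σ]
    (hσ : ∀ᵐ x ∂σ, 0 ≤ x) (c : ι) (n : ℕ) {C : Set (ℝ × ℝ)} (hC : MeasurableSet C) (e : Prop) :
    sysLaw rate σ {p | gap 0 (p c) n ∈ C ∧ (e → prevDelivered c n p)} =
      ∫⁻ z in C, (if e then survival (otherRate rate c) z else 1) ∂(gapLaw (rate c) σ n) := by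
  simpa using sysLaw_forall_gap_mem hr hσ c {n} (C := fun _ => C) (fun _ => hC) (fun _ => e)

/-- The marked gaps are independent. -/
lemma iIndepFun_markedGap (hr : ∀ d, 0 < rate d) [IsProbabilityMeasure σ]
    (hσ : ∀ᵐ x ∂σ, 0 ≤ x) (c : ι) :
    iIndepFun (markedGap c) (sysLaw rate σ) := by
  classical
  have := isProbabilityMeasure_sysLaw (σ := σ) hr
  -- A π-system: `e = False` leaves the mark free, `e = True` requires a delivery, and intersecting
  -- two sets takes `e ∨ e'`.
  let π : ℕ → Set (Set (SysPath ι)) := fun n => {s | ∃ C : Set (ℝ × ℝ), MeasurableSet C ∧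
    ∃ e : Prop, s = {p | gap 0 (p c) n ∈ C ∧ (e → prevDelivered c n p)}}
  have hπm : ∀ n, ∀ s ∈ π n, MeasurableSet s := by
    rintro n _ ⟨C, hC, e, rfl⟩
    refine (measurable_gap_apply c n hC).inter
      (?_ : MeasurableSet {p : SysPath ι | e → prevDelivered c n p})
    by_cases he : e
    · have h : {p : SysPath ι | e → prevDelivered c n p} = {p | prevDelivered c n p} := by
        ext p; exact forall_prop_of_true he
      rw [h]
      exact measurableSet_prevDelivered c n
    · have h : {p : SysPath ι | e → prevDelivered c n p} = Set.univ := by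
        ext p; simp [he]
      rw [h]
      exact MeasurableSet.univ
  have hind : iIndep (fun n => MeasurableSpace.generateFrom (π n)) (sysLaw rate σ) := by
    refine iIndepSets.iIndep (m := fun n => MeasurableSpace.generateFrom (π n)) (π := π)
      (fun n => MeasurableSpace.generateFrom_le (hπm n)) ?_ (fun n => rfl) ?_
    · rintro n _ ⟨C, hC, e, rfl⟩ _ ⟨C', hC', e', rfl⟩ _
      refine ⟨C ∩ C', hC.inter hC', e ∨ e', ?_⟩
      ext p
      simp only [Set.mem_inter_iff, Set.mem_ofPred_eq]
      tauto
    · rw [iIndepSets_iff]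
      intro F f hf
      choose! C hC e he using hf
      have h1 : (⋂ n ∈ F, f n) =
          {p | ∀ n ∈ F, gap 0 (p c) n ∈ (if n ∈ F then C n else Set.univ) ∧
            (e n → prevDelivered c n p)} := by
        ext p
        simp only [Set.mem_iInter, Set.mem_ofPred_eq]
        refine forall₂_congr fun n hn => ?_
        rw [he n hn]
        simp [hn]
      rw [h1, sysLaw_forall_gap_mem hr hσ c F
        (fun n => by split_ifs with h; exacts [hC n h, .univ]) e]
      refine Finset.prod_congr rfl fun n hn => ?_
      rw [he n hn, sysLaw_gap_mem hr hσ c n (hC n hn)]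
      simp [hn]
  refine iIndep_of_iIndep_of_le hind fun n => ?_
  rw [← measurable_iff_comap_le]
  have h1 : Measurable[MeasurableSpace.generateFrom (π n)]
      fun p : SysPath ι => gap 0 (p c) n := fun C hC =>
    MeasurableSpace.measurableSet_generateFrom ⟨C, hC, False, by ext p; simp⟩
  have h2 : Measurable[MeasurableSpace.generateFrom (π n)]
      (prevDelivered c n : SysPath ι → Prop) :=
    (@measurableSet_setOfPred _ (MeasurableSpace.generateFrom (π n)) _).1 <|
      MeasurableSpace.measurableSet_generateFrom ⟨Set.univ, .univ, True, by ext p; simp⟩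
  exact Measurable.prodMk h1 h2

lemma lintegral_gap (hr : ∀ d, 0 < rate d) [IsProbabilityMeasure σ]
    (hσ : ∀ᵐ x ∂σ, 0 ≤ x) (c : ι) (n : ℕ) {φ : ℝ × ℝ → ℝ≥0∞} (hφ : Measurable φ) :
    ∫⁻ p, φ (gap 0 (p c) n) ∂(sysLaw rate σ) = ∫⁻ z, φ z ∂(gapLaw (rate c) σ n) := by
  have : (sysLaw rate σ).map (fun p => gap 0 (p c) n) = gapLaw (rate c) σ n := by
    ext C hC
    rw [Measure.map_apply (measurable_gap_apply c n) hC]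
    simpa [Set.preimage] using sysLaw_gap_mem hr hσ c n hC False
  rw [← this, lintegral_map hφ (measurable_gap_apply c n)]

/-- On the event of a delivery, the gap has density `survival` with respect to its unconditional
law. -/
lemma setLIntegral_gap_prevDelivered (hr : ∀ d, 0 < rate d) [IsProbabilityMeasure σ]
    (hσ : ∀ᵐ x ∂σ, 0 ≤ x) (c : ι) (n : ℕ) {φ : ℝ × ℝ → ℝ≥0∞} (hφ : Measurable φ) :
    ∫⁻ p in {p | prevDelivered c n p}, φ (gap 0 (p c) n) ∂(sysLaw rate σ) =
      ∫⁻ z, survival (otherRate rate c) z * φ z ∂(gapLaw (rate c) σ n) := by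
  have : ((sysLaw rate σ).restrict {p | prevDelivered c n p}).map (fun p => gap 0 (p c) n) =
      (gapLaw (rate c) σ n).withDensity (survival (otherRate rate c)) := by
    ext C hC
    rw [Measure.map_apply (measurable_gap_apply c n) hC,
      Measure.restrict_apply (measurable_gap_apply c n hC), withDensity_apply _ hC]
    simpa [Set.preimage, Set.inter_def] using sysLaw_gap_mem hr hσ c n hC True
  rw [← lintegral_map hφ (measurable_gap_apply c n), this,
    lintegral_withDensity_eq_lintegral_mul _ (measurable_survival _) hφ]
  rfl

end System

/-! ### Exponential moments of a gap -/

/-- The exponential moment of order `s` of the exponential law, as an extended nonnegative real. -/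
noncomputable def expMoment (r s : ℝ) : ℝ≥0∞ :=
  ∫⁻ x, ENNReal.ofReal (Real.exp (s * x)) ∂(expMeasure r)

lemma expMoment_of_lt {r s : ℝ} (hr : 0 < r) (hs : s < r) :
    expMoment r s = ENNReal.ofReal (r / (r - s)) := by
  have h0 : 0 < r - s := sub_pos.2 hs
  have h1 : ∫⁻ x in Set.Ioi (0 : ℝ), ENNReal.ofReal ((r - s) * Real.exp (-((r - s) * x))) = 1 := by
    have := isProbabilityMeasure_expMeasure h0
    have h := lintegral_expMeasure (r - s) (fun _ => 1)
    simpa using h.symm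
  rw [expMoment, lintegral_expMeasure]
  have h2 : ∀ x : ℝ, ENNReal.ofReal (r * Real.exp (-(r * x))) * ENNReal.ofReal (Real.exp (s * x)) =
      ENNReal.ofReal (r / (r - s)) * ENNReal.ofReal ((r - s) * Real.exp (-((r - s) * x))) := by
    intro x
    rw [← ENNReal.ofReal_mul (by positivity), ← ENNReal.ofReal_mul (by positivity), mul_assoc,
      ← Real.exp_add, ← mul_assoc, div_mul_cancel₀ _ h0.ne']
    ring_nf
  simp_rw [h2]
  rw [lintegral_const_mul' _ _ ENNReal.ofReal_ne_top, h1, mul_one]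

lemma expMoment_of_le {r s : ℝ} (hr : 0 < r) (hs : r ≤ s) : expMoment r s = ∞ := by
  rw [expMoment, lintegral_expMeasure, eq_top_iff]
  calc ∞ = ∫⁻ _ in Set.Ioi (0 : ℝ), ENNReal.ofReal r := by
        rw [setLIntegral_const, Real.volume_Ioi, ENNReal.mul_top (by simpa using hr)]
    _ ≤ _ := by
        refine setLIntegral_mono' measurableSet_Ioi fun x hx => ?_
        rw [← ENNReal.ofReal_mul (by positivity), mul_assoc, ← Real.exp_add]
        refine ENNReal.ofReal_le_ofReal (le_mul_of_one_le_right hr.le (Real.one_le_exp ?_))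
        have : 0 ≤ (s - r) * x := mul_nonneg (sub_nonneg.2 hs) (le_of_lt hx)
        linarith

lemma setLIntegral_Ici_exp_expMeasure {r : ℝ} (s : ℝ) {y : ℝ} (hy : 0 ≤ y) :
    ∫⁻ x in Set.Ici y, ENNReal.ofReal (Real.exp (s * x)) ∂(expMeasure r) =
      ENNReal.ofReal (Real.exp ((s - r) * y)) * expMoment r s := by
  have hac : expMeasure r ≪ volume := withDensity_absolutelyContinuous _ _
  rw [setLIntegral_congr (hac.ae_eq Ioi_ae_eq_Ici.symm)]
  have h1 : ∀ x, ENNReal.ofReal (Real.exp (s * x)) =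
      ENNReal.ofReal (Real.exp (s * y)) * ENNReal.ofReal (Real.exp (s * (x - y))) := fun x => by
    rw [← ENNReal.ofReal_mul (Real.exp_pos _).le, ← Real.exp_add]
    ring_nf
  rw [lintegral_congr h1, lintegral_const_mul' _ _ ENNReal.ofReal_ne_top,
    setLIntegral_Ioi_expMeasure_sub r hy (fun x => ENNReal.ofReal (Real.exp (s * x))), ← mul_assoc,
    ← ENNReal.ofReal_mul (Real.exp_pos _).le, ← Real.exp_add, expMoment]
  ring_nf

/-- The exponential moment of order `s` of the service law. -/
noncomputable def serviceMoment (σ : Measure ℝ) (s : ℝ) : ℝ≥0∞ :=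
  ∫⁻ y, ENNReal.ofReal (Real.exp (s * y)) ∂σ

section Moments

variable {r : ℝ} {σ : Measure ℝ}

lemma lintegral_survival_mul (hr : 0 < r) [IsProbabilityMeasure σ] (μ : ℝ)
    {f g : ℝ → ℝ≥0∞} (hf : Measurable f) (hg : Measurable g) :
    ∫⁻ z, survival μ z * (f z.1 * g z.2) ∂((expMeasure r).prod σ) =
      ∫⁻ y, ENNReal.ofReal (Real.exp (-(μ * y))) * g y *
        ∫⁻ x in Set.Ici y, f x ∂(expMeasure r) ∂σ := by
  have := isProbabilityMeasure_expMeasure hr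
  rw [lintegral_prod_symm _ (by fun_prop)]
  refine lintegral_congr fun y => ?_
  rw [← lintegral_const_mul _ hf, ← lintegral_indicator measurableSet_Ici]
  refine lintegral_congr fun x => ?_
  by_cases hx : y ≤ x
  · rw [Set.indicator_of_mem (Set.mem_Ici.2 hx), survival, Set.indicator_of_mem (by exact hx)]
    ring
  · rw [Set.indicator_of_notMem (by simpa using hx), survival,
      Set.indicator_of_notMem (by exact hx), zero_mul]

/-- Given the service time `y`, the other sources contribute `exp (-μ y)`, and the interarrival time
restricted to `[y, ∞)` contributes `exp ((s - r) y)` times its full moment. This is where the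
argument `s - λ` of `M` comes from. -/
lemma lintegral_survival_mul_exp_fst (hr : 0 < r) [IsProbabilityMeasure σ]
    (hσ : ∀ᵐ x ∂σ, 0 ≤ x) (μ s : ℝ) :
    ∫⁻ z, survival μ z * ENNReal.ofReal (Real.exp (s * z.1)) ∂((expMeasure r).prod σ) =
      expMoment r s * serviceMoment σ (s - (r + μ)) := by
  have h := lintegral_survival_mul (σ := σ) hr μ
    (f := fun x => ENNReal.ofReal (Real.exp (s * x))) (g := fun _ => 1) (by fun_prop) (by fun_prop)
  simp only [mul_one] at h
  rw [h, serviceMoment, ← lintegral_const_mul _ (by fun_prop)]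
  refine lintegral_congr_ae ?_
  filter_upwards [hσ] with y hy
  rw [setLIntegral_Ici_exp_expMeasure s hy, ← mul_assoc, mul_comm,
    ← ENNReal.ofReal_mul (Real.exp_pos _).le, ← Real.exp_add]
  ring_nf

/-- Here the interarrival time enters only through the probability `exp (-r y)` that it is at least
`y`. -/
lemma lintegral_survival_mul_exp_snd (hr : 0 < r) [IsProbabilityMeasure σ]
    (hσ : ∀ᵐ x ∂σ, 0 ≤ x) (μ s : ℝ) :
    ∫⁻ z, survival μ z * ENNReal.ofReal (Real.exp (s * z.2)) ∂((expMeasure r).prod σ) =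
      serviceMoment σ (s - (r + μ)) := by
  have h := lintegral_survival_mul (σ := σ) hr μ (f := fun _ => 1)
    (g := fun x => ENNReal.ofReal (Real.exp (s * x))) (by fun_prop) (by fun_prop)
  simp only [one_mul] at h
  rw [h, serviceMoment]
  refine lintegral_congr_ae ?_
  filter_upwards [hσ] with y hy
  rw [setLIntegral_one, expMeasure_Ici hr hy, ← ENNReal.ofReal_mul (Real.exp_pos _).le,
    ← ENNReal.ofReal_mul (by positivity), ← Real.exp_add, ← Real.exp_add]
  ring_nf

lemma serviceMoment_pos [IsProbabilityMeasure σ] (s : ℝ) : 0 < serviceMoment σ s := by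
  rw [serviceMoment, lintegral_pos_iff_support (by fun_prop)]
  have : Function.support (fun y => ENNReal.ofReal (Real.exp (s * y))) = Set.univ := by
    ext y
    simp [Real.exp_pos]
  rw [this, measure_univ]
  exact one_pos

lemma serviceMoment_le_one [IsProbabilityMeasure σ] (hσ : ∀ᵐ x ∂σ, 0 ≤ x) {s : ℝ} (hs : s ≤ 0) :
    serviceMoment σ s ≤ 1 := by
  calc serviceMoment σ s ≤ ∫⁻ _, 1 ∂σ := by
        refine lintegral_mono_ae ?_
        filter_upwards [hσ] with y hy
        rw [ENNReal.ofReal_le_one, Real.exp_le_one_iff]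
        exact mul_nonpos_of_nonpos_of_nonneg hs hy
    _ = 1 := by simp

end Moments

/-! ### Products over consecutive marked gaps -/

section System

variable {ι : Type*}

/-- The information contained in the marked gaps up to the `m`-th one. -/
@[reducible]
def gapsUpTo (c : ι) (m : ℕ) : MeasurableSpace (SysPath ι) :=
  ⨆ k ∈ Set.Iic m, MeasurableSpace.comap (markedGap c k) inferInstance

lemma measurable_markedGap_gapsUpTo (c : ι) {k m : ℕ} (hk : k ≤ m) :
    Measurable[gapsUpTo c m] (markedGap c k) :=
  measurable_iff_comap_le.2 (le_iSup₂_of_le k (Set.mem_Iic.2 hk) le_rfl)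

lemma gapsUpTo_mono (c : ι) : Monotone (gapsUpTo c) := fun _ _ h =>
  iSup₂_le fun k hk => le_iSup₂_of_le k (Set.mem_Iic.2 (le_trans hk h)) le_rfl

lemma gapsUpTo_le [Countable ι] (c : ι) (m : ℕ) : gapsUpTo c m ≤ MeasurableSpace.pi :=
  iSup₂_le fun k _ => (measurable_markedGap c k).comap_le

/-- Exponential weight of an interarrival time after a preempted packet. -/
noncomputable def lostWeight (s : ℝ) (q : (ℝ × ℝ) × Prop) : ℝ≥0∞ :=
  {q : (ℝ × ℝ) × Prop | ¬ q.2}.indicator (fun q => ENNReal.ofReal (Real.exp (s * q.1.1))) q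

/-- Exponential weight of an interarrival time after a delivered packet. -/
noncomputable def keptWeight (s : ℝ) (q : (ℝ × ℝ) × Prop) : ℝ≥0∞ :=
  {q : (ℝ × ℝ) × Prop | q.2}.indicator (fun q => ENNReal.ofReal (Real.exp (s * q.1.1))) q

/-- Exponential weight of the service time of a delivered packet. -/
noncomputable def serviceWeight (s : ℝ) (q : (ℝ × ℝ) × Prop) : ℝ≥0∞ :=
  {q : (ℝ × ℝ) × Prop | q.2}.indicator (fun q => ENNReal.ofReal (Real.exp (s * q.1.2))) q

lemma measurableSet_mark : MeasurableSet {q : (ℝ × ℝ) × Prop | q.2} :=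
  measurableSet_setOfPred.2 measurable_snd

@[fun_prop]
lemma measurable_lostWeight (s : ℝ) : Measurable (lostWeight s) :=
  Measurable.indicator (by fun_prop) measurableSet_mark.compl

@[fun_prop]
lemma measurable_keptWeight (s : ℝ) : Measurable (keptWeight s) :=
  Measurable.indicator (by fun_prop) measurableSet_mark

@[fun_prop]
lemma measurable_serviceWeight (s : ℝ) : Measurable (serviceWeight s) :=
  Measurable.indicator (by fun_prop) measurableSet_mark

/-- Exponential weight of the time from the `m`-th packet to the delivery of the `(m+j)`-th one, if
this is the first delivered packet from the `m`-th one on. -/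
noncomputable def runWeight (s : ℝ) (c : ι) (m j : ℕ) (p : SysPath ι) : ℝ≥0∞ :=
  (∏ k ∈ Finset.range j, lostWeight s (markedGap c (m + 1 + k) p)) *
    serviceWeight s (markedGap c (m + 1 + j) p)

-- Mark `n + 1` records the fate of packet `n`. The weights of the lost packets telescope to the
-- time between arrivals `m` and `m + j`.
open Classical in
lemma runWeight_eq (s : ℝ) (c : ι) (m j : ℕ) (p : SysPath ι) :
    runWeight s c m j p =
      if (∀ k < j, ¬ prevDelivered c (m + k + 1) p) ∧ prevDelivered c (m + j + 1) p then
        ENNReal.ofReal (Real.exp (s * (arrival (p c) (m + j) + (p c (m + j)).2 - arrival (p c) m)))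
      else 0 := by
  have hidx : ∀ k, m + 1 + k = m + k + 1 := fun k => by ring
  simp_rw [runWeight, hidx]
  by_cases h1 : ∀ k < j, ¬ prevDelivered c (m + k + 1) p
  · have hp : ∏ k ∈ Finset.range j, lostWeight s (markedGap c (m + k + 1) p) =
        ENNReal.ofReal (Real.exp (s * (arrival (p c) (m + j) - arrival (p c) m))) := by
      clear hidx
      induction j with
      | zero => simp
      | succ j ih =>
        rw [Finset.prod_range_succ, ih fun k hk => h1 k (by omega), lostWeight,
          Set.indicator_of_mem (by exact h1 j (by omega)),
          ← ENNReal.ofReal_mul (Real.exp_pos _).le, ← Real.exp_add, ← add_assoc, arrival_succ]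
        simp only [markedGap, gap]
        ring_nf
    rw [hp]
    by_cases h2 : prevDelivered c (m + j + 1) p
    · rw [if_pos ⟨h1, h2⟩, serviceWeight, Set.indicator_of_mem (by exact h2),
        ← ENNReal.ofReal_mul (Real.exp_pos _).le, ← Real.exp_add]
      simp only [markedGap, gap, prevService]
      ring_nf
    · rw [if_neg fun h => h2 h.2, serviceWeight, Set.indicator_of_notMem (by exact h2), mul_zero]
  · rw [if_neg fun h => h1 h.1]
    push Not at h1
    obtain ⟨k, hk, hd⟩ := h1
    rw [Finset.prod_eq_zero (Finset.mem_range.2 hk), zero_mul]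
    rw [lostWeight, Set.indicator_of_notMem (by exact not_not.2 hd)]

variable [Fintype ι] {rate : ι → ℝ} {σ : Measure ℝ}

lemma lintegral_mul_markedGap (hr : ∀ d, 0 < rate d) [IsProbabilityMeasure σ]
    (hσ : ∀ᵐ x ∂σ, 0 ≤ x) (c : ι) {m : ℕ} {G : SysPath ι → ℝ≥0∞} (hG : Measurable[gapsUpTo c m] G)
    {φ : (ℝ × ℝ) × Prop → ℝ≥0∞} (hφ : Measurable φ) :
    ∫⁻ p, G p * φ (markedGap c (m + 1) p) ∂(sysLaw rate σ) =
      (∫⁻ p, G p ∂(sysLaw rate σ)) * ∫⁻ p, φ (markedGap c (m + 1) p) ∂(sysLaw rate σ) := by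
  have hind := indep_iSup_of_disjoint (fun k => (measurable_markedGap c k).comap_le)
    (iIndepFun_markedGap hr hσ c).iIndep
    (show Disjoint (Set.Iic m) {m + 1} by simp)
  refine lintegral_mul_eq_lintegral_mul_lintegral_of_independent_measurableSpace
    (gapsUpTo_le c m) (iSup₂_le fun k _ => (measurable_markedGap c k).comap_le) hind hG ?_
  refine hφ.comp (measurable_iff_comap_le.2 ?_)
  exact le_iSup₂_of_le (m + 1) rfl le_rfl

lemma lintegral_keptWeight (hr : ∀ d, 0 < rate d) [IsProbabilityMeasure σ]
    (hσ : ∀ᵐ x ∂σ, 0 ≤ x) (c : ι) (s : ℝ) (n : ℕ) :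
    ∫⁻ p, keptWeight s (markedGap c (n + 1) p) ∂(sysLaw rate σ) =
      expMoment (rate c) s * serviceMoment σ (s - ∑ d, rate d) := by
  have h := setLIntegral_gap_prevDelivered hr hσ c (n + 1)
    (φ := fun z => ENNReal.ofReal (Real.exp (s * z.1))) (by fun_prop)
  rw [← lintegral_indicator (measurableSet_prevDelivered c (n + 1))] at h
  refine h.trans ?_
  rw [gapLaw, lintegral_survival_mul_exp_fst (hr c) hσ, otherRate, add_sub_cancel]

lemma lintegral_serviceWeight (hr : ∀ d, 0 < rate d) [IsProbabilityMeasure σ]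
    (hσ : ∀ᵐ x ∂σ, 0 ≤ x) (c : ι) (s : ℝ) (n : ℕ) :
    ∫⁻ p, serviceWeight s (markedGap c (n + 1) p) ∂(sysLaw rate σ) =
      serviceMoment σ (s - ∑ d, rate d) := by
  have h := setLIntegral_gap_prevDelivered hr hσ c (n + 1)
    (φ := fun z => ENNReal.ofReal (Real.exp (s * z.2))) (by fun_prop)
  rw [← lintegral_indicator (measurableSet_prevDelivered c (n + 1))] at h
  refine h.trans ?_
  rw [gapLaw, lintegral_survival_mul_exp_snd (hr c) hσ, otherRate, add_sub_cancel]

lemma lintegral_exp_gap_fst (hr : ∀ d, 0 < rate d) [IsProbabilityMeasure σ]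
    (hσ : ∀ᵐ x ∂σ, 0 ≤ x) (c : ι) (s : ℝ) (n : ℕ) :
    ∫⁻ p, ENNReal.ofReal (Real.exp (s * (p c n).1)) ∂(sysLaw rate σ) = expMoment (rate c) s := by
  have := isProbabilityMeasure_expMeasure (hr c)
  have h := lintegral_gap hr hσ c n
    (φ := fun z => ENNReal.ofReal (Real.exp (s * z.1))) (by fun_prop)
  refine h.trans ?_
  have h2 : (gapLaw (rate c) σ n).map Prod.fst = expMeasure (rate c) := by
    cases n <;> simp [gapLaw]
  rw [expMoment, ← h2, lintegral_map (by fun_prop) measurable_fst]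

/-- Losses are complements of the events whose probabilities are known, so the full laws of the
marked gaps are compared on a π-system. The comparison starts at index `1`, since gap `0` carries
the virtual packet. -/
lemma lintegral_lostWeight_eq (hr : ∀ d, 0 < rate d) [IsProbabilityMeasure σ]
    (hσ : ∀ᵐ x ∂σ, 0 ≤ x) (c : ι) (s : ℝ) (n : ℕ) :
    ∫⁻ p, lostWeight s (markedGap c (n + 1) p) ∂(sysLaw rate σ) =
      ∫⁻ p, lostWeight s (markedGap c 1 p) ∂(sysLaw rate σ) := by
  have hl := isProbabilityMeasure_sysLaw (σ := σ) hr
  have key : ∀ n, (sysLaw rate σ).map (markedGap c (n + 1)) =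
      (sysLaw rate σ).map (markedGap c 1) := by
    intro n
    have hmap := fun k => Measure.isProbabilityMeasure_map (μ := sysLaw rate σ)
      (measurable_markedGap c k).aemeasurable
    let π : Set (Set ((ℝ × ℝ) × Prop)) := {s | ∃ C : Set (ℝ × ℝ), MeasurableSet C ∧
      ∃ e : Prop, s = {q | q.1 ∈ C ∧ (e → q.2)}}
    have hgen : (inferInstance : MeasurableSpace ((ℝ × ℝ) × Prop)) =
        MeasurableSpace.generateFrom π := by
      refine le_antisymm ?_ (MeasurableSpace.generateFrom_le ?_)
      · refine sup_le (measurable_iff_comap_le.1 fun C hC => ?_)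
          (measurable_iff_comap_le.1 ?_)
        · exact MeasurableSpace.measurableSet_generateFrom ⟨C, hC, False, by ext p; simp⟩
        · exact (@measurableSet_setOfPred _ (MeasurableSpace.generateFrom π) _).1 <|
            MeasurableSpace.measurableSet_generateFrom ⟨Set.univ, .univ, True, by ext p; simp⟩
      · rintro _ ⟨C, hC, e, rfl⟩
        refine (measurable_fst hC).inter (?_ : MeasurableSet {q : (ℝ × ℝ) × Prop | e → q.2})
        by_cases he : e
        · simpa [he] using measurableSet_mark
        · have : {q : (ℝ × ℝ) × Prop | e → q.2} = Set.univ := by ext; simp [he]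
          rw [this]
          exact .univ
    refine ext_of_generate_finite π hgen ?_ ?_ (by simp)
    · rintro _ ⟨C, hC, e, rfl⟩ _ ⟨C', hC', e', rfl⟩ _
      refine ⟨C ∩ C', hC.inter hC', e ∨ e', ?_⟩
      ext p
      simp only [Set.mem_inter_iff, Set.mem_ofPred_eq]
      tauto
    · intro t ht
      have htm : MeasurableSet t := by
        have := MeasurableSpace.measurableSet_generateFrom ht
        rwa [← hgen] at this
      obtain ⟨C, hC, e, rfl⟩ := ht
      rw [Measure.map_apply (measurable_markedGap c _) htm,
        Measure.map_apply (measurable_markedGap c _) htm]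
      exact (sysLaw_gap_mem hr hσ c (n + 1) hC e).trans (sysLaw_gap_mem hr hσ c 1 hC e).symm
  rw [← lintegral_map (measurable_lostWeight s) (measurable_markedGap c _), key n,
    lintegral_map (measurable_lostWeight s) (measurable_markedGap c _)]

/-- The exponential moment of an interarrival time following a preempted packet. -/
noncomputable def lostMoment (rate : ι → ℝ) (σ : Measure ℝ) (c : ι) (s : ℝ) : ℝ≥0∞ :=
  ∫⁻ p, lostWeight s (markedGap c 1 p) ∂(sysLaw rate σ)

/-- Lost and kept weights add up to the weight of the whole interarrival time. The additive form
stays valid when the moments are infinite. -/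
lemma lostMoment_add (hr : ∀ d, 0 < rate d) [IsProbabilityMeasure σ]
    (hσ : ∀ᵐ x ∂σ, 0 ≤ x) (c : ι) (s : ℝ) :
    lostMoment rate σ c s + expMoment (rate c) s * serviceMoment σ (s - ∑ d, rate d) =
      expMoment (rate c) s := by
  rw [← lintegral_keptWeight hr hσ c s 0, ← lintegral_exp_gap_fst hr hσ c s 1, lostMoment,
    ← lintegral_add_left (f := fun p => lostWeight s (markedGap c 1 p))
      ((measurable_lostWeight s).comp (measurable_markedGap c 1))]
  refine lintegral_congr fun p => ?_
  by_cases h : prevDelivered c 1 p <;>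
    simp [lostWeight, keptWeight, markedGap, gap, h]

/-- Marked gaps are peeled off one at a time, each being independent of all that precede it; `G`
stands for any weight of the history. -/
lemma lintegral_mul_runWeight (hr : ∀ d, 0 < rate d) [IsProbabilityMeasure σ]
    (hσ : ∀ᵐ x ∂σ, 0 ≤ x) (c : ι) (s : ℝ) {m : ℕ} {G : SysPath ι → ℝ≥0∞}
    (hG : Measurable[gapsUpTo c m] G) (j : ℕ) :
    ∫⁻ p, G p * runWeight s c m j p ∂(sysLaw rate σ) =
      (∫⁻ p, G p ∂(sysLaw rate σ)) * lostMoment rate σ c s ^ j *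
        serviceMoment σ (s - ∑ d, rate d) := by
  have hprod : ∀ j, (Measurable[gapsUpTo c (m + j)] fun p =>
      G p * ∏ k ∈ Finset.range j, lostWeight s (markedGap c (m + 1 + k) p)) ∧
      ∫⁻ p, G p * ∏ k ∈ Finset.range j, lostWeight s (markedGap c (m + 1 + k) p)
        ∂(sysLaw rate σ) = (∫⁻ p, G p ∂(sysLaw rate σ)) * lostMoment rate σ c s ^ j := by
    intro j
    induction j with
    | zero => simpa using hG
    | succ j ih =>
      simp_rw [Finset.prod_range_succ, ← mul_assoc]
      rw [show m + 1 + j = m + j + 1 by ring]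
      refine ⟨?_, ?_⟩
      · have h1 := ih.1.mono (gapsUpTo_mono c (show m + j ≤ m + (j + 1) by omega)) le_rfl
        have h2 : Measurable[gapsUpTo c (m + (j + 1))]
            fun p => lostWeight s (markedGap c (m + j + 1) p) :=
          (measurable_lostWeight s).comp (measurable_markedGap_gapsUpTo c (by omega))
        exact h1.mul h2
      · rw [lintegral_mul_markedGap hr hσ c ih.1 (measurable_lostWeight s), ih.2,
          lintegral_lostWeight_eq hr hσ c s, pow_succ, mul_assoc]
        rfl
  simp_rw [runWeight, ← mul_assoc]
  rw [show m + 1 + j = m + j + 1 by ring,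
    lintegral_mul_markedGap hr hσ c (hprod j).1 (measurable_serviceWeight s), (hprod j).2,
    lintegral_serviceWeight hr hσ c s]

end System

/-! ### Enumerations of infinite sets of natural numbers -/

section Nth

variable {D : ℕ → Prop}

/-- Written with `0 + k` so as to match `runWeight_eq` at `m = 0`. -/
lemma nth_zero_eq_iff (hD : {n | D n}.Infinite) {j : ℕ} :
    Nat.nth D 0 = j ↔ (∀ k < j, ¬ D (0 + k)) ∧ D (0 + j) := by
  simp only [zero_add]
  have hl := Nat.isLeast_nth_of_infinite hD 0
  constructor
  · rintro rfl
    exact ⟨fun k hk hDk => absurd (hl.2 ⟨hDk, by simp⟩) (not_le.2 hk), hl.1.1⟩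
  · rintro ⟨h1, h2⟩
    refine le_antisymm (hl.2 ⟨h2, by simp⟩) (not_lt.1 fun hlt => h1 _ hlt hl.1.1)

lemma nth_succ_eq_iff (hD : {n | D n}.Infinite) {i j : ℕ} :
    Nat.nth D (i + 1) = Nat.nth D i + 1 + j ↔
      (∀ k < j, ¬ D (Nat.nth D i + 1 + k)) ∧ D (Nat.nth D i + 1 + j) := by
  have hl : IsLeast {n | D n ∧ ∀ k < i + 1, Nat.nth D k < n} (Nat.nth D (i + 1)) :=
    Nat.isLeast_nth_of_infinite hD (i + 1)
  have hle : ∀ k < i + 1, Nat.nth D k ≤ Nat.nth D i := fun k hk =>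
    Nat.nth_monotone hD (Nat.lt_succ_iff.1 hk)
  have hlt : Nat.nth D i < Nat.nth D (i + 1) := Nat.nth_strictMono hD i.lt_succ_self
  constructor
  · intro h
    refine ⟨fun k hk hDk => ?_, h ▸ hl.1.1⟩
    have := hl.2 ⟨hDk, fun k' hk' => by have := hle k' hk'; omega⟩
    omega
  · rintro ⟨h1, h2⟩
    refine le_antisymm (hl.2 ⟨h2, fun k' hk' => by have := hle k' hk'; omega⟩)
      (not_lt.1 fun hlt' => ?_)
    obtain ⟨k, hk⟩ := Nat.exists_eq_add_of_le (Nat.succ_le_of_lt hlt)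
    refine h1 k (by omega) ?_
    rw [← Nat.succ_eq_add_one, ← hk]
    exact hl.1.1

lemma nth_eq_iff [DecidablePred D] (hD : {n | D n}.Infinite) {i m : ℕ} :
    Nat.nth D i = m ↔ Nat.count D m = i ∧ D m := by
  constructor
  · rintro rfl
    exact ⟨Nat.count_nth_of_infinite hD i, Nat.nth_mem_of_infinite hD i⟩
  · rintro ⟨rfl, h⟩
    exact Nat.nth_count h

end Nth

/-! ### Delivery indices, and the exponential moments of the first delivery time and of the peak
age. -/

section System

variable {ι : Type*}

/-- The index of the `i`-th delivered packet of source `c`. -/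
noncomputable def deliveryIndex (c : ι) (i : ℕ) (p : SysPath ι) : ℕ :=
  Nat.nth (fun n => prevDelivered c (n + 1) p) i

/-- The time of the first delivery of source `c`. -/
noncomputable def firstDelivery (c : ι) (p : SysPath ι) : ℝ :=
  arrival (p c) (deliveryIndex c 0 p) + (p c (deliveryIndex c 0 p)).2

/-- The age of source `c` just before its `(i+1)`-st delivery. -/
noncomputable def sysPeak (c : ι) (i : ℕ) (p : SysPath ι) : ℝ :=
  arrival (p c) (deliveryIndex c (i + 1) p) + (p c (deliveryIndex c (i + 1) p)).2 -
    arrival (p c) (deliveryIndex c i p)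

open Classical in
/-- The number of delivered packets of source `c` among the first `m` packets. -/
noncomputable def deliveryCount (c : ι) (m : ℕ) (p : SysPath ι) : ℕ :=
  Nat.count (fun n => prevDelivered c (n + 1) p) m

/-- The fates of packets `0, …, m - 1` are the marks `1, …, m`, so the count is known from the gaps
up to the `m`-th. -/
lemma measurable_deliveryCount (c : ι) (m : ℕ) :
    Measurable[gapsUpTo c m] (deliveryCount c m) := by
  induction m with
  | zero =>
    have : deliveryCount c 0 = fun _ => 0 := by
      funext p
      simp [deliveryCount]
    rw [this]
    exact measurable_const
  | succ m ih =>
    have h : deliveryCount c (m + 1) = fun p => deliveryCount c m p +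
        {q : (ℝ × ℝ) × Prop | q.2}.indicator (fun _ => 1) (markedGap c (m + 1) p) := by
      funext p
      by_cases hp : prevDelivered c (m + 1) p <;>
        simp [deliveryCount, Nat.count_succ, markedGap, hp]
    rw [h]
    have h1 := ih.mono (gapsUpTo_mono c m.le_succ) le_rfl
    have h2 : Measurable fun q : (ℝ × ℝ) × Prop =>
        {q : (ℝ × ℝ) × Prop | q.2}.indicator (fun _ => 1) q :=
      Measurable.indicator (f := fun _ => (1 : ℕ)) measurable_const measurableSet_mark
    have h3 : Measurable[gapsUpTo c (m + 1)] fun p : SysPath ι =>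
        {q : (ℝ × ℝ) × Prop | q.2}.indicator (fun _ => 1) (markedGap c (m + 1) p) :=
      h2.comp (measurable_markedGap_gapsUpTo c le_rfl)
    exact h1.add h3

lemma deliveryIndex_zero_eq_iff {c : ι} {p : SysPath ι}
    (hp : {n | prevDelivered c (n + 1) p}.Infinite) {j : ℕ} :
    deliveryIndex c 0 p = j ↔
      (∀ k < j, ¬ prevDelivered c (0 + k + 1) p) ∧ prevDelivered c (0 + j + 1) p :=
  nth_zero_eq_iff hp

lemma deliveryIndex_succ_eq_iff {c : ι} {p : SysPath ι}
    (hp : {n | prevDelivered c (n + 1) p}.Infinite) {i j : ℕ} :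
    deliveryIndex c (i + 1) p = deliveryIndex c i p + 1 + j ↔
      (∀ k < j, ¬ prevDelivered c (deliveryIndex c i p + 1 + k + 1) p) ∧
        prevDelivered c (deliveryIndex c i p + 1 + j + 1) p :=
  nth_succ_eq_iff hp

lemma deliveryIndex_eq_iff {c : ι} {p : SysPath ι}
    (hp : {n | prevDelivered c (n + 1) p}.Infinite) {i m : ℕ} :
    deliveryIndex c i p = m ↔ deliveryCount c m p = i ∧ prevDelivered c (m + 1) p := by
  classical
  unfold deliveryCount
  exact nth_eq_iff hp

/-- The indicator of the event that exactly `i` of the first `m` packets are delivered. -/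
noncomputable def countWeight (c : ι) (i m : ℕ) (p : SysPath ι) : ℝ≥0∞ :=
  (deliveryCount c m ⁻¹' {i}).indicator 1 p

lemma measurable_countWeight (c : ι) (i m : ℕ) :
    Measurable[gapsUpTo c m] (countWeight c i m) :=
  Measurable.indicator measurable_const (measurable_deliveryCount c m (measurableSet_singleton i))

variable [Fintype ι] {rate : ι → ℝ} {σ : Measure ℝ}

lemma measurable_runWeight (s : ℝ) (c : ι) (m j : ℕ) :
    Measurable (runWeight s c m j : SysPath ι → ℝ≥0∞) := by
  have := fun n => measurable_markedGap (ι := ι) c n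
  unfold runWeight
  fun_prop

lemma sysLaw_prevDelivered (hr : ∀ d, 0 < rate d) [IsProbabilityMeasure σ]
    (hσ : ∀ᵐ x ∂σ, 0 ≤ x) (c : ι) (n : ℕ) :
    sysLaw rate σ {p | prevDelivered c (n + 1) p} = serviceMoment σ (-∑ d, rate d) := by
  have h := lintegral_serviceWeight hr hσ c 0 n
  rw [zero_sub] at h
  rw [← h, ← lintegral_indicator_one (measurableSet_prevDelivered c (n + 1))]
  refine lintegral_congr fun p => ?_
  by_cases hp : prevDelivered c (n + 1) p <;> simp [serviceWeight, markedGap, hp]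

/-- Second Borel–Cantelli lemma: deliveries are independent events of the same positive probability.
-/
lemma ae_infinite_prevDelivered (hr : ∀ d, 0 < rate d) [IsProbabilityMeasure σ]
    (hσ : ∀ᵐ x ∂σ, 0 ≤ x) (c : ι) :
    ∀ᵐ p ∂(sysLaw rate σ), {n | prevDelivered c (n + 1) p}.Infinite := by
  have := isProbabilityMeasure_sysLaw (σ := σ) hr
  have hm := fun n => measurableSet_prevDelivered (ι := ι) c (n + 1)
  have hind : iIndepSet (fun n => {p | prevDelivered c (n + 1) p}) (sysLaw rate σ) := by
    rw [iIndepSet_iff_meas_biInter hm]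
    intro F
    exact ((iIndepFun_markedGap hr hσ c).precomp Nat.succ_injective).meas_biInter
      (s := fun n => {p | prevDelivered c (n + 1) p})
      (fun n _ => ⟨{q | q.2}, measurableSet_mark, rfl⟩)
  have h := measure_limsup_eq_one hm hind (by
    simp_rw [sysLaw_prevDelivered hr hσ c]
    exact ENNReal.tsum_const_eq_top_of_ne_zero (serviceMoment_pos _).ne')
  have hmem := (prob_compl_eq_zero_iff (MeasurableSet.measurableSet_limsup hm)).2 h
  filter_upwards [show ∀ᵐ p ∂(sysLaw rate σ),
    p ∈ limsup (fun n => {p | prevDelivered c (n + 1) p}) atTop from hmem] with p hp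
  rw [mem_limsup_iff_frequently_mem] at hp
  exact Nat.frequently_atTop_iff_infinite.1 hp

/-- Split by the index `j` of the first delivered packet; on each path a single term survives. The
sum over `j` is geometric, and the formula holds also when it diverges. -/
lemma lintegral_exp_firstDelivery (hr : ∀ d, 0 < rate d) [IsProbabilityMeasure σ]
    (hσ : ∀ᵐ x ∂σ, 0 ≤ x) (c : ι) (s : ℝ) :
    ∫⁻ p, ENNReal.ofReal (Real.exp (s * firstDelivery c p)) ∂(sysLaw rate σ) =
      expMoment (rate c) s * (1 - lostMoment rate σ c s)⁻¹ *
        serviceMoment σ (s - ∑ d, rate d) := by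
  have hG : Measurable[gapsUpTo c 0] fun p : SysPath ι =>
      ENNReal.ofReal (Real.exp (s * (p c 0).1)) := by
    have h1 : Measurable fun q : (ℝ × ℝ) × Prop => ENNReal.ofReal (Real.exp (s * q.1.1)) := by
      fun_prop
    exact h1.comp (measurable_markedGap_gapsUpTo c le_rfl)
  have hpt : ∀ᵐ p ∂(sysLaw rate σ), ENNReal.ofReal (Real.exp (s * firstDelivery c p)) =
      ∑' j, ENNReal.ofReal (Real.exp (s * (p c 0).1)) * runWeight s c 0 j p := by
    filter_upwards [ae_infinite_prevDelivered hr hσ c] with p hp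
    rw [tsum_eq_single (deliveryIndex c 0 p)]
    · rw [runWeight_eq, if_pos ((deliveryIndex_zero_eq_iff hp).1 rfl),
        ← ENNReal.ofReal_mul (Real.exp_pos _).le, ← Real.exp_add, firstDelivery, zero_add,
        arrival_zero]
      ring_nf
    · intro j hj
      rw [runWeight_eq, if_neg fun h => hj ((deliveryIndex_zero_eq_iff hp).2 h).symm, mul_zero]
  have hm : ∀ j, AEMeasurable (fun p : SysPath ι =>
      ENNReal.ofReal (Real.exp (s * (p c 0).1)) * runWeight s c 0 j p) (sysLaw rate σ) := fun j =>
    ((hG.mono (gapsUpTo_le c 0) le_rfl).mul (measurable_runWeight s c 0 j)).aemeasurable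
  rw [lintegral_congr_ae hpt, lintegral_tsum hm]
  simp_rw [lintegral_mul_runWeight hr hσ c s hG, lintegral_exp_gap_fst hr hσ c s]
  rw [ENNReal.tsum_mul_right, ENNReal.tsum_mul_left, ENNReal.tsum_geometric]

/-- Exactly one packet is the `i`-th delivered one. Packet `m` is so iff `i` of its predecessors
were delivered and it is delivered itself. These are independent, and the latter has the same
probability for all `m`, so it factors out of a sum equal to `1`. -/
lemma tsum_lintegral_countWeight (hr : ∀ d, 0 < rate d) [IsProbabilityMeasure σ]
    (hσ : ∀ᵐ x ∂σ, 0 ≤ x) (c : ι) (i : ℕ) :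
    ∑' m, ∫⁻ p, countWeight c i m p ∂(sysLaw rate σ) = (serviceMoment σ (-∑ d, rate d))⁻¹ := by
  have := isProbabilityMeasure_sysLaw (σ := σ) hr
  refine ENNReal.eq_inv_of_mul_eq_one_left ?_
  -- At exponent `0` the service weight is just the indicator of a delivery.
  have h0 : ∀ m, (∫⁻ p, countWeight c i m p ∂(sysLaw rate σ)) * serviceMoment σ (-∑ d, rate d) =
      ∫⁻ p, countWeight c i m p * serviceWeight 0 (markedGap c (m + 1) p) ∂(sysLaw rate σ) := by
    intro m
    rw [lintegral_mul_markedGap hr hσ c (measurable_countWeight c i m) (measurable_serviceWeight 0),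
      lintegral_serviceWeight hr hσ c, zero_sub]
  rw [← ENNReal.tsum_mul_right]
  simp_rw [h0]
  have hm : ∀ m, AEMeasurable (fun p : SysPath ι =>
      countWeight c i m p * serviceWeight 0 (markedGap c (m + 1) p)) (sysLaw rate σ) := fun m =>
    (((measurable_countWeight c i m).mono (gapsUpTo_le c m) le_rfl).mul
      ((measurable_serviceWeight 0).comp (measurable_markedGap c _))).aemeasurable
  rw [← lintegral_tsum hm]
  rw [← measure_univ (μ := sysLaw rate σ), ← lintegral_one]
  refine lintegral_congr_ae ?_
  filter_upwards [ae_infinite_prevDelivered hr hσ c] with p hp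
  have hiff := fun m => deliveryIndex_eq_iff hp (i := i) (m := m)
  rw [tsum_eq_single (deliveryIndex c i p)]
  · have h := (hiff _).1 rfl
    have h1 := h.1
    rw [countWeight, Set.indicator_of_mem (by exact h1), serviceWeight,
      Set.indicator_of_mem (by exact h.2)]
    simp
  · intro m hm
    by_cases h1 : deliveryCount c m p = i
    · by_cases h2 : prevDelivered c (m + 1) p
      · exact absurd ((hiff m).2 ⟨h1, h2⟩).symm hm
      · rw [serviceWeight, Set.indicator_of_notMem (by exact h2), mul_zero]
    · rw [countWeight, Set.indicator_of_notMem (by exact h1), zero_mul]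

/-- Split by the index `m` of the `i`-th delivered packet and by the number `j` of lost packets up
to the next delivery. The sum over `m` contributes only the factor of `tsum_lintegral_countWeight`,
so the value does not depend on `i`. -/
lemma lintegral_exp_sysPeak (hr : ∀ d, 0 < rate d) [IsProbabilityMeasure σ]
    (hσ : ∀ᵐ x ∂σ, 0 ≤ x) (c : ι) (i : ℕ) (s : ℝ) :
    ∫⁻ p, ENNReal.ofReal (Real.exp (s * sysPeak c i p)) ∂(sysLaw rate σ) =
      (serviceMoment σ (-∑ d, rate d))⁻¹ *
        (expMoment (rate c) s * serviceMoment σ (s - ∑ d, rate d)) *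
        (1 - lostMoment rate σ c s)⁻¹ * serviceMoment σ (s - ∑ d, rate d) := by
  let G : ℕ → SysPath ι → ℝ≥0∞ := fun m p =>
    countWeight c i m p * keptWeight s (markedGap c (m + 1) p)
  have hG : ∀ m, Measurable[gapsUpTo c (m + 1)] (G m) := fun m => by
    have h1 := (measurable_countWeight c i m).mono (gapsUpTo_mono c m.le_succ) le_rfl
    have h2 : Measurable[gapsUpTo c (m + 1)] fun p : SysPath ι =>
        keptWeight s (markedGap c (m + 1) p) :=
      (measurable_keptWeight s).comp (measurable_markedGap_gapsUpTo c le_rfl)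
    exact h1.mul h2
  have hGm : ∀ m, Measurable (G m) := fun m => (hG m).mono (gapsUpTo_le c _) le_rfl
  have hpt : ∀ᵐ p ∂(sysLaw rate σ), ENNReal.ofReal (Real.exp (s * sysPeak c i p)) =
      ∑' m, ∑' j, G m p * runWeight s c (m + 1) j p := by
    filter_upwards [ae_infinite_prevDelivered hr hσ c] with p hp
    have hiff := fun m => deliveryIndex_eq_iff hp (i := i) (m := m)
    rw [tsum_eq_single (deliveryIndex c i p)]
    · set m := deliveryIndex c i p with hm
      have h := (hiff m).1 hm.symm
      have h1 := h.1
      have hlt : m + 1 ≤ deliveryIndex c (i + 1) p := Nat.nth_strictMono hp i.lt_succ_self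
      obtain ⟨j, hj⟩ := Nat.exists_eq_add_of_le hlt
      have hGv : G m p = ENNReal.ofReal (Real.exp (s * (p c (m + 1)).1)) := by
        simp only [G]
        rw [countWeight, Set.indicator_of_mem (by exact h1), keptWeight,
          Set.indicator_of_mem (by exact h.2)]
        simp [markedGap, gap]
      rw [tsum_eq_single j]
      · rw [hGv, runWeight_eq, if_pos ((deliveryIndex_succ_eq_iff hp).1 hj),
          ← ENNReal.ofReal_mul (Real.exp_pos _).le, ← Real.exp_add, sysPeak, hj, ← hm,
          arrival_succ _ m]
        ring_nf
      · intro j' hj'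
        rw [runWeight_eq, if_neg fun h => hj' ?_, mul_zero]
        have := (deliveryIndex_succ_eq_iff hp).2 h
        omega
    · intro m hm
      suffices h : G m p = 0 by simp [h]
      simp only [G]
      by_cases h1 : deliveryCount c m p = i
      · by_cases h2 : prevDelivered c (m + 1) p
        · exact absurd ((hiff m).2 ⟨h1, h2⟩).symm hm
        · rw [keptWeight, Set.indicator_of_notMem (by exact h2), mul_zero]
      · rw [countWeight, Set.indicator_of_notMem (by exact h1), zero_mul]
  have hterm : ∀ m j, Measurable fun p => G m p * runWeight s c (m + 1) j p := fun m j =>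
    (hGm m).mul (measurable_runWeight s c (m + 1) j)
  rw [lintegral_congr_ae hpt,
    lintegral_tsum fun m => (Measurable.tsum (hterm m)).aemeasurable]
  have h1 : ∀ m, ∫⁻ p, ∑' j, G m p * runWeight s c (m + 1) j p ∂(sysLaw rate σ) =
      (∫⁻ p, countWeight c i m p ∂(sysLaw rate σ)) *
        ((expMoment (rate c) s * serviceMoment σ (s - ∑ d, rate d)) *
        (1 - lostMoment rate σ c s)⁻¹ * serviceMoment σ (s - ∑ d, rate d)) := by
    intro m
    rw [lintegral_tsum fun j => (hterm m j).aemeasurable]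
    simp_rw [lintegral_mul_runWeight hr hσ c s (hG m)]
    rw [ENNReal.tsum_mul_right, ENNReal.tsum_mul_left, ENNReal.tsum_geometric]
    simp only [G]
    rw [lintegral_mul_markedGap hr hσ c (measurable_countWeight c i m) (measurable_keptWeight s),
      lintegral_keptWeight hr hσ c]
    ring
  simp_rw [h1]
  rw [ENNReal.tsum_mul_right, tsum_lintegral_countWeight hr hσ c i]
  ring

end System

/-! ### Finiteness and value of the moment generating functions -/

section Mgf

variable {Ω : Type*} [MeasurableSpace Ω] {P : Measure Ω} {W : Ω → ℝ}

lemma integrable_exp_mul_iff (hW : AEMeasurable W P) (s : ℝ) :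
    Integrable (fun ω => Real.exp (s * W ω)) P ↔
      ∫⁻ ω, ENNReal.ofReal (Real.exp (s * W ω)) ∂P ≠ ∞ :=
  (lintegral_ofReal_ne_top_iff_integrable (by fun_prop)
    (Eventually.of_forall fun _ => (Real.exp_pos _).le)).symm

lemma mgf_eq_toReal_lintegral (hW : AEMeasurable W P) (s : ℝ) :
    mgf W P s = (∫⁻ ω, ENNReal.ofReal (Real.exp (s * W ω)) ∂P).toReal :=
  integral_eq_lintegral_of_nonneg_ae (Eventually.of_forall fun _ => (Real.exp_pos _).le)
    (by fun_prop)

end Mgf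

section Moments

variable {σ : Measure ℝ} {M : ℝ → ℝ}

lemma integrable_exp_of_nonpos [IsProbabilityMeasure σ] (hσ : ∀ᵐ x ∂σ, 0 ≤ x) {u : ℝ}
    (hu : u ≤ 0) : Integrable (fun x => Real.exp (u * x)) σ := by
  rw [integrable_exp_mul_iff (W := fun x => x) aemeasurable_id]
  exact ne_top_of_le_ne_top ENNReal.one_ne_top (serviceMoment_le_one hσ hu)

lemma serviceMoment_eq_ofReal [IsProbabilityMeasure σ] (hσ : ∀ᵐ x ∂σ, 0 ≤ x)
    (hM : ∀ u, M u = ∫ x, Real.exp (u * x) ∂σ) {u : ℝ} (hu : u ≤ 0) :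
    serviceMoment σ u = ENNReal.ofReal (M u) := by
  rw [hM, ofReal_integral_eq_lintegral_ofReal (integrable_exp_of_nonpos hσ hu)
    (Eventually.of_forall fun _ => (Real.exp_pos _).le)]
  rfl

lemma serviceMoment_real_mem [IsProbabilityMeasure σ] (hσ : ∀ᵐ x ∂σ, 0 ≤ x)
    (hM : ∀ u, M u = ∫ x, Real.exp (u * x) ∂σ) {u : ℝ} (hu : u ≤ 0) : 0 < M u ∧ M u ≤ 1 := by
  have h := serviceMoment_eq_ofReal hσ hM hu
  have h1 := serviceMoment_pos (σ := σ) u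
  have h2 := serviceMoment_le_one hσ hu
  rw [h] at h1 h2
  exact ⟨ENNReal.ofReal_pos.1 h1, ENNReal.ofReal_le_one.1 h2⟩

variable {ι : Type*} [Fintype ι] {rate : ι → ℝ}

lemma rate_le_sum (hr : ∀ d, 0 < rate d) (c : ι) : rate c ≤ ∑ d, rate d :=
  Finset.single_le_sum (fun d _ => (hr d).le) (Finset.mem_univ c)

lemma lostMoment_eq (hr : ∀ d, 0 < rate d) [IsProbabilityMeasure σ]
    (hσ : ∀ᵐ x ∂σ, 0 ≤ x) (hM : ∀ u, M u = ∫ x, Real.exp (u * x) ∂σ) (c : ι) {s : ℝ}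
    (hs : s < rate c) :
    lostMoment rate σ c s =
      ENNReal.ofReal (rate c / (rate c - s) * (1 - M (s - ∑ d, rate d))) := by
  have hle : s - ∑ d, rate d ≤ 0 := by linarith [rate_le_sum hr c]
  have hpos : 0 < rate c / (rate c - s) := div_pos (hr c) (sub_pos.2 hs)
  obtain ⟨h0, h1⟩ := serviceMoment_real_mem hσ hM hle
  have h := lostMoment_add hr hσ c s
  rw [expMoment_of_lt (hr c) hs, serviceMoment_eq_ofReal hσ hM hle,
    ← ENNReal.ofReal_mul hpos.le] at h
  rw [ENNReal.eq_sub_of_add_eq ENNReal.ofReal_ne_top h, ← ENNReal.ofReal_sub _ (by positivity)]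
  congr 1
  ring

/-- The exponential moment of the time of the first delivery is finite exactly in the stated
range. -/
lemma firstDelivery_moment_ne_top_iff (hr : ∀ d, 0 < rate d) [IsProbabilityMeasure σ]
    (hσ : ∀ᵐ x ∂σ, 0 ≤ x) (hM : ∀ u, M u = ∫ x, Real.exp (u * x) ∂σ) (c : ι) (s : ℝ) :
    expMoment (rate c) s * (1 - lostMoment rate σ c s)⁻¹ * serviceMoment σ (s - ∑ d, rate d) ≠ ∞ ↔
      s < ∑ d, rate d ∧ s < rate c * M (s - ∑ d, rate d) := by
  -- A nonzero factor is needed so that an infinite moment is not cancelled by `0 * ∞ = 0`.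
  have hinv : (1 - lostMoment rate σ c s)⁻¹ ≠ 0 :=
    ENNReal.inv_ne_zero.2 (ne_top_of_le_ne_top ENNReal.one_ne_top tsub_le_self)
  rcases lt_or_ge s (rate c) with hs | hs
  · have hlt : s < ∑ d, rate d := hs.trans_le (rate_le_sum hr c)
    have hle : s - ∑ d, rate d ≤ 0 := by linarith
    have h0 : 0 < rate c - s := sub_pos.2 hs
    have hpos : 0 < rate c / (rate c - s) := div_pos (hr c) h0
    obtain ⟨hM0, hM1⟩ := serviceMoment_real_mem hσ hM hle
    have key : (1 - lostMoment rate σ c s)⁻¹ ≠ ∞ ↔ s < rate c * M (s - ∑ d, rate d) := by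
      rw [ENNReal.inv_ne_top, ne_eq, tsub_eq_zero_iff_le, not_le, lostMoment_eq hr hσ hM c hs,
        ENNReal.ofReal_lt_one, div_mul_eq_mul_div, div_lt_one h0]
      constructor <;> intro h <;> linarith
    rw [expMoment_of_lt (hr c) hs, serviceMoment_eq_ofReal hσ hM hle, and_iff_right hlt, ← key]
    constructor
    · intro h htop
      refine h ?_
      rw [htop, ENNReal.mul_top (by simpa using hpos), ENNReal.top_mul (by simpa using hM0)]
    · intro h
      exact ENNReal.mul_ne_top (ENNReal.mul_ne_top ENNReal.ofReal_ne_top h) ENNReal.ofReal_ne_top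
  -- For `s ≥ rate c` the moment of a single interarrival time is infinite, and the criterion fails
  -- because `M (s - λ) ≤ 1`.
  · rw [expMoment_of_le (hr c) hs, ENNReal.top_mul hinv, ENNReal.top_mul (serviceMoment_pos _).ne']
    simp only [ne_eq, not_true_eq_false, false_iff, not_and, not_lt]
    intro hlt
    have := (serviceMoment_real_mem hσ hM (u := s - ∑ d, rate d) (by linarith)).2
    nlinarith [hr c]

lemma firstDelivery_moment_eq (hr : ∀ d, 0 < rate d) [IsProbabilityMeasure σ]
    (hσ : ∀ᵐ x ∂σ, 0 ≤ x) (hM : ∀ u, M u = ∫ x, Real.exp (u * x) ∂σ) (c : ι) {s : ℝ}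
    (hs1 : s < ∑ d, rate d) (hs2 : s < rate c * M (s - ∑ d, rate d)) :
    expMoment (rate c) s * (1 - lostMoment rate σ c s)⁻¹ * serviceMoment σ (s - ∑ d, rate d) =
      ENNReal.ofReal (rate c * M (s - ∑ d, rate d) / (rate c * M (s - ∑ d, rate d) - s)) := by
  have hle : s - ∑ d, rate d ≤ 0 := by linarith
  obtain ⟨hM0, hM1⟩ := serviceMoment_real_mem hσ hM hle
  have hs : s < rate c := by nlinarith [hr c]
  have h0 : 0 < rate c - s := sub_pos.2 hs
  have h1 : 0 < rate c * M (s - ∑ d, rate d) - s := sub_pos.2 hs2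
  have hpos : 0 < rate c / (rate c - s) := div_pos (hr c) h0
  have h2 : 1 - rate c / (rate c - s) * (1 - M (s - ∑ d, rate d)) =
      (rate c * M (s - ∑ d, rate d) - s) / (rate c - s) := by
    field_simp
    ring
  rw [lostMoment_eq hr hσ hM c hs, ← ENNReal.ofReal_one,
    ← ENNReal.ofReal_sub _ (mul_nonneg hpos.le (by linarith)), h2,
    ← ENNReal.ofReal_inv_of_pos (div_pos h1 h0), expMoment_of_lt (hr c) hs,
    serviceMoment_eq_ofReal hσ hM hle, ← ENNReal.ofReal_mul hpos.le,
    ← ENNReal.ofReal_mul (by positivity)]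
  congr 1
  field_simp

/-- The peak moment is the first-delivery moment times the positive factor `M (s - λ) / L`. -/
lemma sysPeak_moment_ne_top_iff (hr : ∀ d, 0 < rate d) [IsProbabilityMeasure σ]
    (hσ : ∀ᵐ x ∂σ, 0 ≤ x) (hM : ∀ u, M u = ∫ x, Real.exp (u * x) ∂σ) (c : ι) (s : ℝ) :
    (serviceMoment σ (-∑ d, rate d))⁻¹ *
        (expMoment (rate c) s * serviceMoment σ (s - ∑ d, rate d)) *
        (1 - lostMoment rate σ c s)⁻¹ * serviceMoment σ (s - ∑ d, rate d) ≠ ∞ ↔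
      s < ∑ d, rate d ∧ s < rate c * M (s - ∑ d, rate d) := by
  have hneg : -∑ d, rate d ≤ 0 := by linarith [rate_le_sum hr c, hr c]
  have hL0 : serviceMoment σ (-∑ d, rate d) ≠ 0 := (serviceMoment_pos _).ne'
  have hL1 : serviceMoment σ (-∑ d, rate d) ≠ ∞ :=
    ne_top_of_le_ne_top ENNReal.one_ne_top (serviceMoment_le_one hσ hneg)
  have hre : (serviceMoment σ (-∑ d, rate d))⁻¹ *
        (expMoment (rate c) s * serviceMoment σ (s - ∑ d, rate d)) *
        (1 - lostMoment rate σ c s)⁻¹ * serviceMoment σ (s - ∑ d, rate d) =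
      (serviceMoment σ (-∑ d, rate d))⁻¹ * serviceMoment σ (s - ∑ d, rate d) *
        (expMoment (rate c) s * (1 - lostMoment rate σ c s)⁻¹ *
          serviceMoment σ (s - ∑ d, rate d)) := by ring
  rw [hre, ← firstDelivery_moment_ne_top_iff hr hσ hM c s]
  constructor
  · intro h htop
    rw [htop, ENNReal.mul_top] at h
    · exact h rfl
    · exact mul_ne_zero (ENNReal.inv_ne_zero.2 hL1) (serviceMoment_pos _).ne'
  · intro h
    -- For `s > λ` the service moment could be infinite; finiteness of the first-delivery moment
    -- excludes this case.
    have hs := ((firstDelivery_moment_ne_top_iff hr hσ hM c s).1 h).1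
    refine ENNReal.mul_ne_top (ENNReal.mul_ne_top (ENNReal.inv_ne_top.2 hL0) ?_) h
    exact ne_top_of_le_ne_top ENNReal.one_ne_top (serviceMoment_le_one hσ (by linarith))

lemma sysPeak_moment_eq (hr : ∀ d, 0 < rate d) [IsProbabilityMeasure σ]
    (hσ : ∀ᵐ x ∂σ, 0 ≤ x) (hM : ∀ u, M u = ∫ x, Real.exp (u * x) ∂σ) (c : ι) {s : ℝ}
    (hs1 : s < ∑ d, rate d) (hs2 : s < rate c * M (s - ∑ d, rate d)) :
    (serviceMoment σ (-∑ d, rate d))⁻¹ *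
        (expMoment (rate c) s * serviceMoment σ (s - ∑ d, rate d)) *
        (1 - lostMoment rate σ c s)⁻¹ * serviceMoment σ (s - ∑ d, rate d) =
      ENNReal.ofReal (rate c * M (s - ∑ d, rate d) ^ 2 /
        (M (-∑ d, rate d) * (rate c * M (s - ∑ d, rate d) - s))) := by
  have hneg : -∑ d, rate d ≤ 0 := by linarith [rate_le_sum hr c, hr c]
  have hle : s - ∑ d, rate d ≤ 0 := by linarith
  obtain ⟨hM0, hM1⟩ := serviceMoment_real_mem hσ hM hle
  obtain ⟨hL0, hL1⟩ := serviceMoment_real_mem hσ hM hneg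
  have h1 : 0 < rate c * M (s - ∑ d, rate d) - s := sub_pos.2 hs2
  have hre : (serviceMoment σ (-∑ d, rate d))⁻¹ *
        (expMoment (rate c) s * serviceMoment σ (s - ∑ d, rate d)) *
        (1 - lostMoment rate σ c s)⁻¹ * serviceMoment σ (s - ∑ d, rate d) =
      (serviceMoment σ (-∑ d, rate d))⁻¹ * serviceMoment σ (s - ∑ d, rate d) *
        (expMoment (rate c) s * (1 - lostMoment rate σ c s)⁻¹ *
          serviceMoment σ (s - ∑ d, rate d)) := by ring
  rw [hre, firstDelivery_moment_eq hr hσ hM c hs1 hs2, serviceMoment_eq_ofReal hσ hM hle,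
    serviceMoment_eq_ofReal hσ hM hneg, ← ENNReal.ofReal_inv_of_pos hL0,
    ← ENNReal.ofReal_mul (by positivity), ← ENNReal.ofReal_mul (by positivity)]
  congr 1
  field_simp

end Moments

/-! ### The age along a path -/

section System

variable {ι : Type*}

lemma receivedWithin_subset (c : ι) {u u' t t' : ℝ} (hu : u' ≤ u) (ht : t ≤ t') :
    receivedWithin c u t ⊆ receivedWithin c u' t' := fun _ ⟨n, h1, h2, h3⟩ =>
  ⟨n, hu.trans_lt h1, h2.trans ht, h3⟩

/-- The generation time of the `i`-th delivered packet of source `c`. -/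
noncomputable def generationAt (c : ι) (i : ℕ) (p : SysPath ι) : ℝ :=
  arrival (p c) (deliveryIndex c i p)

/-- The time of the `i`-th delivery of source `c`. -/
noncomputable def deliveryAt (c : ι) (i : ℕ) (p : SysPath ι) : ℝ :=
  arrival (p c) (deliveryIndex c i p) + (p c (deliveryIndex c i p)).2

open Classical in
/-- The age of source `c` at time `t` along the path `p`; `u₀` is the initial time stamp. -/
noncomputable def sysAge (u₀ : ℝ) (c : ι) (t : ℝ) (p : SysPath ι) : ℝ :=
  t - if ∃ i, deliveryAt c i p ≤ t then generationAt c (sSup {i | deliveryAt c i p ≤ t}) p else u₀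

/-- Paths along which all sources are regular and source `c` delivers infinitely often. -/
structure IsRecurrent (c : ι) (p : SysPath ι) : Prop where
  regular : ∀ d, IsRegular (p d)
  infinite : {n | prevDelivered c (n + 1) p}.Infinite

namespace IsRecurrent

variable {c : ι} {p : SysPath ι}

lemma strictMono_deliveryIndex (h : IsRecurrent c p) :
    StrictMono fun i => deliveryIndex c i p := Nat.nth_strictMono h.infinite

lemma isDelivered_deliveryIndex (h : IsRecurrent c p) (i : ℕ) :
    IsDelivered p c (deliveryIndex c i p) :=
  (prevDelivered_succ_iff h.regular c _).1 (Nat.nth_mem_of_infinite h.infinite i)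

lemma exists_deliveryIndex_eq (h : IsRecurrent c p) {n : ℕ} (hn : IsDelivered p c n) :
    ∃ i, deliveryIndex c i p = n := by
  have hn' := (prevDelivered_succ_iff h.regular c n).2 hn
  have := Nat.range_nth_of_infinite h.infinite
  exact this.ge hn'

lemma generationAt_le_deliveryAt (h : IsRecurrent c p) (i : ℕ) :
    generationAt c i p ≤ deliveryAt c i p :=
  le_add_of_nonneg_right ((h.regular c).nonneg _)

lemma strictMono_generationAt (h : IsRecurrent c p) : StrictMono fun i => generationAt c i p :=
  (h.regular c).strictMono.comp h.strictMono_deliveryIndex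

/-- Otherwise the later packet would preempt the earlier one. In particular, deliveries follow the
order of generation. -/
lemma deliveryAt_le_generationAt_succ (h : IsRecurrent c p) (i : ℕ) :
    deliveryAt c i p ≤ generationAt c (i + 1) p :=
  h.isDelivered_deliveryIndex i c _ (h.strictMono_generationAt i.lt_succ_self)

lemma monotone_deliveryAt (h : IsRecurrent c p) : Monotone fun i => deliveryAt c i p :=
  monotone_nat_of_le_succ fun i =>
    (h.deliveryAt_le_generationAt_succ i).trans (h.generationAt_le_deliveryAt _)

lemma bddAbove_deliveryAt_le (h : IsRecurrent c p) (t : ℝ) :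
    BddAbove {i | deliveryAt c i p ≤ t} := by
  obtain ⟨n, hn⟩ := (h.regular c).unbounded t
  refine ⟨n, fun i hi => not_lt.1 fun hlt => ?_⟩
  have h1 : arrival (p c) n ≤ generationAt c i p :=
    (h.regular c).strictMono.monotone (hlt.le.trans h.strictMono_deliveryIndex.le_apply)
  have h2 : deliveryAt c i p ≤ t := hi
  linarith [h.generationAt_le_deliveryAt i]

lemma exists_deliveryAt_le_iff (h : IsRecurrent c p) {t : ℝ} :
    (∃ i, deliveryAt c i p ≤ t) ↔ firstDelivery c p ≤ t :=
  ⟨fun ⟨_, hi⟩ => (h.monotone_deliveryAt (Nat.zero_le _)).trans hi, fun h0 => ⟨0, h0⟩⟩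

lemma mem_receivedWithin_iff (h : IsRecurrent c p) {u t : ℝ} :
    p ∈ receivedWithin c u t ↔ ∃ i, u < generationAt c i p ∧ deliveryAt c i p ≤ t := by
  constructor
  · rintro ⟨n, h1, h2, h3⟩
    obtain ⟨i, rfl⟩ := h.exists_deliveryIndex_eq h3
    exact ⟨i, h1, h2⟩
  · rintro ⟨i, h1, h2⟩
    exact ⟨_, h1, h2, h.isDelivered_deliveryIndex i⟩

lemma generationAt_pos (h : IsRecurrent c p) (i : ℕ) : 0 < generationAt c i p :=
  (h.regular c).arrival_pos _

lemma firstDelivery_pos (h : IsRecurrent c p) : 0 < firstDelivery c p :=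
  (h.generationAt_pos 0).trans_le (h.generationAt_le_deliveryAt 0)

lemma firstDelivery_le_iff (h : IsRecurrent c p) {t : ℝ} :
    firstDelivery c p ≤ t ↔ p ∈ receivedWithin c 0 t := by
  rw [h.mem_receivedWithin_iff, ← h.exists_deliveryAt_le_iff]
  exact exists_congr fun i => (and_iff_right (h.generationAt_pos i)).symm

lemma firstDelivery_le_of_mem (h : IsRecurrent c p) {u t : ℝ} (hp : p ∈ receivedWithin c u t) :
    firstDelivery c p ≤ t := by
  obtain ⟨i, _, hi⟩ := h.mem_receivedWithin_iff.1 hp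
  exact h.exists_deliveryAt_le_iff.1 ⟨i, hi⟩

lemma sysAge_of_lt (h : IsRecurrent c p) {u₀ t : ℝ} (ht : t < firstDelivery c p) :
    sysAge u₀ c t p = t - u₀ := by
  rw [sysAge, if_neg]
  rw [h.exists_deliveryAt_le_iff]
  exact not_le.2 ht

/-- Deliveries follow the order of generation, so the most recently delivered packet is also the
youngest delivered one. The age is below `x` as soon as any delivered packet was generated after `t
- x`. -/
lemma sysAge_lt_iff (h : IsRecurrent c p) {u₀ t x : ℝ} (ht : firstDelivery c p ≤ t) :
    sysAge u₀ c t p < x ↔ p ∈ receivedWithin c (t - x) t := by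
  have hex := h.exists_deliveryAt_le_iff.2 ht
  rw [sysAge, if_pos hex, h.mem_receivedWithin_iff]
  have hmem : deliveryAt c (sSup {i | deliveryAt c i p ≤ t}) p ≤ t :=
    Nat.sSup_mem hex (h.bddAbove_deliveryAt_le t)
  constructor
  · intro hx
    exact ⟨_, by linarith, hmem⟩
  · rintro ⟨i, h1, h2⟩
    have : generationAt c i p ≤ generationAt c (sSup {i | deliveryAt c i p ≤ t}) p :=
      h.strictMono_generationAt.monotone (le_csSup (h.bddAbove_deliveryAt_le t) h2)
    linarith

lemma sysAge_nonneg (h : IsRecurrent c p) {u₀ t : ℝ} (ht : firstDelivery c p ≤ t) :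
    0 ≤ sysAge u₀ c t p := by
  by_contra! hlt
  rw [h.sysAge_lt_iff ht, sub_zero] at hlt
  obtain ⟨i, h1, h2⟩ := h.mem_receivedWithin_iff.1 hlt
  linarith [h.generationAt_le_deliveryAt i]

end IsRecurrent

lemma measurableSet_time_receivedWithin (c : ι) (p : SysPath ι) (a b : ℝ) :
    MeasurableSet {t : ℝ | p ∈ receivedWithin c (t + a) (t + b)} := by
  have : {t : ℝ | p ∈ receivedWithin c (t + a) (t + b)} = ⋃ n,
      ({t : ℝ | t + a < arrival (p c) n} ∩ ({t : ℝ | arrival (p c) n + (p c n).2 ≤ t + b} ∩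
        {_t : ℝ | IsDelivered p c n})) := by
    ext t
    simp [receivedWithin]
  rw [this]
  exact .iUnion fun n => (measurableSet_lt (by fun_prop) measurable_const).inter
    ((measurableSet_le measurable_const (by fun_prop)).inter (.const _))

lemma IsRecurrent.measurable_sysAge {c : ι} {p : SysPath ι} (h : IsRecurrent c p) (u₀ : ℝ) :
    Measurable fun t => sysAge u₀ c t p := by
  refine measurable_of_Iio fun x => ?_
  have : (fun t => sysAge u₀ c t p) ⁻¹' Set.Iio x =
      (Set.Ici (firstDelivery c p) ∩ {t | p ∈ receivedWithin c (t + -x) (t + 0)}) ∪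
      (Set.Iio (firstDelivery c p) ∩ {t | t - u₀ < x}) := by
    ext t
    rcases le_or_gt (firstDelivery c p) t with ht | ht
    · have := h.sysAge_lt_iff (u₀ := u₀) (x := x) ht
      simp only [Set.mem_preimage, Set.mem_Iio, Set.mem_union, Set.mem_inter_iff, Set.mem_Ici, ht,
        true_and, not_lt.2 ht, false_and, or_false, Set.mem_ofPred_eq, add_zero, this,
        sub_eq_add_neg]
    · simp only [Set.mem_preimage, Set.mem_Iio, Set.mem_union, Set.mem_inter_iff, Set.mem_Ici, ht,
        true_and, not_le.2 ht, false_and, false_or, Set.mem_ofPred_eq, h.sysAge_of_lt ht]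
  rw [this]
  exact (measurableSet_Ici.inter (measurableSet_time_receivedWithin c p _ _)).union
    (measurableSet_Iio.inter (measurableSet_lt (by fun_prop) measurable_const))

variable [Fintype ι] {rate : ι → ℝ} {σ : Measure ℝ}

lemma ae_isRecurrent (hr : ∀ d, 0 < rate d) [IsProbabilityMeasure σ]
    (hσ : ∀ᵐ x ∂σ, 0 ≤ x) (c : ι) : ∀ᵐ p ∂(sysLaw rate σ), IsRecurrent c p := by
  filter_upwards [ae_forall_isRegular hr hσ, ae_infinite_prevDelivered hr hσ c] with p h1 h2
  exact ⟨h1, h2⟩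

/-- The description of the index by counts requires infinitely many deliveries, hence measurability
only up to a null set. -/
lemma aemeasurable_deliveryIndex (hr : ∀ d, 0 < rate d) [IsProbabilityMeasure σ]
    (hσ : ∀ᵐ x ∂σ, 0 ≤ x) (c : ι) (i : ℕ) :
    AEMeasurable (deliveryIndex c i) (sysLaw rate σ) := by
  refine NullMeasurable.aemeasurable fun A _ => ?_
  rw [← Set.biUnion_preimage_singleton]
  refine .biUnion A.to_countable fun m _ => ?_
  have hm : MeasurableSet {p : SysPath ι | deliveryCount c m p = i ∧ prevDelivered c (m + 1) p} :=
    (((measurable_deliveryCount c m).mono (gapsUpTo_le c m) le_rfl)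
      (measurableSet_singleton i)).inter (measurableSet_prevDelivered c (m + 1))
  refine hm.nullMeasurableSet.congr ?_
  filter_upwards [ae_infinite_prevDelivered hr hσ c] with p hp
  exact propext (deliveryIndex_eq_iff hp).symm

lemma aemeasurable_comp_deliveryIndex (hr : ∀ d, 0 < rate d) [IsProbabilityMeasure σ]
    (hσ : ∀ᵐ x ∂σ, 0 ≤ x) (c : ι) (i : ℕ) {f : ℕ → SysPath ι → ℝ} (hf : ∀ n, Measurable (f n)) :
    AEMeasurable (fun p => f (deliveryIndex c i p) p) (sysLaw rate σ) := by
  have h1 : Measurable fun q : ℕ × SysPath ι => f q.1 q.2 :=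
    measurable_from_prod_countable_right fun n => hf n
  exact h1.comp_aemeasurable ((aemeasurable_deliveryIndex hr hσ c i).prodMk aemeasurable_id)

lemma aemeasurable_deliveryAt (hr : ∀ d, 0 < rate d) [IsProbabilityMeasure σ]
    (hσ : ∀ᵐ x ∂σ, 0 ≤ x) (c : ι) (i : ℕ) :
    AEMeasurable (deliveryAt c i) (sysLaw rate σ) :=
  aemeasurable_comp_deliveryIndex hr hσ c i (f := fun n p => arrival (p c) n + (p c n).2)
    (fun n => by fun_prop)

lemma aemeasurable_firstDelivery (hr : ∀ d, 0 < rate d) [IsProbabilityMeasure σ]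
    (hσ : ∀ᵐ x ∂σ, 0 ≤ x) (c : ι) : AEMeasurable (firstDelivery c) (sysLaw rate σ) :=
  aemeasurable_deliveryAt hr hσ c 0

lemma aemeasurable_sysPeak (hr : ∀ d, 0 < rate d) [IsProbabilityMeasure σ]
    (hσ : ∀ᵐ x ∂σ, 0 ≤ x) (c : ι) (i : ℕ) : AEMeasurable (sysPeak c i) (sysLaw rate σ) :=
  (aemeasurable_deliveryAt hr hσ c (i + 1)).sub
    (aemeasurable_comp_deliveryIndex hr hσ c i (f := fun n p => arrival (p c) n)
      (fun n => by fun_prop))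

end System

/-! ### Weak convergence on the line and a law of large numbers for `M`-dependent events -/

/-- Half-open intervals with rational endpoints form a π-system containing small neighbourhoods of
every point. Countably many conditions allow the almost sure statements to be combined later. -/
lemma tendsto_probabilityMeasure_of_Iio {α : Type*} {l : Filter α} [l.IsCountablyGenerated]
    {μ : α → ProbabilityMeasure ℝ} {ν : ProbabilityMeasure ℝ}
    (h : ∀ x : ℚ, Tendsto (fun a => (μ a : Measure ℝ).real (Set.Iio (x : ℝ))) l
      (𝓝 ((ν : Measure ℝ).real (Set.Iio (x : ℝ))))) : Tendsto μ l (𝓝 ν) := by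
  refine (isPiSystem_Ico (fun x : ℚ => (x : ℝ)) fun x : ℚ => (x : ℝ))
    |>.tendsto_probabilityMeasure_of_tendsto_of_mem ?_ ?_ ?_
  · rintro _ ⟨a, b, _, rfl⟩
    exact measurableSet_Ico
  · intro u hu x hx
    obtain ⟨a, b, ⟨hax, hxb⟩, hab⟩ := mem_nhds_iff_exists_Ioo_subset.1 (hu.mem_nhds hx)
    obtain ⟨q, haq, hqx⟩ := exists_rat_btwn hax
    obtain ⟨r, hxr, hrb⟩ := exists_rat_btwn hxb
    exact ⟨_, ⟨q, r, hqx.trans hxr, rfl⟩, Ico_mem_nhds hqx hxr,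
      fun y hy => hab ⟨haq.trans_le hy.1, hy.2.trans hrb⟩⟩
  · rintro _ ⟨a, b, hab, rfl⟩
    have key : ∀ κ : ProbabilityMeasure ℝ, κ (Set.Ico (a : ℝ) b) =
        ((κ : Measure ℝ).real (Set.Iio (b : ℝ)) -
          (κ : Measure ℝ).real (Set.Iio (a : ℝ))).toNNReal := by
      intro κ
      have : (κ : Measure ℝ).real (Set.Ico (a : ℝ) b) =
          (κ : Measure ℝ).real (Set.Iio (b : ℝ)) - (κ : Measure ℝ).real (Set.Iio (a : ℝ)) := by
        rw [← measureReal_sdiff (Set.Iio_subset_Iio hab.le) measurableSet_Iio]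
        congr 1
        ext y
        simp
      rw [← this, ProbabilityMeasure.measureReal_eq_coe_coeFn, Real.toNNReal_coe]
    simp_rw [key]
    exact (continuous_real_toNNReal.tendsto _).comp ((h b).sub (h a))

lemma sum_range_mul (M : ℕ) (f : ℕ → ℝ) (n : ℕ) :
    ∑ k ∈ Finset.range (M * n), f k =
      ∑ r ∈ Finset.range M, ∑ i ∈ Finset.range n, f (M * i + r) := by
  induction n with
  | zero => simp
  | succ n ih =>
    rw [Nat.mul_succ, Finset.sum_range_add, ih, ← Finset.sum_add_distrib]
    simp_rw [Finset.sum_range_succ]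

/-- A strong law of large numbers for events which are independent at distance at least `M`. -/
lemma ae_tendsto_count_div {Ω : Type*} [MeasurableSpace Ω] {P : Measure Ω} [IsProbabilityMeasure P]
    {e : ℕ → Set Ω} (he : ∀ k, MeasurableSet (e k)) (hq : ∀ k, P (e k) = P (e 0)) {M : ℕ}
    (hind : ∀ j k, j + M ≤ k → P (e j ∩ e k) = P (e j) * P (e k)) :
    ∀ᵐ ω ∂P, Tendsto (fun n : ℕ => (∑ k ∈ Finset.range (M * n), (e k).indicator 1 ω : ℝ) / n) atTop
      (𝓝 (M * P.real (e 0))) := by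
  have hmeas : ∀ k, Measurable ((e k).indicator (1 : Ω → ℝ)) := fun k =>
    measurable_one.indicator (he k)
  have hlaw : ∀ r : ℕ, ∀ᵐ ω ∂P, Tendsto
      (fun n : ℕ => (∑ i ∈ Finset.range n, (e (M * i + r)).indicator 1 ω : ℝ) / n) atTop
      (𝓝 (P.real (e 0))) := by
    intro r
    -- Indices in one residue class modulo `M` are at distance at least `M`. Pairwise independence
    -- suffices for the strong law used here.
    have hpair : ∀ i j : ℕ, i < j →
        ((e (M * i + r)).indicator (1 : Ω → ℝ)) ⟂ᵢ[P] ((e (M * j + r)).indicator (1 : Ω → ℝ)) := by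
      intro i j hij
      have h1 : IndepSet (e (M * i + r)) (e (M * j + r)) P := by
        rw [indepSet_iff_measure_inter_eq_mul (he _) (he _) P]
        refine hind _ _ ?_
        have := Nat.mul_le_mul_left M (Nat.succ_le_of_lt hij)
        rw [Nat.mul_succ] at this
        omega
      have h2 : ∀ k, MeasurableSpace.comap ((e k).indicator (1 : Ω → ℝ)) inferInstance ≤
          MeasurableSpace.generateFrom {e k} := fun k =>
        Measurable.comap_le (Measurable.indicator (m := _) (@measurable_const _ _ _ (_) 1)
          (MeasurableSpace.measurableSet_generateFrom (Set.mem_singleton _)))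
      rw [IndepFun_iff_Indep]
      exact indep_of_indep_of_le_right (indep_of_indep_of_le_left h1 (h2 _)) (h2 _)
    have h := strong_law_ae_real (μ := P) (fun i => (e (M * i + r)).indicator (1 : Ω → ℝ))
      ((integrable_const (1 : ℝ)).indicator (he _))
      (fun i j hij => (lt_or_gt_of_ne hij).elim (hpair i j) fun h => (hpair j i h).symm)
      (fun i => ?_)
    · have h2 : P[(e (M * 0 + r)).indicator (1 : Ω → ℝ)] = P.real (e 0) := by
        rw [integral_indicator_one (he _), measureReal_def, hq, ← measureReal_def]
      rwa [h2] at h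
    · refine ⟨(hmeas _).aemeasurable, (hmeas _).aemeasurable, ?_⟩
      -- An indicator has a Bernoulli law, which is determined by the probability of the event.
      have hmap : ∀ k, P.map ((e k).indicator (1 : Ω → ℝ)) =
          P (e 0) • Measure.dirac 1 + (1 - P (e 0)) • Measure.dirac 0 := by
        intro k
        ext s hs
        have hpre : (e k).indicator (1 : Ω → ℝ) ⁻¹' s =
            ((e k) ∩ {_ω | (1 : ℝ) ∈ s}) ∪ ((e k)ᶜ ∩ {_ω | (0 : ℝ) ∈ s}) := by
          ext ω
          by_cases hω : ω ∈ e k <;> simp [hω]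
        rw [Measure.map_apply (hmeas k) hs, hpre, measure_union
          ((disjoint_compl_right).mono Set.inter_subset_left Set.inter_subset_left)
          ((he k).compl.inter (.const _))]
        by_cases h1 : (1 : ℝ) ∈ s <;> by_cases h0 : (0 : ℝ) ∈ s <;>
          simp [h1, h0, hs, prob_compl_eq_one_sub (he k), hq k]
      rw [hmap, hmap]
  filter_upwards [ae_all_iff.2 hlaw] with ω hω
  have h := tendsto_finsetSum (Finset.range M) fun r _ => hω r
  simp only [Finset.sum_const, Finset.card_range, nsmul_eq_mul] at h
  refine h.congr fun n => ?_
  rw [sum_range_mul, Finset.sum_div]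

/-! ### Occupation times and block sums -/

section Blocks

variable {T : Set ℝ} {h : ℝ}

lemma volume_inter_Ioc_mul_succ (hT : MeasurableSet T) (hh : 0 ≤ h) (N : ℕ) :
    volume.real (T ∩ Set.Ioc 0 ((N + 1 : ℕ) * h)) = volume.real (T ∩ Set.Ioc 0 (N * h)) +
      volume.real (T ∩ Set.Ioc (N * h) ((N + 1 : ℕ) * h)) := by
  have h1 : (0 : ℝ) ≤ N * h := by positivity
  have h2 : (N : ℝ) * h ≤ (N + 1 : ℕ) * h := by gcongr; simp
  have hfin : ∀ a b : ℝ, volume (T ∩ Set.Ioc a b) ≠ ∞ := fun a b =>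
    measure_ne_top_of_subset Set.inter_subset_right (by simp)
  rw [← Set.Ioc_union_Ioc_eq_Ioc h1 h2, Set.inter_union_distrib_left,
    measureReal_union _ (hT.inter measurableSet_Ioc) (hfin _ _) (hfin _ _)]
  exact (Set.Ioc_disjoint_Ioc_of_le le_rfl).mono Set.inter_subset_right Set.inter_subset_right

lemma volume_Ioc_mul_succ (hh : 0 ≤ h) (N : ℕ) :
    volume.real (Set.Ioc (N * h) ((N + 1 : ℕ) * h)) = h := by
  rw [Real.volume_real_Ioc_of_le (by gcongr; simp)]
  push_cast
  ring

/-- Every block that meets `T` is counted with its whole length. -/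
lemma volume_inter_Ioc_le_sum (hT : MeasurableSet T) (hh : 0 ≤ h) {b : ℕ → ℝ} (hb0 : ∀ k, 0 ≤ b k)
    (hb : ∀ k : ℕ, (T ∩ Set.Ioc (k * h) ((k + 1 : ℕ) * h)).Nonempty → 1 ≤ b k) (N : ℕ) :
    volume.real (T ∩ Set.Ioc 0 (N * h)) ≤ h * ∑ k ∈ Finset.range N, b k := by
  induction N with
  | zero => simp
  | succ N ih =>
    rw [volume_inter_Ioc_mul_succ hT hh, Finset.sum_range_succ, mul_add]
    refine add_le_add ih ?_
    rcases (T ∩ Set.Ioc (N * h) ((N + 1 : ℕ) * h)).eq_empty_or_nonempty with he | hne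
    · rw [he, measureReal_empty]
      exact mul_nonneg hh (hb0 N)
    · calc volume.real (T ∩ Set.Ioc (N * h) ((N + 1 : ℕ) * h))
          ≤ volume.real (Set.Ioc (N * h) ((N + 1 : ℕ) * h)) :=
            measureReal_mono Set.inter_subset_right (by simp)
        _ = h * 1 := by rw [volume_Ioc_mul_succ hh, mul_one]
        _ ≤ h * b N := mul_le_mul_of_nonneg_left (hb N hne) hh

lemma sum_le_volume_inter_Ioc (hT : MeasurableSet T) (hh : 0 ≤ h) {a : ℕ → ℝ} (ha1 : ∀ k, a k ≤ 1)
    (ha : ∀ k : ℕ, 0 < a k → Set.Ioc (k * h) ((k + 1 : ℕ) * h) ⊆ T) (N : ℕ) :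
    h * ∑ k ∈ Finset.range N, a k ≤ volume.real (T ∩ Set.Ioc 0 (N * h)) := by
  induction N with
  | zero => simp
  | succ N ih =>
    rw [volume_inter_Ioc_mul_succ hT hh, Finset.sum_range_succ, mul_add]
    refine add_le_add ih ?_
    rcases le_or_gt (a N) 0 with h0 | h0
    · exact (mul_nonpos_of_nonneg_of_nonpos hh h0).trans measureReal_nonneg
    · rw [Set.inter_eq_right.2 (ha N h0), volume_Ioc_mul_succ hh]
      exact mul_le_of_le_one_right hh (ha1 N)

lemma volume_inter_Ioc_mono {τ τ' : ℝ} (hτ : τ ≤ τ') :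
    volume.real (T ∩ Set.Ioc 0 τ) ≤ volume.real (T ∩ Set.Ioc 0 τ') :=
  measureReal_mono (Set.inter_subset_inter_right _ (Set.Ioc_subset_Ioc_right hτ))
    (measure_ne_top_of_subset Set.inter_subset_right (by simp))

lemma tendsto_floor_div_div {a : ℝ} (ha : 0 < a) :
    Tendsto (fun τ : ℝ => (⌊τ / a⌋₊ : ℝ) / τ) atTop (𝓝 a⁻¹) := by
  have h1 : Tendsto (fun τ : ℝ => (⌊τ / a⌋₊ : ℝ) / (τ / a)) atTop (𝓝 1) :=
    tendsto_nat_floor_div_atTop.comp (tendsto_id.atTop_div_const ha)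
  refine (h1.mul_const a⁻¹).congr' ?_ |>.trans (by simp)
  filter_upwards [eventually_gt_atTop 0] with τ hτ
  field_simp

/-- With `n = ⌊τ / (M h)⌋`, the interval `(0, τ]` is covered by `n + 1` groups of `M` blocks. The
limit is `h * (M q) / (M h) = q`. -/
lemma eventually_volume_div_lt (hT : MeasurableSet T) (hh : 0 < h) {b : ℕ → ℝ} (hb0 : ∀ k, 0 ≤ b k)
    (hb : ∀ k : ℕ, (T ∩ Set.Ioc (k * h) ((k + 1 : ℕ) * h)).Nonempty → 1 ≤ b k) {M : ℕ} (hM : 0 < M)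
    {q y : ℝ} (hlim : Tendsto (fun n : ℕ => (∑ k ∈ Finset.range (M * n), b k) / n) atTop
      (𝓝 (M * q))) (hy : q < y) :
    ∀ᶠ τ in atTop, volume.real (T ∩ Set.Ioc 0 τ) / τ < y := by
  have hM' : (0 : ℝ) < M := by exact_mod_cast hM
  have ha : 0 < M * h := by positivity
  have hfl : Tendsto (fun τ : ℝ => ⌊τ / (M * h)⌋₊ + 1) atTop atTop :=
    (tendsto_add_atTop_nat 1).comp
      (tendsto_nat_floor_atTop.comp (tendsto_id.atTop_div_const ha))
  have h1 := (hlim.comp hfl)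
  have h2 : Tendsto (fun τ : ℝ => ((⌊τ / (M * h)⌋₊ : ℝ) / τ + 1 / τ)) atTop
      (𝓝 ((M * h)⁻¹ + 0)) :=
    (tendsto_floor_div_div ha).add (tendsto_const_nhds.div_atTop tendsto_id)
  have h3 := ((h1.mul h2).const_mul h)
  have h4 : h * (M * q * ((M * h)⁻¹ + 0)) = q := by
    field_simp
    simp
  rw [h4] at h3
  filter_upwards [h3.eventually_lt_const hy, eventually_gt_atTop 0] with τ hτ hτ0
  refine lt_of_le_of_lt ?_ hτ
  set n := ⌊τ / (M * h)⌋₊ with hn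
  have h5 : τ ≤ (M * (n + 1) : ℕ) * h := by
    have := (Nat.lt_floor_add_one (τ / (M * h))).le
    rw [div_le_iff₀ ha] at this
    push_cast
    linarith
  have h6 := (volume_inter_Ioc_mono (T := T) h5).trans
    (volume_inter_Ioc_le_sum hT hh.le hb0 hb (M * (n + 1)))
  have h7 : (0 : ℝ) < (n + 1 : ℕ) := by positivity
  simp only [Function.comp]
  rw [div_le_iff₀ hτ0]
  refine h6.trans (le_of_eq ?_)
  rw [← hn]
  push_cast at h7 ⊢
  field_simp

lemma eventually_lt_volume_div (hT : MeasurableSet T) (hh : 0 < h) {a : ℕ → ℝ} (ha1 : ∀ k, a k ≤ 1)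
    (ha : ∀ k : ℕ, 0 < a k → Set.Ioc (k * h) ((k + 1 : ℕ) * h) ⊆ T) {M : ℕ} (hM : 0 < M)
    {q y : ℝ} (hlim : Tendsto (fun n : ℕ => (∑ k ∈ Finset.range (M * n), a k) / n) atTop
      (𝓝 (M * q))) (hy : y < q) :
    ∀ᶠ τ in atTop, y < volume.real (T ∩ Set.Ioc 0 τ) / τ := by
  have hM' : (0 : ℝ) < M := by exact_mod_cast hM
  have hMh : 0 < M * h := by positivity
  have hfl : Tendsto (fun τ : ℝ => ⌊τ / (M * h)⌋₊) atTop atTop :=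
    tendsto_nat_floor_atTop.comp (tendsto_id.atTop_div_const hMh)
  have h3 := (((hlim.comp hfl).mul (tendsto_floor_div_div hMh)).const_mul h)
  have h4 : h * (M * q * (M * h)⁻¹) = q := by field_simp
  rw [h4] at h3
  filter_upwards [h3.eventually_const_lt hy, eventually_gt_atTop 0, hfl.eventually_gt_atTop 0]
    with τ hτ hτ0 hn0
  refine hτ.trans_le ?_
  set n := ⌊τ / (M * h)⌋₊ with hn
  have h5 : (M * n : ℕ) * h ≤ τ := by
    have := Nat.floor_le (a := τ / (M * h)) (by positivity)
    rw [le_div_iff₀ hMh] at this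
    push_cast
    linarith
  have h6 := (sum_le_volume_inter_Ioc hT hh.le ha1 ha (M * n)).trans
    (volume_inter_Ioc_mono (T := T) h5)
  have h7 : (0 : ℝ) < n := by exact_mod_cast hn0
  simp only [Function.comp]
  rw [le_div_iff₀ hτ0]
  refine (le_of_eq ?_).trans h6
  rw [← hn]
  field_simp

end Blocks

/-! ### The stationary law of the age -/

section System

variable {ι : Type*}

/-- For `t` beyond `firstDelivery c p + x`, an age below `x` means a delivery in the window starting
at `t - x > 0`. The translation by `x` preserves length, and the initial stretch is negligible after
division by `τ`. -/
lemma IsRecurrent.volume_sysAge_lt_le {c : ι} {p : SysPath ι} (h : IsRecurrent c p) (u₀ : ℝ)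
    {x : ℝ} (hx : 0 ≤ x) (τ : ℝ) :
    volume.real ({t | sysAge u₀ c t p < x} ∩ Set.Ioc 0 τ) ≤
      (firstDelivery c p + x) +
        volume.real ({s | p ∈ receivedWithin c s (s + x)} ∩ Set.Ioc 0 τ) := by
  set K := {s | p ∈ receivedWithin c s (s + x)} ∩ Set.Ioc 0 τ
  have hK : volume K ≠ ∞ := measure_ne_top_of_subset Set.inter_subset_right (by simp)
  have hshift : volume.real ((fun t => t + -x) ⁻¹' K) = volume.real K := by
    rw [measureReal_def, measure_preimage_add_right, measureReal_def]
  have hD := h.firstDelivery_pos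
  have hsub : {t | sysAge u₀ c t p < x} ∩ Set.Ioc 0 τ ⊆
      Set.Ioc 0 (firstDelivery c p + x) ∪ (fun t => t + -x) ⁻¹' K := by
    rintro t ⟨h1, h2⟩
    rcases le_or_gt t (firstDelivery c p + x) with ht | ht
    · exact Or.inl ⟨h2.1, ht⟩
    · refine Or.inr ⟨?_, by linarith, by linarith [h2.2]⟩
      have := (h.sysAge_lt_iff (u₀ := u₀) (x := x) (t := t) (by linarith)).1 h1
      simpa [sub_eq_add_neg] using this
  calc _ ≤ volume.real (Set.Ioc 0 (firstDelivery c p + x) ∪ (fun t => t + -x) ⁻¹' K) :=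
        measureReal_mono hsub (measure_union_ne_top (by simp)
          (by rwa [measure_preimage_add_right]))
    _ ≤ _ := measureReal_union_le _ _
    _ = _ := by rw [hshift, Real.volume_real_Ioc_of_le (by linarith), sub_zero]

lemma IsRecurrent.le_volume_sysAge_lt {c : ι} {p : SysPath ι} (h : IsRecurrent c p) (u₀ : ℝ)
    {x : ℝ} (hx : 0 ≤ x) (τ : ℝ) :
    volume.real ({s | p ∈ receivedWithin c s (s + x)} ∩ Set.Ioc 0 τ) ≤
      volume.real ({t | sysAge u₀ c t p < x} ∩ Set.Ioc 0 τ) + x := by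
  set K := {t | sysAge u₀ c t p < x} ∩ Set.Ioc 0 τ
  have hK : volume K ≠ ∞ := measure_ne_top_of_subset Set.inter_subset_right (by simp)
  have hsub : {s | p ∈ receivedWithin c s (s + x)} ∩ Set.Ioc 0 τ ⊆
      (fun t => t + x) ⁻¹' (K ∪ Set.Ioc τ (τ + x)) := by
    rintro s ⟨h1, h2⟩
    have h3 := (h.sysAge_lt_iff (u₀ := u₀) (x := x) (h.firstDelivery_le_of_mem h1)).2
      (by simpa using h1)
    rcases le_or_gt (s + x) τ with ht | ht
    · exact Or.inl ⟨h3, by linarith [h2.1], ht⟩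
    · exact Or.inr ⟨ht, by linarith [h2.2]⟩
  have hfin : volume (K ∪ Set.Ioc τ (τ + x)) ≠ ∞ := measure_union_ne_top hK (by simp)
  calc _ ≤ volume.real ((fun t => t + x) ⁻¹' (K ∪ Set.Ioc τ (τ + x))) :=
        measureReal_mono hsub (by rwa [measure_preimage_add_right])
    _ = volume.real (K ∪ Set.Ioc τ (τ + x)) := by
        rw [measureReal_def, measure_preimage_add_right, measureReal_def]
    _ ≤ _ := measureReal_union_le _ _
    _ = _ := by rw [Real.volume_real_Ioc_of_le (by linarith), add_sub_cancel_left]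

variable [Fintype ι] {rate : ι → ℝ} {σ : Measure ℝ}

/-- The stationary law of the age of source `c`: the law of the time of the first delivery. -/
noncomputable def ageLaw (rate : ι → ℝ) (σ : Measure ℝ) (c : ι) : Measure ℝ :=
  (sysLaw rate σ).map (firstDelivery c)

lemma isProbabilityMeasure_ageLaw (hr : ∀ d, 0 < rate d) [IsProbabilityMeasure σ]
    (hσ : ∀ᵐ x ∂σ, 0 ≤ x) (c : ι) : IsProbabilityMeasure (ageLaw rate σ c) := by
  have := isProbabilityMeasure_sysLaw (σ := σ) hr
  exact Measure.isProbabilityMeasure_map (aemeasurable_firstDelivery hr hσ c)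

lemma ageLaw_Iic (hr : ∀ d, 0 < rate d) [IsProbabilityMeasure σ]
    (hσ : ∀ᵐ x ∂σ, 0 ≤ x) (c : ι) (x : ℝ) :
    ageLaw rate σ c (Set.Iic x) = sysLaw rate σ (receivedWithin c 0 x) := by
  rw [ageLaw, Measure.map_apply_of_aemeasurable (aemeasurable_firstDelivery hr hσ c)
    measurableSet_Iic]
  refine measure_congr ?_
  filter_upwards [ae_isRecurrent hr hσ c] with p hp
  exact propext hp.firstDelivery_le_iff

lemma sysLaw_receivedWithin_eq_ageLaw (hr : ∀ d, 0 < rate d) [IsProbabilityMeasure σ]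
    (hσ : ∀ᵐ x ∂σ, 0 ≤ x) (c : ι) {u : ℝ} (hu : 0 ≤ u) (t : ℝ) :
    sysLaw rate σ (receivedWithin c u t) = ageLaw rate σ c (Set.Iic (t - u)) := by
  rw [sysLaw_receivedWithin hr hσ c hu, ageLaw_Iic hr hσ]

/-- Arrivals come strictly after time `0`, so a delivery by `x` already uses a packet generated
after some `u > 0`. By homogeneity that has the probability of a first delivery by `x - u < x`. -/
lemma ageLaw_Iio (hr : ∀ d, 0 < rate d) [IsProbabilityMeasure σ]
    (hσ : ∀ᵐ x ∂σ, 0 ≤ x) (c : ι) (x : ℝ) :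
    ageLaw rate σ c (Set.Iio x) = ageLaw rate σ c (Set.Iic x) := by
  refine le_antisymm (measure_mono Set.Iio_subset_Iic_self) ?_
  obtain ⟨u, hu, hpos, hlim⟩ := exists_seq_strictAnti_tendsto (0 : ℝ)
  have hU : receivedWithin c 0 x = ⋃ n, receivedWithin c (u n) x := by
    refine Set.Subset.antisymm ?_ (Set.iUnion_subset fun n =>
      receivedWithin_subset c (hpos n).le le_rfl)
    rintro p ⟨k, h1, h2, h3⟩
    obtain ⟨n, hn⟩ := (hlim.eventually_lt_const h1).exists
    exact Set.mem_iUnion.2 ⟨n, k, hn, h2, h3⟩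
  have hmono : Monotone fun n => receivedWithin c (u n) x := fun i j hij =>
    receivedWithin_subset c (hu.antitone hij) le_rfl
  rw [ageLaw_Iic hr hσ, hU, hmono.measure_iUnion]
  refine iSup_le fun n => ?_
  rw [sysLaw_receivedWithin_eq_ageLaw hr hσ c (hpos n).le]
  exact measure_mono (Set.Iic_subset_Iio.2 (sub_lt_self x (hpos n)))

lemma continuous_ageLaw_Iic (hr : ∀ d, 0 < rate d) [IsProbabilityMeasure σ]
    (hσ : ∀ᵐ x ∂σ, 0 ≤ x) (c : ι) : Continuous fun x => (ageLaw rate σ c).real (Set.Iic x) := by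
  have := isProbabilityMeasure_ageLaw hr hσ c
  simp_rw [← cdf_eq_real]
  refine continuous_iff_continuousAt.2 fun x => ?_
  rw [(cdf (ageLaw rate σ c)).mono.continuousAt_iff_leftLim_eq_rightLim,
    StieltjesFunction.rightLim_eq]
  refine le_antisymm ((cdf (ageLaw rate σ c)).mono.leftLim_le le_rfl) ?_
  have h : ageLaw rate σ c {x} = 0 := by
    rw [← Set.Iic_sdiff_Iio_same, measure_sdiff Set.Iio_subset_Iic_self
      measurableSet_Iio.nullMeasurableSet (measure_ne_top _ _), ageLaw_Iio hr hσ, tsub_self]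
  rw [← measure_cdf (ageLaw rate σ c), StieltjesFunction.measure_singleton,
    ENNReal.ofReal_eq_zero] at h
  linarith

/-! ### Convergence of the law of the age -/

/-- For `t ≥ x` the event differs from `receivedWithin c (t - x) t` only where nothing has been
delivered by `t`, and the probability of that tends to `0`. -/
lemma tendsto_measureReal_sysAge_lt (hr : ∀ d, 0 < rate d) [IsProbabilityMeasure σ]
    (hσ : ∀ᵐ x ∂σ, 0 ≤ x) {Ω : Type*} [MeasurableSpace Ω] {P : Measure Ω} [IsProbabilityMeasure P]
    {Y : Ω → SysPath ι} (hY : AEMeasurable Y P) (hlaw : P.map Y = sysLaw rate σ) (U₀ : Ω → ℝ)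
    (c : ι) (x : ℝ) :
    Tendsto (fun t => P.real {ω | sysAge (U₀ ω) c t (Y ω) < x}) atTop
      (𝓝 ((ageLaw rate σ c).real (Set.Iio x))) := by
  have := isProbabilityMeasure_ageLaw hr hσ c
  have hmap : ∀ u t, P (Y ⁻¹' receivedWithin c u t) = sysLaw rate σ (receivedWithin c u t) :=
    fun u t => by
      rw [← hlaw, Measure.map_apply_of_aemeasurable hY (measurableSet_receivedWithin c u t)]
  have hrec : ∀ᵐ ω ∂P, IsRecurrent c (Y ω) := by
    refine ae_of_ae_map hY ?_
    rw [hlaw]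
    exact ae_isRecurrent hr hσ c
  have hx : (ageLaw rate σ c).real (Set.Iio x) = (ageLaw rate σ c).real (Set.Iic x) := by
    rw [measureReal_def, ageLaw_Iio hr hσ, measureReal_def]
  have hlim : Tendsto (fun t => (ageLaw rate σ c).real (Set.Iic x) +
      (1 - (ageLaw rate σ c).real (Set.Iic t))) atTop (𝓝 ((ageLaw rate σ c).real (Set.Iio x))) := by
    have h := (tendsto_cdf_atTop (ageLaw rate σ c)).const_sub 1 |>.const_add
      ((ageLaw rate σ c).real (Set.Iic x))
    simp_rw [cdf_eq_real] at h
    rw [hx]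
    simpa using h
  have hB : ∀ t, x ≤ t →
      P.real (Y ⁻¹' receivedWithin c (t - x) t) = (ageLaw rate σ c).real (Set.Iic x) := by
    intro t ht
    rw [measureReal_def, hmap, sysLaw_receivedWithin_eq_ageLaw hr hσ c (sub_nonneg.2 ht),
      sub_sub_cancel, measureReal_def]
  refine tendsto_of_tendsto_of_tendsto_of_le_of_le' tendsto_const_nhds hlim ?_ ?_
  · filter_upwards [eventually_ge_atTop x] with t ht
    rw [hx, ← hB t ht]
    refine ENNReal.toReal_mono (measure_ne_top _ _) (measure_mono_ae ?_)
    filter_upwards [hrec] with ω hω h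
    exact (hω.sysAge_lt_iff (hω.firstDelivery_le_of_mem h)).2 h
  · filter_upwards [eventually_ge_atTop x] with t ht
    have hD : 1 - (ageLaw rate σ c).real (Set.Iic t) = P.real (Y ⁻¹' receivedWithin c 0 t)ᶜ := by
      rw [measureReal_def, ageLaw_Iic hr hσ, ← hmap, ← measureReal_def]
      exact (probReal_compl_eq_one_sub₀
        (hY.nullMeasurableSet_preimage (measurableSet_receivedWithin c 0 t))).symm
    rw [← hB t ht, hD]
    refine le_trans ?_ (measureReal_union_le _ _)
    refine ENNReal.toReal_mono (measure_ne_top _ _) (measure_mono_ae ?_)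
    filter_upwards [hrec] with ω hω h
    by_cases h0 : Y ω ∈ receivedWithin c 0 t
    · exact Or.inl ((hω.sysAge_lt_iff (hω.firstDelivery_le_iff.2 h0)).1 h)
    · exact Or.inr h0

/-! ### Time averages of the age -/

/-- Cut the starting times into blocks of length `h`. Shrinking or enlarging the window by `h` gives
one event per block, `A k` or `B k`, that brackets the whole block. The law of large numbers yields
the bounds `F (x - h)` and `F (x + h)`, and continuity of `F` closes the gap. -/
lemma ae_tendsto_volume_receivedWithin (hr : ∀ d, 0 < rate d) [IsProbabilityMeasure σ]
    (hσ : ∀ᵐ x ∂σ, 0 ≤ x) (c : ι) {x : ℝ} (hx : 0 < x) :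
    ∀ᵐ p ∂(sysLaw rate σ), Tendsto
      (fun τ => volume.real ({s | p ∈ receivedWithin c s (s + x)} ∩ Set.Ioc 0 τ) / τ) atTop
      (𝓝 ((ageLaw rate σ c).real (Set.Iic x))) := by
  have := isProbabilityMeasure_sysLaw (σ := σ) hr
  set F : ℝ → ℝ := fun y => (ageLaw rate σ c).real (Set.Iic y) with hF
  have hmeasT : ∀ p : SysPath ι, MeasurableSet {s | p ∈ receivedWithin c s (s + x)} := fun p => by
    simpa using measurableSet_time_receivedWithin c p 0 x
  have hbound : ∀ m : ℕ, ∀ᵐ p ∂(sysLaw rate σ),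
      (∀ y, F (x + x / (m + 1)) < y → ∀ᶠ τ in atTop,
        volume.real ({s | p ∈ receivedWithin c s (s + x)} ∩ Set.Ioc 0 τ) / τ < y) ∧
      (∀ y, y < F (x - x / (m + 1)) → ∀ᶠ τ in atTop,
        y < volume.real ({s | p ∈ receivedWithin c s (s + x)} ∩ Set.Ioc 0 τ) / τ) := by
    intro m
    -- The window length is a whole number of blocks, `x = (m + 1) * h`.
    set h := x / (m + 1) with hh
    have hh0 : 0 < h := by positivity
    have hxh : x = (m + 1) * h := by rw [hh]; field_simp
    have hkh : ∀ k : ℕ, (0 : ℝ) ≤ k * h := fun k => by positivity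
    set A : ℕ → Set (SysPath ι) := fun k => receivedWithin c ((k + 1 : ℕ) * h) (k * h + x) with hA
    set B : ℕ → Set (SysPath ι) := fun k => receivedWithin c (k * h) ((k + 1 : ℕ) * h + x) with hB
    have hPA : ∀ k, sysLaw rate σ (A k) = ageLaw rate σ c (Set.Iic (x - h)) := fun k => by
      rw [hA, sysLaw_receivedWithin_eq_ageLaw hr hσ c (hkh _)]
      congr 2
      push_cast
      ring
    have hPB : ∀ k, sysLaw rate σ (B k) = ageLaw rate σ c (Set.Iic (x + h)) := fun k => by
      rw [hB, sysLaw_receivedWithin_eq_ageLaw hr hσ c (hkh _)]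
      congr 2
      push_cast
      ring
    -- The enlarged window of block `j` ends at `(j + 1) h + (m + 1) h = (j + m + 2) h`, so windows
    -- `m + 2` blocks apart do not overlap.
    have hjk : ∀ j k : ℕ, j + (m + 2) ≤ k → ((j + 1 : ℕ) : ℝ) * h + x ≤ k * h := by
      intro j k hle
      have : ((j + (m + 2) : ℕ) : ℝ) ≤ k := by exact_mod_cast hle
      calc ((j + 1 : ℕ) : ℝ) * h + x = ((j + (m + 2) : ℕ) : ℝ) * h := by
            rw [hxh]; push_cast; ring
        _ ≤ k * h := by gcongr
    have hstep : ∀ k : ℕ, (k : ℝ) * h ≤ (k + 1 : ℕ) * h := fun k => by gcongr; simp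
    have hAlim := ae_tendsto_count_div (P := sysLaw rate σ) (e := A)
      (fun k => measurableSet_receivedWithin c _ _) (fun k => by rw [hPA, hPA])
      (M := m + 2) (fun j k hle => sysLaw_receivedWithin_inter hr hσ c
        ((add_le_add_left (hstep j) x).trans ((hjk j k hle).trans (hstep k))) (hkh _))
    have hBlim := ae_tendsto_count_div (P := sysLaw rate σ) (e := B)
      (fun k => measurableSet_receivedWithin c _ _) (fun k => by rw [hPB, hPB])
      (M := m + 2) (fun j k hle => sysLaw_receivedWithin_inter hr hσ c
        (hjk j k hle) (hkh _))
    rw [measureReal_def, hPA, ← measureReal_def] at hAlim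
    rw [measureReal_def, hPB, ← measureReal_def] at hBlim
    filter_upwards [hAlim, hBlim] with p hpA hpB
    refine ⟨fun y hy => ?_, fun y hy => ?_⟩
    · refine eventually_volume_div_lt (hmeasT p) hh0 (b := fun k => (B k).indicator 1 p)
        (fun k => Set.indicator_nonneg (fun _ _ => zero_le_one) _) (fun k ⟨s, hs1, hs2⟩ => ?_)
        (Nat.succ_pos (m + 1)) hpB hy
      have : p ∈ B k := receivedWithin_subset c hs2.1.le (by linarith [hs2.2]) hs1
      simp [this]
    · refine eventually_lt_volume_div (hmeasT p) hh0 (a := fun k => (A k).indicator 1 p)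
        (fun k => Set.indicator_le_self' (fun _ _ => zero_le_one) _ ) (fun k hk s hs => ?_)
        (Nat.succ_pos (m + 1)) hpA hy
      have : p ∈ A k := Set.mem_of_indicator_ne_zero hk.ne'
      exact receivedWithin_subset c hs.2 (by linarith [hs.1]) this
  have hdiv : Tendsto (fun m : ℕ => x / ((m : ℝ) + 1)) atTop (𝓝 0) :=
    tendsto_const_nhds.div_atTop (tendsto_natCast_atTop_atTop.atTop_add tendsto_const_nhds)
  have hcont := continuous_ageLaw_Iic hr hσ c
  have hup : Tendsto (fun m : ℕ => F (x + x / (m + 1))) atTop (𝓝 (F x)) := by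
    have := (hcont.tendsto (x + 0)).comp (hdiv.const_add x)
    rwa [add_zero] at this
  have hdown : Tendsto (fun m : ℕ => F (x - x / (m + 1))) atTop (𝓝 (F x)) := by
    have := (hcont.tendsto (x - 0)).comp (hdiv.const_sub x)
    rwa [sub_zero] at this
  filter_upwards [ae_all_iff.2 hbound] with p hp
  refine tendsto_order.2 ⟨fun y hy => ?_, fun y hy => ?_⟩
  · obtain ⟨m, hm⟩ := (hdown.eventually_const_lt hy).exists
    exact (hp m).2 y hm
  · obtain ⟨m, hm⟩ := (hup.eventually_lt_const hy).exists
    exact (hp m).1 y hm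

lemma ageLaw_Iic_of_nonpos (hr : ∀ d, 0 < rate d) [IsProbabilityMeasure σ]
    (hσ : ∀ᵐ x ∂σ, 0 ≤ x) (c : ι) {x : ℝ} (hx : x ≤ 0) : ageLaw rate σ c (Set.Iic x) = 0 := by
  rw [ageLaw_Iic hr hσ, measure_eq_zero_iff_ae_notMem]
  filter_upwards [ae_isRecurrent hr hσ c] with p hp h
  exact (hp.firstDelivery_pos.trans_le ((hp.firstDelivery_le_of_mem h).trans hx)).false

lemma ae_tendsto_volume_sysAge_lt (hr : ∀ d, 0 < rate d) [IsProbabilityMeasure σ]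
    (hσ : ∀ᵐ x ∂σ, 0 ≤ x) (c : ι) (x : ℝ) :
    ∀ᵐ p ∂(sysLaw rate σ), ∀ u₀, Tendsto
      (fun τ => volume.real ({t | sysAge u₀ c t p < x} ∩ Set.Ioc 0 τ) / τ) atTop
      (𝓝 ((ageLaw rate σ c).real (Set.Iic x))) := by
  rcases le_or_gt x 0 with hx | hx
  · filter_upwards [ae_isRecurrent hr hσ c] with p hp u₀
    rw [measureReal_def, ageLaw_Iic_of_nonpos hr hσ c hx, ENNReal.toReal_zero]
    refine tendsto_of_tendsto_of_tendsto_of_le_of_le' tendsto_const_nhds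
      (tendsto_const_nhds.div_atTop tendsto_id : Tendsto (fun τ => firstDelivery c p / τ) atTop _)
      ?_ ?_
    · filter_upwards [eventually_ge_atTop 0] with τ hτ
      positivity
    · filter_upwards [eventually_ge_atTop 0] with τ hτ
      refine div_le_div_of_nonneg_right ?_ hτ
      have hsub : {t | sysAge u₀ c t p < x} ∩ Set.Ioc 0 τ ⊆ Set.Ioc 0 (firstDelivery c p) := by
        rintro t ⟨h1, h2⟩
        refine ⟨h2.1, not_lt.1 fun hlt => ?_⟩
        have h1' : sysAge u₀ c t p < x := h1
        linarith [hp.sysAge_nonneg (u₀ := u₀) hlt.le]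
      refine (measureReal_mono hsub (by simp)).trans (le_of_eq ?_)
      rw [Real.volume_real_Ioc_of_le hp.firstDelivery_pos.le, sub_zero]
  · filter_upwards [ae_isRecurrent hr hσ c, ae_tendsto_volume_receivedWithin hr hσ c hx]
      with p hp hlim u₀
    have hlow := hlim.sub (tendsto_const_nhds.div_atTop tendsto_id :
      Tendsto (fun τ : ℝ => x / τ) atTop (𝓝 0))
    have hupp := (tendsto_const_nhds.div_atTop tendsto_id :
      Tendsto (fun τ : ℝ => (firstDelivery c p + x) / τ) atTop (𝓝 0)).add hlim
    rw [sub_zero] at hlow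
    rw [zero_add] at hupp
    refine tendsto_of_tendsto_of_tendsto_of_le_of_le' hlow hupp ?_ ?_
    · filter_upwards [eventually_gt_atTop 0] with τ hτ
      rw [← sub_div]
      have := hp.le_volume_sysAge_lt u₀ hx.le τ
      gcongr
      linarith
    · filter_upwards [eventually_gt_atTop 0] with τ hτ
      rw [← add_div]
      have := hp.volume_sysAge_lt_le u₀ hx.le τ
      gcongr

lemma isProbabilityMeasure_cond_Ioc {τ : ℝ} (hτ : 0 < τ) :
    IsProbabilityMeasure (volume[|Set.Ioc 0 τ]) :=
  cond_isProbabilityMeasure_of_finite (by simp [hτ]) (by simp)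

lemma integral_cond_Ioc {τ : ℝ} (hτ : 0 < τ) (g : ℝ → ℝ) :
    ∫ t, g t ∂(volume[|Set.Ioc 0 τ]) = τ⁻¹ * ∫ t in (0 : ℝ)..τ, g t := by
  rw [ProbabilityTheory.cond, integral_smul_measure, intervalIntegral.integral_of_le hτ.le]
  simp [hτ.le]

/-- A time average over `(0, τ]` is an integral against the law of the age at a uniform random time;
those laws converge weakly. The null set is chosen before `u₀`, which is later replaced by the
random initial stamp. -/
lemma ae_tendsto_timeAverage_sysAge (hr : ∀ d, 0 < rate d) [IsProbabilityMeasure σ]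
    (hσ : ∀ᵐ x ∂σ, 0 ≤ x) (c : ι) :
    ∀ᵐ p ∂(sysLaw rate σ), ∀ (u₀ : ℝ) (f : ℝ →ᵇ ℝ), Tendsto
      (fun τ : ℝ => τ⁻¹ * ∫ t in (0 : ℝ)..τ, f (sysAge u₀ c t p)) atTop
      (𝓝 (∫ x, f x ∂(ageLaw rate σ c))) := by
  have := isProbabilityMeasure_ageLaw hr hσ c
  filter_upwards [ae_isRecurrent hr hσ c,
    ae_all_iff.2 fun q : ℚ => ae_tendsto_volume_sysAge_lt hr hσ c (q : ℝ)] with p hp hlim u₀ f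
  have hmeas := hp.measurable_sysAge u₀
  -- The maximum with `1` makes the uniform law a probability measure for every `τ`, without
  -- affecting the limit.
  have hpos : ∀ τ : ℝ, 0 < max τ 1 := fun τ => lt_max_of_lt_right one_pos
  have hprob := fun τ : ℝ => isProbabilityMeasure_cond_Ioc (hpos τ)
  let κ : ℝ → ProbabilityMeasure ℝ := fun τ =>
    ⟨(volume[|Set.Ioc 0 (max τ 1)]).map fun t => sysAge u₀ c t p,
      Measure.isProbabilityMeasure_map hmeas.aemeasurable⟩
  have hκ : Tendsto κ atTop (𝓝 ⟨ageLaw rate σ c, this⟩) := by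
    refine tendsto_probabilityMeasure_of_Iio fun q => ?_
    have h := hlim q u₀
    simp only [ProbabilityMeasure.coe_mk, κ]
    rw [measureReal_def (ageLaw rate σ c), ageLaw_Iio hr hσ, ← measureReal_def]
    refine h.congr' ?_
    filter_upwards [eventually_ge_atTop 1] with τ hτ
    rw [map_measureReal_apply hmeas measurableSet_Iio, max_eq_left hτ, measureReal_def,
      measureReal_def, cond_apply measurableSet_Ioc, ENNReal.toReal_mul, ENNReal.toReal_inv,
      Real.volume_Ioc, sub_zero, ENNReal.toReal_ofReal (by linarith), div_eq_inv_mul, Set.inter_comm]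
    rfl
  have h := ProbabilityMeasure.tendsto_iff_forall_integral_tendsto.1 hκ f
  refine h.congr' ?_
  filter_upwards [eventually_ge_atTop 1] with τ hτ
  simp only [ProbabilityMeasure.coe_mk, κ]
  rw [integral_map hmeas.aemeasurable f.continuous.aestronglyMeasurable, max_eq_left hτ,
    integral_cond_Ioc (by linarith)]

end System

/-! ### The path of an M/G/1/1 system -/

lemma infinitePi_map_pathLaw {r : ℝ} (hr : 0 < r) (σ : Measure ℝ) [IsProbabilityMeasure σ] :
    (Measure.infinitePi fun q : ℕ × Fin 2 => ![expMeasure r, σ] q.2).map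
      (fun x k => (x (k, 0), x (k, 1))) = pathLaw r σ := by
  have := isProbabilityMeasure_expMeasure hr
  have hprob : ∀ j : Fin 2, IsProbabilityMeasure (![expMeasure r, σ] j) :=
    Fin.forall_fin_two.2 ⟨this, ‹_›⟩
  have h1 := Measure.infinitePi_map_curry fun (_ : ℕ) (j : Fin 2) => ![expMeasure r, σ] j
  have h2 := Measure.infinitePi_map_pi
    (fun _ : ℕ => Measure.infinitePi fun j : Fin 2 => ![expMeasure r, σ] j)
    (f := fun _ => MeasurableEquiv.finTwoArrow) (fun _ => MeasurableEquiv.measurable _)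
  have hm : Measurable fun (x : ℕ → Fin 2 → ℝ) k => MeasurableEquiv.finTwoArrow (x k) :=
    measurable_pi_lambda _ fun k => (MeasurableEquiv.measurable _).comp (measurable_pi_apply k)
  rw [← h1, Measure.map_map hm (MeasurableEquiv.measurable _)] at h2
  refine h2.trans ?_
  rw [pathLaw]
  congr 1
  funext k
  rw [Measure.infinitePi_eq_pi]
  exact (measurePreserving_finTwoArrow_vec (expMeasure r) σ).map_eq

section Input

variable {ι Ω : Type*} (X S : ι → ℕ → Ω → ℝ)

/-- The path of the system. -/
def inputPath (ω : Ω) : SysPath ι := fun d k => (X d k ω, S d k ω)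

lemma not_preempted_iff (c : ι) (n : ℕ) (ω : Ω) :
    ¬ Preempted X S c n ω ↔ IsDelivered (inputPath X S ω) c n := by
  simp only [Preempted, IsDelivered, not_exists, not_and, not_lt]
  rfl

variable {X S}

lemma deliveredIndex_eq {ω : Ω} (h : ∀ d, IsRegular (inputPath X S ω d)) (c : ι) (i : ℕ) :
    deliveredIndex X S c i ω = deliveryIndex c i (inputPath X S ω) := by
  unfold deliveredIndex deliveryIndex
  congr 1
  funext n
  exact propext ((not_preempted_iff X S c n ω).trans (prevDelivered_succ_iff h c n).symm)

lemma deliveryTime_eq {ω : Ω} (h : ∀ d, IsRegular (inputPath X S ω d)) (c : ι) (i : ℕ) :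
    deliveryTime X S c i ω = deliveryAt c i (inputPath X S ω) := by
  rw [deliveryTime, deliveredGen, deliveredIndex_eq h]
  rfl

lemma deliveredGen_eq {ω : Ω} (h : ∀ d, IsRegular (inputPath X S ω d)) (c : ι) (i : ℕ) :
    deliveredGen X S c i ω = generationAt c i (inputPath X S ω) := by
  rw [deliveredGen, deliveredIndex_eq h]
  rfl

lemma peakAoI_eq {ω : Ω} (h : ∀ d, IsRegular (inputPath X S ω d)) (c : ι) (i : ℕ) :
    peakAoI X S c i ω = sysPeak c i (inputPath X S ω) := by
  rw [peakAoI, interdeparture, systemTime, deliveryTime_eq h, deliveryTime_eq h,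
    deliveredGen_eq h]
  simp only [deliveryAt, generationAt, sysPeak]
  ring

lemma age_eq {ω : Ω} (h : ∀ d, IsRegular (inputPath X S ω d)) (U₀ : Ω → ℝ) (c : ι) (t : ℝ) :
    age X S U₀ c t ω = sysAge (U₀ ω) c t (inputPath X S ω) := by
  have hiff : (∃ i, deliveryTime X S c i ω ≤ t) ↔ ∃ i, deliveryAt c i (inputPath X S ω) ≤ t := by
    simp only [deliveryTime_eq h]
  rw [age, timeStamp, sysAge]
  by_cases hex : ∃ i, deliveryTime X S c i ω ≤ t
  · rw [if_pos hex, if_pos (hiff.1 hex)]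
    simp only [deliveryTime_eq h, deliveredGen_eq h]
  · rw [if_neg hex, if_neg (hex ∘ hiff.2)]

variable [MeasurableSpace Ω] {P : Measure Ω} {rate : ι → ℝ} {σ : Measure ℝ}

lemma IsMG11Input.aemeasurable_inputPath [Countable ι] (hXS : IsMG11Input P rate σ X S) :
    AEMeasurable (inputPath X S) P :=
  aemeasurable_pi_lambda _ fun d => aemeasurable_pi_lambda _ fun k =>
    (hXS.interarrival_law d k).aemeasurable.prodMk (hXS.service_law d k).aemeasurable

lemma IsMG11Input.map_inputPath [Fintype ι] [IsProbabilityMeasure P] [IsProbabilityMeasure σ]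
    (hr : ∀ d, 0 < rate d) (hXS : IsMG11Input P rate σ X S) :
    P.map (inputPath X S) = sysLaw rate σ := by
  have hexp := fun d => isProbabilityMeasure_expMeasure (hr d)
  have := fun d => isProbabilityMeasure_pathLaw (σ := σ) (hr d)
  have hprob : ∀ (d : ι) (j : Fin 2), IsProbabilityMeasure (![expMeasure (rate d), σ] j) :=
    fun d => Fin.forall_fin_two.2 ⟨hexp d, ‹_›⟩
  -- Reindexing by source, packet and kind (interarrival or service) lets two curryings turn the
  -- product of all laws into a product over sources of products over packets.
  let g : ι × (ℕ × Fin 2) → (ι × ℕ) ⊕ (ι × ℕ) := fun q =>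
    if q.2.2 = 0 then .inl (q.1, q.2.1) else .inr (q.1, q.2.1)
  have hg : Function.Injective g := by
    rintro ⟨d, k, j⟩ ⟨d', k', j'⟩ h
    fin_cases j <;> fin_cases j' <;> simp_all [g]
  let Z : ι × (ℕ × Fin 2) → Ω → ℝ := fun q =>
    Sum.elim (fun p : ι × ℕ => X p.1 p.2) (fun p : ι × ℕ => S p.1 p.2) (g q)
  have hZ : iIndepFun Z P := hXS.indep.precomp hg
  have hlaw : ∀ q, HasLaw (Z q) (![expMeasure (rate q.1), σ] q.2.2) P := by
    rintro ⟨d, k, j⟩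
    fin_cases j
    · simpa [Z, g] using hXS.interarrival_law d k
    · simpa [Z, g] using hXS.service_law d k
  have hmeasZ := fun q => (hlaw q).aemeasurable
  have h1 : P.map (fun ω q => Z q ω) = Measure.infinitePi fun q : ι × (ℕ × Fin 2) =>
      ![expMeasure (rate q.1), σ] q.2.2 := by
    rw [hZ.map_fun_eq_infinitePi_map₀' hmeasZ]
    congr 1
    funext q
    exact (hlaw q).map_eq
  have h2 := Measure.infinitePi_map_curry fun (d : ι) (q : ℕ × Fin 2) =>
    ![expMeasure (rate d), σ] q.2
  have h3 := Measure.infinitePi_map_pi (fun d : ι => Measure.infinitePi fun q : ℕ × Fin 2 =>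
    ![expMeasure (rate d), σ] q.2) (f := fun _ x k => (x (k, 0), x (k, 1)))
    (fun _ => by fun_prop)
  simp_rw [infinitePi_map_pathLaw (hr _) σ] at h3
  rw [← h2, ← h1, AEMeasurable.map_map_of_aemeasurable
    (MeasurableEquiv.measurable _).aemeasurable (aemeasurable_pi_lambda _ hmeasZ),
    AEMeasurable.map_map_of_aemeasurable (Measurable.aemeasurable (by fun_prop))
    ((MeasurableEquiv.measurable _).comp_aemeasurable (aemeasurable_pi_lambda _ hmeasZ)),
    Measure.infinitePi_eq_pi] at h3
  exact h3

lemma IsMG11Input.ae_isRecurrent [Fintype ι] [IsProbabilityMeasure P] [IsProbabilityMeasure σ]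
    (hr : ∀ d, 0 < rate d) (hσ : ∀ᵐ x ∂σ, 0 ≤ x) (hXS : IsMG11Input P rate σ X S) (c : ι) :
    ∀ᵐ ω ∂P, IsRecurrent c (inputPath X S ω) := by
  refine ae_of_ae_map hXS.aemeasurable_inputPath ?_
  rw [hXS.map_inputPath hr]
  exact AoI.ae_isRecurrent hr hσ c

lemma IsMG11Input.aemeasurable_age [Fintype ι] [IsProbabilityMeasure P] [IsProbabilityMeasure σ]
    (hr : ∀ d, 0 < rate d) (hσ : ∀ᵐ x ∂σ, 0 ≤ x) (hXS : IsMG11Input P rate σ X S) {U₀ : Ω → ℝ}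
    (hU₀ : AEMeasurable U₀ P) (c : ι) (t : ℝ) : AEMeasurable (age X S U₀ c t) P := by
  have hrec := hXS.ae_isRecurrent hr hσ c
  have hpath := hXS.aemeasurable_inputPath
  refine NullMeasurable.aemeasurable ?_
  refine (measurable_of_Iio (δ := NullMeasurableSpace Ω P) fun x => ?_)
  have hR : ∀ u, NullMeasurableSet (inputPath X S ⁻¹' receivedWithin c u t) P := fun u =>
    hpath.nullMeasurableSet_preimage (measurableSet_receivedWithin c u t)
  have h0 : NullMeasurableSet {ω | t - U₀ ω < x} P :=
    (hU₀.const_sub t).nullMeasurableSet_preimage measurableSet_Iio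
  refine NullMeasurableSet.congr
    (((hR 0).inter (hR (t - x))).union ((hR 0).compl.inter h0)) ?_
  filter_upwards [hrec] with ω hω
  refine propext ?_
  change (inputPath X S ω ∈ receivedWithin c 0 t ∧ inputPath X S ω ∈ receivedWithin c (t - x) t) ∨
    (inputPath X S ω ∉ receivedWithin c 0 t ∧ t - U₀ ω < x) ↔ age X S U₀ c t ω < x
  rw [age_eq hω.regular, ← hω.firstDelivery_le_iff]
  rcases le_or_gt (firstDelivery c (inputPath X S ω)) t with h | h
  · rw [hω.sysAge_lt_iff h]
    simp [h]
  · rw [hω.sysAge_of_lt h]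
    simp [not_le.2 h]

lemma IsMG11Input.isStationaryLaw_age [Fintype ι] [IsProbabilityMeasure P] [IsProbabilityMeasure σ]
    (hr : ∀ d, 0 < rate d) (hσ : ∀ᵐ x ∂σ, 0 ≤ x) (hXS : IsMG11Input P rate σ X S) {U₀ : Ω → ℝ}
    (hU₀ : AEMeasurable U₀ P) (c : ι) [IsProbabilityMeasure (ageLaw rate σ c)] :
    IsStationaryLaw P (age X S U₀ c) (ageLaw rate σ c) := by
  have hrec := hXS.ae_isRecurrent hr hσ c
  have hmeas := hXS.aemeasurable_age hr hσ hU₀ c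
  refine ⟨⟨hmeas, aemeasurable_id, ?_⟩, fun f => ?_⟩
  · refine tendsto_probabilityMeasure_of_Iio fun q => ?_
    have h := tendsto_measureReal_sysAge_lt hr hσ hXS.aemeasurable_inputPath (hXS.map_inputPath hr)
      U₀ c (q : ℝ)
    simp only [ProbabilityMeasure.coe_mk, Measure.map_id]
    refine h.congr fun t => ?_
    rw [measureReal_def, measureReal_def,
      Measure.map_apply_of_aemeasurable (hmeas t) measurableSet_Iio]
    congr 1
    refine measure_congr ?_
    filter_upwards [hrec] with ω hω
    refine propext ?_
    change sysAge (U₀ ω) c t (inputPath X S ω) < q ↔ age X S U₀ c t ω < q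
    rw [age_eq hω.regular]
  · have h := ae_tendsto_timeAverage_sysAge hr hσ c
    rw [← hXS.map_inputPath hr] at h
    filter_upwards [hrec, ae_of_ae_map hXS.aemeasurable_inputPath h] with ω hω hlim
    simp_rw [age_eq hω.regular]
    exact hlim (U₀ ω) f

end Input

end AoI

/-! ### Transfer of the moment formulas to the given probability space. -/

theorem theorem2 {ι Ω : Type*} [Fintype ι] [MeasurableSpace Ω]
    (P : Measure Ω) [IsProbabilityMeasure P]
    (rate : ι → ℝ) (hrate : ∀ c, 0 < rate c)
    (σ : Measure ℝ) [IsProbabilityMeasure σ] (hσ : ∀ᵐ x ∂σ, 0 ≤ x)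
    (X S : ι → ℕ → Ω → ℝ) (hXS : AoI.IsMG11Input P rate σ X S)
    (U₀ : Ω → ℝ) (hU₀ : AEMeasurable U₀ P) (c : ι)
    (Λ : ℝ) (hΛ : Λ = ∑ d, rate d)
    (M : ℝ → ℝ) (hM : ∀ u, M u = ∫ x, Real.exp (u * x) ∂σ)
    (L : ℝ) (hL : L = ∫ x, Real.exp (-Λ * x) ∂σ) :
    (∃ (ν : Measure ℝ) (_ : IsProbabilityMeasure ν),
      AoI.IsStationaryLaw P (AoI.age X S U₀ c) ν ∧
      ∀ s : ℝ,
        (Integrable (fun x => Real.exp (s * x)) ν ↔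
          s < Λ ∧ s < rate c * M (s - Λ)) ∧
        (s < Λ → s < rate c * M (s - Λ) →
          mgf id ν s = rate c * M (s - Λ) / (rate c * M (s - Λ) - s))) ∧
    (∀ (i : ℕ) (s : ℝ),
      (Integrable (fun ω => Real.exp (s * AoI.peakAoI X S c i ω)) P ↔
        s < Λ ∧ s < rate c * M (s - Λ)) ∧
      (s < Λ → s < rate c * M (s - Λ) →
        mgf (AoI.peakAoI X S c i) P s =
          rate c * M (s - Λ) ^ 2 / (L * (rate c * M (s - Λ) - s)))) := by
  have hν := AoI.isProbabilityMeasure_ageLaw hrate hσ c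
  have hpath := hXS.aemeasurable_inputPath
  have hrec := hXS.ae_isRecurrent hrate hσ c
  have hLM : L = M (-∑ d, rate d) := by rw [hL, hM, hΛ]
  subst hΛ
  have hMpos : ∀ s, s < ∑ d, rate d → 0 < M (s - ∑ d, rate d) := fun s hs =>
    (AoI.serviceMoment_real_mem hσ hM (sub_nonpos.2 hs.le)).1
  refine ⟨⟨AoI.ageLaw rate σ c, hν, hXS.isStationaryLaw_age hrate hσ hU₀ c, fun s => ?_⟩,
    fun i s => ?_⟩
  · have hmom : ∫⁻ x, ENNReal.ofReal (Real.exp (s * x)) ∂(AoI.ageLaw rate σ c) =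
        ∫⁻ p, ENNReal.ofReal (Real.exp (s * AoI.firstDelivery c p)) ∂(AoI.sysLaw rate σ) :=
      lintegral_map' (by fun_prop) (AoI.aemeasurable_firstDelivery hrate hσ c)
    rw [AoI.lintegral_exp_firstDelivery hrate hσ c s] at hmom
    refine ⟨?_, fun hs1 hs2 => ?_⟩
    · have h := AoI.integrable_exp_mul_iff (P := AoI.ageLaw rate σ c) (W := id) aemeasurable_id s
      simp only [id] at h
      rw [h, hmom, AoI.firstDelivery_moment_ne_top_iff hrate hσ hM c s]
    · rw [AoI.mgf_eq_toReal_lintegral aemeasurable_id s]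
      simp only [id]
      rw [hmom, AoI.firstDelivery_moment_eq hrate hσ hM c hs1 hs2, ENNReal.toReal_ofReal]
      exact div_nonneg (mul_pos (hrate c) (hMpos s hs1)).le (sub_pos.2 hs2).le
  · have hpeak : AEMeasurable (AoI.sysPeak c i) (P.map (AoI.inputPath X S)) := by
      rw [hXS.map_inputPath hrate]
      exact AoI.aemeasurable_sysPeak hrate hσ c i
    have hcongr : AoI.peakAoI X S c i =ᵐ[P] fun ω => AoI.sysPeak c i (AoI.inputPath X S ω) := by
      filter_upwards [hrec] with ω hω
      exact AoI.peakAoI_eq hω.regular c i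
    have hW : AEMeasurable (AoI.peakAoI X S c i) P :=
      (hpeak.comp_aemeasurable hpath).congr hcongr.symm
    have hmom : ∫⁻ ω, ENNReal.ofReal (Real.exp (s * AoI.peakAoI X S c i ω)) ∂P =
        ∫⁻ p, ENNReal.ofReal (Real.exp (s * AoI.sysPeak c i p)) ∂(AoI.sysLaw rate σ) := by
      rw [← hXS.map_inputPath hrate, lintegral_map' (by fun_prop) hpath]
      refine lintegral_congr_ae ?_
      filter_upwards [hcongr] with ω hω
      rw [hω]
    rw [AoI.lintegral_exp_sysPeak hrate hσ c i s] at hmom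
    refine ⟨?_, fun hs1 hs2 => ?_⟩
    · rw [AoI.integrable_exp_mul_iff hW s, hmom, AoI.sysPeak_moment_ne_top_iff hrate hσ hM c s]
    · rw [AoI.mgf_eq_toReal_lintegral hW s, hmom, AoI.sysPeak_moment_eq hrate hσ hM c hs1 hs2, hLM,
        ENNReal.toReal_ofReal]
      have hM0 : 0 ≤ M (-∑ d, rate d) := (AoI.serviceMoment_real_mem hσ hM
        (neg_nonpos.2 (Finset.sum_nonneg fun d _ => (hrate d).le))).1.le
      exact div_nonneg (mul_nonneg (hrate c).le (sq_nonneg _)) (mul_nonneg hM0 (sub_pos.2 hs2).le)
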